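/- Let $\mathbb F$ be any field. For $k\ge 1$ let $$T_k=\sum_{\substack{S,T,U\in\binom{[3k]}{k}\\ S\cup T\cup U=[3k]}}X_S\,Y_T\,Z_U ,$$ regarded as a trilinear form over $\mathbb F$ in three disjoint sets of $\binom{3k}{k}$ variables, and let $\mathbf R(T_k)$ be its tensor rank over $\mathbb F$: the least $r$ such that $T_k$ is an $\mathbb F$-linear combination of $r$ products $\big(\sum_S a_SX_S\big)\big(\sum_T b_TY_T\big)\big(\sum_U c_UZ_U\big)$. For $s\in\mathbb N$, the $s$-set cover problem is: given $n,t\in\mathbb N$ and a family $\mathcal F$ of subsets of $[n]$, each of size at most $s$, decide whether some at most $t$ sets of $\mathcal F$ have union $[n]$. The set cover conjecture says that for every $\varepsilon>0$ there is an $s\in\mathbb N$ such that no randomized algorithm (random access machine with logarithmic cost and fair coin tosses, error probability at most $1/3$ on every input) solves $s$-set cover in time $2^{(1-\varepsilon)n}$, up to factors polynomial in the input length, for all outcomes of the coin tosses. If the set cover conjecture is true, then for every integer $k\ge 1$, $$\mathbf R(T_k)\;\ge\; \frac{8^k\binom{3k}{k}\binom{2k}{k}}{27^k}\;\ge\;\frac29\cdot\frac{8^k}{k}.$$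 Consequently, if $\mathbf R(T_k)\le \frac{2}{9k}\,8^k$ holds for even a single $k\ge1$, then the set cover conjecture is false. -/

import Mathlib

open MeasureTheory

/-! ### Trilinear forms, tensor rank, and the tensors `T_k` -/

/-- A tensor over `F` of dimension `|ι|`: a trilinear form on `F^ι × F^ι × F^ι`. -/
abbrev Trilinear (F ι : Type*) [Field F] : Type _ :=
  (ι → F) →ₗ[F] (ι → F) →ₗ[F] (ι → F) →ₗ[F] F

/-- The product of three linear forms in disjoint sets of variables, that is, the trilinear form
`(x, y, z) ↦ f x * g y * h z`. -/
def Trilinear.ofForms {F ι : Type*} [Field F] (f g h : (ι → F) →ₗ[F] F) : Trilinear F ι :=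
  f.smulRight (g.smulRight h)

/-- The linear form `∑ i, a i * X i`. -/
def linForm {F ι : Type*} [Field F] [Fintype ι] (a : ι → F) : (ι → F) →ₗ[F] F :=
  ∑ i, a i • LinearMap.proj i

/-- `T = (∑ a_i X_i) (∑ b_i Y_i) (∑ c_i Z_i)` for some `a, b, c`. -/
def Trilinear.IsRankOne {F ι : Type*} [Field F] [Fintype ι] (T : Trilinear F ι) : Prop :=
  ∃ a b c : ι → F, T = Trilinear.ofForms (linForm a) (linForm b) (linForm c)

/-- The tensor rank: the least `r` such that `T` is a linear combination of `r` rank-one tensors. -/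
noncomputable def Trilinear.rank {F ι : Type*} [Field F] [Fintype ι] (T : Trilinear F ι) : ℕ :=
  sInf {r : ℕ | ∃ (coeff : Fin r → F) (A : Fin r → Trilinear F ι),
    (∀ i, (A i).IsRankOne) ∧ T = ∑ i, coeff i • A i}

/-- The `k`-element subsets of a set of `3k` elements. -/
abbrev ThirdSubset (k : ℕ) : Type := {S : Finset (Fin (3 * k)) // S.card = k}

/-- The tensor `T_k`, the sum of the monomials `X_S Y_T Z_U` over all triples of `k`-element
subsets of `[3k]` with `S ∪ T ∪ U = [3k]`. -/
def tripartitionTensor (F : Type*) [Field F] (k : ℕ) : Trilinear F (ThirdSubset k) :=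
  ∑ S : ThirdSubset k, ∑ T : ThirdSubset k, ∑ U : ThirdSubset k,
    if S.1 ∪ T.1 ∪ U.1 = Finset.univ then
      Trilinear.ofForms (LinearMap.proj S) (LinearMap.proj T) (LinearMap.proj U)
    else 0

/-! ### Randomized random access machines with logarithmic cost

The memory consists of arrays `0, 1, 2, …`, each of which is an infinite sequence of registers
holding natural numbers. Array names in a program are constants, so a program uses finitely many
arrays; indices into an array are computed (indirect addressing). Every operation is charged one
unit plus the binary length of the number that it produces or moves. -/

/-- The contents of the memory: `m a i` is the content of register `i` of array `a`. -/
abbrev Memory : Type := ℕ → ℕ → ℕ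

/-- Arithmetic expressions. -/
inductive RExpr : Type
  | lit (v : ℕ)
  | get (a : ℕ) (i : RExpr)
  | add (e f : RExpr)
  | sub (e f : RExpr)
  | mul (e f : RExpr)
  | div (e f : RExpr)

/-- The value of an expression; subtraction is truncated at `0`, division is rounded down
(and division by `0` gives `0`). -/
def RExpr.eval (m : Memory) : RExpr → ℕ
  | .lit v => v
  | .get a i => m a (i.eval m)
  | .add e f => e.eval m + f.eval m
  | .sub e f => e.eval m - f.eval m
  | .mul e f => e.eval m * f.eval m
  | .div e f => e.eval m / f.eval m

/-- The cost of evaluating an expression: every node costs one unit plus the binary length of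
its value. -/
def RExpr.cost (m : Memory) : RExpr → ℕ
  | .lit v => 1 + v.size
  | .get a i => i.cost m + (1 + (m a (i.eval m)).size)
  | .add e f => e.cost m + f.cost m + (1 + (e.eval m + f.eval m).size)
  | .sub e f => e.cost m + f.cost m + (1 + (e.eval m - f.eval m).size)
  | .mul e f => e.cost m + f.cost m + (1 + (e.eval m * f.eval m).size)
  | .div e f => e.cost m + f.cost m + (1 + (e.eval m / f.eval m).size)

/-- Programs. -/
inductive RProg : Type
  /-- do nothing -/
  | skip
  /-- store the value of `e` in register `i` of array `a` -/
  | store (a : ℕ) (i e : RExpr)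
  /-- toss a fair coin and store the result (`0` or `1`) in register `i` of array `a` -/
  | toss (a : ℕ) (i : RExpr)
  /-- first `p`, then `q` -/
  | seq (p q : RProg)
  /-- `p` if `e ≠ 0`, otherwise `q` -/
  | cond (e : RExpr) (p q : RProg)
  /-- repeat `p` as long as `e ≠ 0` -/
  | loop (e : RExpr) (p : RProg)

/-- The memory together with the number of coins tossed so far. -/
structure RState : Type where
  mem : Memory
  tossed : ℕ

/-- The memory `m` with the content of register `i` of array `a` replaced by `v`. -/
def Memory.write (m : Memory) (a i v : ℕ) : Memory :=
  Function.update m a (Function.update (m a) i v)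

/-- `Exec ω p σ σ' c`: if the outcomes of the coin tosses are `ω 0, ω 1, …`, then the program `p`,
started in state `σ`, halts in state `σ'`, at total cost `c`. -/
inductive Exec (ω : ℕ → Bool) : RProg → RState → RState → ℕ → Prop
  | skip (σ : RState) : Exec ω .skip σ σ 1
  | store (a : ℕ) (i e : RExpr) (σ : RState) :
      Exec ω (.store a i e) σ
        ⟨σ.mem.write a (i.eval σ.mem) (e.eval σ.mem), σ.tossed⟩
        (1 + i.cost σ.mem + e.cost σ.mem)
  | toss (a : ℕ) (i : RExpr) (σ : RState) :
      Exec ω (.toss a i) σ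
        ⟨σ.mem.write a (i.eval σ.mem) (ω σ.tossed).toNat, σ.tossed + 1⟩
        (1 + i.cost σ.mem)
  | seq {p q : RProg} {σ₁ σ₂ σ₃ : RState} {c d : ℕ} :
      Exec ω p σ₁ σ₂ c → Exec ω q σ₂ σ₃ d → Exec ω (.seq p q) σ₁ σ₃ (c + d)
  | cond_true {e : RExpr} {p q : RProg} {σ σ' : RState} {c : ℕ} :
      e.eval σ.mem ≠ 0 → Exec ω p σ σ' c → Exec ω (.cond e p q) σ σ' (1 + e.cost σ.mem + c)
  | cond_false {e : RExpr} {p q : RProg} {σ σ' : RState} {c : ℕ} :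
      e.eval σ.mem = 0 → Exec ω q σ σ' c → Exec ω (.cond e p q) σ σ' (1 + e.cost σ.mem + c)
  | loop_true {e : RExpr} {p : RProg} {σ₁ σ₂ σ₃ : RState} {c d : ℕ} :
      e.eval σ₁.mem ≠ 0 → Exec ω p σ₁ σ₂ c → Exec ω (.loop e p) σ₂ σ₃ d →
        Exec ω (.loop e p) σ₁ σ₃ (1 + e.cost σ₁.mem + c + d)
  | loop_false {e : RExpr} {p : RProg} {σ : RState} :
      e.eval σ.mem = 0 → Exec ω (.loop e p) σ σ (1 + e.cost σ.mem)

/-- The distribution of an infinite sequence of independent tosses of a fair coin. -/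
noncomputable def coinMeasure : Measure (ℕ → Bool) :=
  Measure.infinitePi fun _ : ℕ => (PMF.uniformOfFintype Bool).toMeasure

/-! ### Set cover -/

/-- An instance of set cover: a universe `[n]`, a bound `t`, and a family of subsets of `[n]`,
listed in some order without repetitions. -/
structure SetCoverInstance : Type where
  n : ℕ
  t : ℕ
  fam : List (Finset (Fin n))
  nodup : fam.Nodup

namespace SetCoverInstance

/-- At most `t` sets of the family have union `[n]`. -/
def IsYes (I : SetCoverInstance) : Prop :=
  ∃ G : Finset (Finset (Fin I.n)), (∀ X ∈ G, X ∈ I.fam) ∧ G.card ≤ I.t ∧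
    G.biUnion id = Finset.univ

/-- The input: array `0` starts with `n`, `t` and the number of sets, and array `1` holds the
incidence matrix of the family, row by row. All other registers are `0`. -/
def input (I : SetCoverInstance) : Memory
  | 0, 0 => I.n
  | 0, 1 => I.t
  | 0, 2 => I.fam.length
  | 1, p => if ∃ (i : Fin I.fam.length) (j : Fin I.n),
      p = (i : ℕ) * I.n + (j : ℕ) ∧ j ∈ I.fam.get i then 1 else 0
  | _, _ => 0

/-- The input length, up to constant factors. -/
def length (I : SetCoverInstance) : ℕ :=
  (I.n + 1) * (I.fam.length + 1) + I.t.size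

end SetCoverInstance

/-- Under the coin tosses `ω`, the program `p` halts on the instance `I` and accepts it, that is,
leaves `1` in register `0` of array `0`. -/
def RProg.Accepts (p : RProg) (I : SetCoverInstance) (ω : ℕ → Bool) : Prop :=
  ∃ (σ : RState) (c : ℕ), Exec ω p ⟨I.input, 0⟩ σ c ∧ σ.mem 0 0 = 1

/-- The randomized algorithm `p` solves `s`-set cover, with error probability at most `1/3`, and
its running time is at most `2 ^ ((1 - ε) n)` up to a factor polynomial in the input length,
whatever the outcomes of the coin tosses. -/
def RProg.SolvesSetCover (p : RProg) (s : ℕ) (ε : ℝ) : Prop :=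
  (∀ I : SetCoverInstance, (∀ X ∈ I.fam, X.card ≤ s) →
    (I.IsYes → 2 / 3 ≤ coinMeasure {ω | p.Accepts I ω}) ∧
    (¬ I.IsYes → coinMeasure {ω | p.Accepts I ω} ≤ 1 / 3)) ∧
  ∃ C d : ℕ, ∀ I : SetCoverInstance, (∀ X ∈ I.fam, X.card ≤ s) →
    ∀ ω : ℕ → Bool, ∃ (σ : RState) (c : ℕ), Exec ω p ⟨I.input, 0⟩ σ c ∧
      (c : ℝ) ≤ C * (I.length : ℝ) ^ d * (2 : ℝ) ^ ((1 - ε) * (I.n : ℝ))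

/-- The set cover conjecture: for every `ε > 0` there is an `s` such that no randomized algorithm
solves `s`-set cover in time `2 ^ ((1 - ε) n)`. -/
def SetCoverConjecture : Prop :=
  ∀ ε : ℝ, 0 < ε → ∃ s : ℕ, ¬ ∃ p : RProg, p.SolvesSetCover s ε

/-! ### A cost-aware program logic for the random access machine -/

namespace RExpr

/-! The proof is by contraposition: a decomposition of `T_k` into too few rank-one terms gives, for
every `s`, an algorithm for `s`-set cover in time `2 ^ (c n)` up to polynomial factors, with a
constant `c < 1` that does not depend on `s`. Let `τ = triCount k` be the number of ordered
partitions of `[3k]` into three `k`-sets and let `r` be the rank; the assumption is `r * 27 ^ k < 8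
^ k * τ`.

The field may be taken finite. The coefficients of the decomposition generate a finitely generated
ring, such a ring maps to a finite field, and the identities to be preserved only involve the values
`0` and `1` (`exists_finite_field_decomposition`). Field operations then become finite tables in the
program.

Arrange the universe, padded to `3km ≥ n + 2s` elements, in `m` blocks of size `3k`. A cover by sets
of size at most `s` can be cut greedily into three partial covers of sets of size at most `km`
(`Covered.split_three`), and padding gives a balanced three-colouring of the positions. A random
permutation balances it on every block with probability about `(τ / 27 ^ k) ^ m`
(`card_balancingPerms`, `le_prob_shuffle_mem`). If it does, the colour classes index a nonzero
coefficient of the `m`-th tensor power of `T_k`. Evaluate this power at random zero-one vectors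
supported on sets with covering numbers at most `j₁`, `j₂` and `t - j₁ - j₂`. A nonzero value proves
that a cover exists (`isYes_of_trialValue_ne_zero`), and a relevant nonzero coefficient makes the
value nonzero with probability at least `1/8` (`eighth_le_prob_trilinear`).

The tensor power has a decomposition into `r ^ m` terms, and Yates's algorithm evaluates it in about
`r ^ m` steps (`yatesValue_succ`, `sum_partialTransform`). Repeating `(27 ^ k / τ) ^ m` times costs
`(27 ^ k * r / τ) ^ m`; tabulating covering numbers of sets of size at most `km` costs `(27 / 4) ^
(km)` (`smallSubsetCount_le_pow`), all up to polynomial factors. Both bases are below `8 ^ k` per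
block of `3k` elements (`growth_lt`), which gives the exponent below `1`.

The algorithm is an explicit program, and `WP` tracks its correctness, register size and cost
together. The explicit lower bound for `τ` is an induction (`two_mul_pow_le`); divisibility by `3`
supplies the strict inequality needed in the last claim (`nine_mul_ne`). -/

instance : Add RExpr := ⟨.add⟩
instance : Sub RExpr := ⟨.sub⟩
instance : Mul RExpr := ⟨.mul⟩
instance : Div RExpr := ⟨.div⟩
instance : Mod RExpr := ⟨fun e f => e - e / f * f⟩
instance (v : ℕ) : OfNat RExpr v := ⟨.lit v⟩

/-- The scalar variable stored in register `0` of array `a`. -/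
abbrev var (a : ℕ) : RExpr := .get a (.lit 0)

@[simp] theorem eval_add (m : Memory) (e f : RExpr) : (e + f).eval m = e.eval m + f.eval m := rfl
@[simp] theorem eval_sub (m : Memory) (e f : RExpr) : (e - f).eval m = e.eval m - f.eval m := rfl
@[simp] theorem eval_mul (m : Memory) (e f : RExpr) : (e * f).eval m = e.eval m * f.eval m := rfl
@[simp] theorem eval_div (m : Memory) (e f : RExpr) : (e / f).eval m = e.eval m / f.eval m := rfl
@[simp] theorem eval_mod (m : Memory) (e f : RExpr) : (e % f).eval m = e.eval m % f.eval m := by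
  change e.eval m - e.eval m / f.eval m * f.eval m = _
  rw [Nat.mod_def, Nat.mul_comm]
@[simp] theorem eval_lit (m : Memory) (v : ℕ) : (RExpr.lit v).eval m = v := rfl
@[simp] theorem eval_ofNat (m : Memory) (v : ℕ) : (no_index (OfNat.ofNat v) : RExpr).eval m = v :=
  rfl
@[simp] theorem eval_get (m : Memory) (a : ℕ) (i : RExpr) : (RExpr.get a i).eval m = m a (i.eval m) := rfl

/-- A bound for the binary length of the value of an expression, relative to the register size. -/
def deg : RExpr → ℕ
  | .lit v => v.size
  | .get _ _ => 1
  | .add e f => e.deg + f.deg + 1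
  | .sub e _ => e.deg
  | .mul e f => e.deg + f.deg
  | .div e _ => e.deg

/-- A bound for the cost of evaluating an expression, relative to the register size. -/
def weight : RExpr → ℕ
  | .lit v => 1 + v.size
  | .get _ i => i.weight + 2
  | .add e f => e.weight + f.weight + (e.deg + f.deg + 2)
  | .sub e f => e.weight + f.weight + (e.deg + 1)
  | .mul e f => e.weight + f.weight + (e.deg + f.deg + 1)
  | .div e f => e.weight + f.weight + (e.deg + 1)

/-- Products add binary lengths and sums add at most one bit to the sum of the lengths. The unit is
`L + 1` rather than `L` so that literals and carries are covered even for `L = 0`. -/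
theorem eval_lt {L : ℕ} {m : Memory} (hm : ∀ a i, m a i < 2 ^ L) (e : RExpr) :
    e.eval m < 2 ^ (e.deg * (L + 1)) := by
  induction e with
  | lit v =>
    refine (Nat.lt_size_self v).trans_le (Nat.pow_le_pow_right (by norm_num) ?_)
    exact Nat.le_mul_of_pos_right _ (Nat.succ_pos L)
  | get a i _ =>
    refine (hm a _).trans_le (Nat.pow_le_pow_right (by norm_num) ?_)
    simp [deg]
  | add e f he hf =>
    simp only [eval, deg]
    calc e.eval m + f.eval m < 2 ^ (e.deg * (L + 1)) + 2 ^ (f.deg * (L + 1)) := by omega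
      _ ≤ 2 ^ ((e.deg + f.deg) * (L + 1)) + 2 ^ ((e.deg + f.deg) * (L + 1)) := by
          gcongr <;> omega
      _ = 2 ^ ((e.deg + f.deg) * (L + 1) + 1) := by ring
      _ ≤ _ := Nat.pow_le_pow_right (by norm_num) (by nlinarith)
  | sub e f he _ => exact (Nat.sub_le _ _).trans_lt he
  | mul e f he hf =>
    simp only [eval, deg, add_mul, pow_add]
    exact Nat.mul_lt_mul'' he hf
  | div e f he _ => exact (Nat.div_le_self _ _).trans_lt he

/-- With registers of `L` bits a fixed expression costs `O(L)`. Hence logarithmic cost exceeds the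
number of executed steps only by a factor linear in the register size. -/
theorem cost_le {L : ℕ} {m : Memory} (hm : ∀ a i, m a i < 2 ^ L) (e : RExpr) :
    e.cost m ≤ e.weight * (L + 1) := by
  have key : ∀ e : RExpr, 1 + (e.eval m).size ≤ (e.deg + 1) * (L + 1) := fun e => by
    have := Nat.size_le.2 (eval_lt hm e)
    nlinarith
  induction e with
  | lit v => simp only [cost, weight]; exact Nat.le_mul_of_pos_right _ (Nat.succ_pos L)
  | get a i hi => have := key (.get a i); simp only [cost, weight, deg, eval] at *; linarith
  | add e f he hf => have := key (.add e f); simp only [cost, weight, deg, eval] at *; linarith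
  | sub e f he hf => have := key (.sub e f); simp only [cost, weight, deg, eval] at *; linarith
  | mul e f he hf => have := key (.mul e f); simp only [cost, weight, deg, eval] at *; linarith
  | div e f he hf => have := key (.div e f); simp only [cost, weight, deg, eval] at *; linarith

end RExpr

namespace Memory

@[simp] theorem write_same (m : Memory) (a i v : ℕ) : m.write a i v a i = v := by
  simp [Memory.write]

@[simp] theorem write_of_ne (m : Memory) {a b : ℕ} (i v : ℕ) (h : b ≠ a) :
    m.write a i v b = m b := by
  simp [Memory.write, h]

theorem write_index (m : Memory) (a i v j : ℕ) :
    m.write a i v a j = if j = i then v else m a j := by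
  simp [Memory.write, Function.update_apply]

end Memory

/-! ### Rules for programs: framing, assignment, composition, loops -/

namespace RProg

/-- The arrays that a program may modify. -/
def writes : RProg → List ℕ
  | .skip => []
  | .store a _ _ => [a]
  | .toss a _ => [a]
  | .seq p q => p.writes ++ q.writes
  | .cond _ p q => p.writes ++ q.writes
  | .loop _ p => p.writes

/-- The cost, relative to the register size, of executing every part of a program once. -/
def weight : RProg → ℕ
  | .skip => 1
  | .store _ i e => 1 + i.weight + e.weight
  | .toss _ i => 1 + i.weight
  | .seq p q => p.weight + q.weight
  | .cond e p q => 1 + e.weight + p.weight + q.weight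
  | .loop e p => 1 + e.weight + p.weight

/-- Run `body` for the values `0, 1, …, bound - 1` of the variable `i`. -/
def forLoop (i : ℕ) (bound : RExpr) (body : RProg) : RProg :=
  .seq (.store i 0 0) (.loop (bound - .var i) (.seq body (.store i 0 (.var i + 1))))

/-- Assignment to a scalar variable. -/
abbrev set (a : ℕ) (e : RExpr) : RProg := .store a 0 e

infixr:60 ";;" => RProg.seq

/-- Array names are constants of the program text, so what a program can modify is known
syntactically. No other aliasing information is used later. -/
theorem _root_.Exec.frame {ω : ℕ → Bool} {p : RProg} {σ σ' : RState} {c : ℕ}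
    (h : Exec ω p σ σ' c) {a : ℕ} (ha : a ∉ p.writes) : σ'.mem a = σ.mem a := by
  induction h <;> simp_all [writes]

/-- Started with memory `m` after `t` coin tosses, with all registers below `2 ^ L`, the program
halts in a state that satisfies `Q`, all registers are again below `2 ^ L`, and the cost is at most
`X` times that of a single execution of each part of the program. -/
def WP (ω : ℕ → Bool) (L X : ℕ) (p : RProg) (m : Memory) (t : ℕ) (Q : Memory → ℕ → Prop) : Prop :=
  (∀ a i, m a i < 2 ^ L) → ∃ m' t' c, Exec ω p ⟨m, t⟩ ⟨m', t'⟩ c ∧ c ≤ p.weight * X * (L + 1) ∧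
    (∀ a i, m' a i < 2 ^ L) ∧ Q m' t'

variable {ω : ℕ → Bool} {L X Y : ℕ} {p q : RProg} {m : Memory} {t : ℕ} {Q R : Memory → ℕ → Prop}

theorem WP.mono (h : WP ω L X p m t Q) (hQ : ∀ m' t', Q m' t' → R m' t') : WP ω L X p m t R := by
  intro hm
  obtain ⟨m', t', c, h1, h2, h3, h4⟩ := h hm
  exact ⟨m', t', c, h1, h2, h3, hQ _ _ h4⟩

theorem WP.frame (h : WP ω L X p m t Q) :
    WP ω L X p m t fun m' t' => Q m' t' ∧ ∀ a, a ∉ p.writes → m' a = m a := by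
  intro hm
  obtain ⟨m', t', c, h1, h2, h3, h4⟩ := h hm
  exact ⟨m', t', c, h1, h2, h3, h4, fun a ha => h1.frame ha⟩

theorem wp_skip (hX : 1 ≤ X) (hQ : Q m t) : WP ω L X .skip m t Q := by
  intro hm
  refine ⟨m, t, _, .skip _, ?_, hm, hQ⟩
  simp only [weight]; nlinarith

theorem wp_store {a : ℕ} {i e : RExpr} (hX : 1 ≤ X) (hv : e.eval m < 2 ^ L)
    (hQ : Q (m.write a (i.eval m) (e.eval m)) t) : WP ω L X (.store a i e) m t Q := by
  intro hm
  refine ⟨_, _, _, .store a i e ⟨m, t⟩, ?_, ?_, hQ⟩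
  · have h1 := i.cost_le hm
    have h2 := e.cost_le hm
    simp only [weight]
    calc 1 + i.cost m + e.cost m ≤ (1 + i.weight + e.weight) * 1 * (L + 1) := by nlinarith
      _ ≤ _ := by gcongr
  · intro b j
    by_cases hb : b = a
    · subst hb; simp only [Memory.write_index]; split_ifs; exacts [hv, hm _ _]
    · simpa [hb] using hm b j

theorem wp_toss {a : ℕ} {i : RExpr} (hX : 1 ≤ X) (hL : 1 ≤ L)
    (hQ : Q (m.write a (i.eval m) (ω t).toNat) (t + 1)) : WP ω L X (.toss a i) m t Q := by
  intro hm
  refine ⟨_, _, _, .toss a i ⟨m, t⟩, ?_, ?_, hQ⟩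
  · have h1 := i.cost_le hm
    simp only [weight]
    calc 1 + i.cost m ≤ (1 + i.weight) * 1 * (L + 1) := by nlinarith
      _ ≤ _ := by gcongr
  · intro b j
    by_cases hb : b = a
    · subst hb; simp only [Memory.write_index]; split_ifs
      · exact (Bool.toNat_lt _).trans_le (Nat.pow_le_pow_right (by norm_num) hL : 2 ^ 1 ≤ 2 ^ L)
      · exact hm _ _
    · simpa [hb] using hm b j

theorem wp_seq (h : WP ω L X p m t fun m' t' => WP ω L X q m' t' Q) : WP ω L X (p ;; q) m t Q := by
  intro hm
  obtain ⟨m', t', c, h1, h2, h3, h4⟩ := h hm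
  obtain ⟨m'', t'', d, h5, h6, h7, h8⟩ := h4 h3
  exact ⟨m'', t'', _, .seq h1 h5, by simp only [weight]; linarith, h7, h8⟩

/-- Sequential composition, remembering what the first program leaves alone. -/
theorem wp_seq_frame {P : Memory → ℕ → Prop} (h : WP ω L X p m t P)
    (hq : ∀ m' t', (∀ a, a ∉ p.writes → m' a = m a) → P m' t' → WP ω L X q m' t' Q) :
    WP ω L X (p ;; q) m t Q :=
  wp_seq (h.frame.mono fun m' t' ⟨h1, h2⟩ => hq m' t' h2 h1)

/-- Only the multiplier grows, from `X` to `X * (N + 1)`; the extra `1` pays for the initialisation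
and the final test. The bound must be unaffected by the loop and the invariant must not mention the
counter. -/
theorem wp_forLoop {i : ℕ} {bound : RExpr} (N : ℕ) (Inv : ℕ → Memory → ℕ → Prop)
    (hi : i ∉ p.writes) (hX : 1 ≤ X)
    (hN : ∀ m' : Memory, (∀ a, a ∉ (forLoop i bound p).writes → m' a = m a) →
      bound.eval m' = N)
    (hNL : N < 2 ^ L)
    (hInv : ∀ j m' t' v, Inv j m' t' → Inv j (m'.write i 0 v) t')
    (h0 : Inv 0 m t)
    (hs : ∀ j m' t', j < N → m' i 0 = j →
      (∀ a, a ∉ (forLoop i bound p).writes → m' a = m a) → Inv j m' t' →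
      WP ω L X p m' t' (Inv (j + 1)))
    (hY : X * (N + 1) ≤ Y)
    (hQ : ∀ m' t', Inv N m' t' → (∀ a, a ∉ (forLoop i bound p).writes → m' a = m a) → Q m' t') :
    WP ω L Y (forLoop i bound p) m t Q := by
  have hw : ∀ a, a ∉ (forLoop i bound p).writes ↔ a ≠ i ∧ a ∉ p.writes := by
    intro a; simp [forLoop, writes]; tauto
  have hpos : 0 < 2 ^ L := by positivity
  -- By truncated subtraction this is nonzero exactly while the counter is below the bound.
  set e : RExpr := bound - .var i with he
  -- The induction is on the number `d` of remaining rounds; the summand outside the factor `d` pays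
  -- for the test that ends the loop.
  have main : ∀ d j m' t', j + d = N → m' i 0 = j →
      (∀ a, a ∉ (forLoop i bound p).writes → m' a = m a) → Inv j m' t' →
      (∀ a i, m' a i < 2 ^ L) →
      ∃ m'' t'' c, Exec ω (.loop e (p ;; set i (.var i + 1))) ⟨m', t'⟩ ⟨m'', t''⟩ c ∧
        c ≤ (d * (1 + e.weight + (p ;; set i (.var i + 1)).weight) + (1 + e.weight)) *
          (X * (L + 1)) ∧
        (∀ a i, m'' a i < 2 ^ L) ∧ Inv N m'' t'' ∧
        (∀ a, a ∉ (forLoop i bound p).writes → m'' a = m a) := by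
    intro d
    induction d with
    | zero =>
      intro j m' t' hj hij hfr hI hm
      obtain rfl : j = N := by omega
      refine ⟨m', t', _, .loop_false ?_, ?_, hm, hI, hfr⟩
      · simp [he, hN m' hfr, hij]
      · have := e.cost_le hm
        simp only
        have hXL : L + 1 ≤ X * (L + 1) := by nlinarith
        nlinarith
    | succ d ih =>
      intro j m' t' hj hij hfr hI hm
      have hb := wp_seq (q := set i (.var i + 1)) (Q := fun m'' t'' => m'' i 0 = j + 1 ∧
          (∀ a, a ∉ (forLoop i bound p).writes → m'' a = m a) ∧ Inv (j + 1) m'' t'')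
        (((hs j m' t' (by omega) hij hfr hI).frame).mono (by
          rintro m'' t'' ⟨hI', hfr'⟩
          have h1 : m'' i 0 = j := by rw [hfr' i hi, hij]
          refine wp_store hX ?_ ⟨?_, ?_, ?_⟩
          · simp [h1]; omega
          · simp [h1]
          · intro a ha
            have := (hw a).1 ha
            rw [Memory.write_of_ne _ _ _ this.1, hfr' a this.2, hfr a ha]
          · exact hInv _ _ _ _ hI'))
      obtain ⟨m1, t1, c1, hx1, hc1, hm1, h11, h12, h13⟩ := hb hm
      obtain ⟨m2, t2, c2, hx2, hc2, hm2, hI2, hf2⟩ := ih (j + 1) m1 t1 (by omega) h11 h12 h13 hm1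
      refine ⟨m2, t2, _, .loop_true ?_ hx1 hx2, ?_, hm2, hI2, hf2⟩
      · simp only [he, RExpr.eval_sub, hN m' hfr, RExpr.eval_get, RExpr.eval_lit, hij]; omega
      · have := e.cost_le hm
        have hXL : L + 1 ≤ X * (L + 1) := by nlinarith
        simp only
        nlinarith
  intro hm
  have hm0 : ∀ a j, (m.write i 0 0) a j < 2 ^ L := by
    intro b j
    by_cases hb : b = i
    · subst hb; simp only [Memory.write_index]; split_ifs; exacts [hpos, hm _ _]
    · simpa [hb] using hm b j
  obtain ⟨m2, t2, c2, hx2, hc2, hm2, hI2, hf2⟩ := main N 0 (m.write i 0 0) t (by omega) (by simp)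
    (fun a ha => by rw [Memory.write_of_ne _ _ _ ((hw a).1 ha).1]) (hInv _ _ _ _ h0) hm0
  refine ⟨m2, t2, _, .seq (.store i 0 0 ⟨m, t⟩) hx2, ?_, hm2, hQ _ _ hI2 hf2⟩
  refine le_trans ?_ (Nat.mul_le_mul_right _ (Nat.mul_le_mul_left _ hY))
  have e1 := (0 : RExpr).cost_le hm
  have e2 : (forLoop i bound p).weight = 1 + (0 : RExpr).weight + (0 : RExpr).weight +
    (1 + e.weight + (p ;; set i (.var i + 1)).weight) := rfl
  rw [e2]
  have hXL : L + 1 ≤ X * (L + 1) := by nlinarith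
  generalize hZ : X * (L + 1) = Z at *
  generalize (p ;; set i (.var i + 1)).weight = w at *
  simp only
  have : (1 + (0 : RExpr).weight + (0 : RExpr).weight + (1 + e.weight + w)) * (X * (N + 1)) * (L + 1)
      = (1 + (0 : RExpr).weight + (0 : RExpr).weight + (1 + e.weight + w)) * (N + 1) * Z := by
    rw [← hZ]; ring
  rw [this]
  generalize (0 : RExpr).weight = z at *
  generalize (0 : RExpr).cost m = y at *
  have h3 : (1 + z + z) * (L + 1) ≤ (1 + z + z) * ((N + 1) * Z) := by
    gcongr; nlinarith
  nlinarith

end RProg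

universe u

/-! ### Rank decompositions over finite fields -/

theorem linForm_single {F ι : Type*} [Field F] [Fintype ι] [DecidableEq ι] (a : ι → F) (i : ι) :
    linForm a (Pi.single i 1) = a i := by
  simp [linForm, LinearMap.sum_apply, Pi.single_apply]

theorem tripartitionTensor_single (F : Type*) [Field F] (k : ℕ) (S T U : ThirdSubset k) :
    tripartitionTensor F k (Pi.single S 1) (Pi.single T 1) (Pi.single U 1) =
      if S.1 ∪ T.1 ∪ U.1 = Finset.univ then 1 else 0 := by
  have h : ∀ S' T' U' : ThirdSubset k,
      (if S'.1 ∪ T'.1 ∪ U'.1 = Finset.univ then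
        (Trilinear.ofForms (LinearMap.proj S') (LinearMap.proj T') (LinearMap.proj U') :
          Trilinear F (ThirdSubset k))
      else 0) (Pi.single S 1) (Pi.single T 1) (Pi.single U 1) =
      if S' = S then if T' = T then if U' = U then
        (if S.1 ∪ T.1 ∪ U.1 = Finset.univ then (1 : F) else 0) else 0 else 0 else 0 := by
    intro S' T' U'
    by_cases h1 : S' = S
    · by_cases h2 : T' = T
      · by_cases h3 : U' = U
        · subst h1 h2 h3
          simp only [if_true]
          split_ifs <;> simp [Trilinear.ofForms]
        · rw [if_pos h1, if_pos h2, if_neg h3]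
          split_ifs <;> simp [Trilinear.ofForms, h3]
      · rw [if_pos h1, if_neg h2]
        split_ifs <;> simp [Trilinear.ofForms, h2]
    · rw [if_neg h1]
      split_ifs <;> simp [Trilinear.ofForms, h1]
  simp only [tripartitionTensor, LinearMap.sum_apply, h]
  simp

/-- The infimum in `Trilinear.rank` is therefore over a nonempty set and is attained, instead of
being the default value `0`. The decomposition has one term per monomial. -/
theorem tripartitionTensor_exists_decomposition (F : Type*) [Field F] (k : ℕ) :
    ∃ (r : ℕ) (coeff : Fin r → F) (A : Fin r → Trilinear F (ThirdSubset k)),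
      (∀ i, (A i).IsRankOne) ∧ tripartitionTensor F k = ∑ i, coeff i • A i := by
  classical
  let P := ThirdSubset k × ThirdSubset k × ThirdSubset k
  let e : P ≃ Fin (Fintype.card P) := Fintype.equivFin P
  refine ⟨Fintype.card P,
    fun i => if (e.symm i).1.1 ∪ (e.symm i).2.1.1 ∪ (e.symm i).2.2.1 = Finset.univ then 1 else 0,
    fun i => Trilinear.ofForms (linForm (Pi.single (e.symm i).1 1))
      (linForm (Pi.single (e.symm i).2.1 1)) (linForm (Pi.single (e.symm i).2.2 1)),
    fun i => ⟨_, _, _, rfl⟩, ?_⟩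
  rw [Equiv.sum_comp e.symm (fun p : P =>
    (if p.1.1 ∪ p.2.1.1 ∪ p.2.2.1 = Finset.univ then (1 : F) else 0) •
      (Trilinear.ofForms (linForm (Pi.single p.1 1)) (linForm (Pi.single p.2.1 1))
        (linForm (Pi.single p.2.2 1)) : Trilinear F (ThirdSubset k)))]
  have hl : ∀ S : ThirdSubset k, linForm (Pi.single S (1 : F)) = LinearMap.proj S := by
    intro S
    simp only [linForm, Pi.single_apply, ite_smul, one_smul, zero_smul]
    simp
  simp only [P, Fintype.sum_prod_type, hl, ite_smul, one_smul, zero_smul]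
  rfl

/-- Evaluation at unit vectors turns the equality of forms into equations for coefficients; the
scalars are absorbed into the first factor. -/
theorem rank_decomposition (F : Type*) [Field F] (k : ℕ) :
    ∃ a b c : Fin (tripartitionTensor F k).rank → ThirdSubset k → F,
      ∀ S T U : ThirdSubset k, ∑ i, a i S * b i T * c i U =
        if S.1 ∪ T.1 ∪ U.1 = Finset.univ then 1 else 0 := by
  classical
  obtain ⟨coeff, A, hA, hT⟩ : ∃ (coeff : Fin (tripartitionTensor F k).rank → F)
      (A : Fin (tripartitionTensor F k).rank → Trilinear F (ThirdSubset k)),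
      (∀ i, (A i).IsRankOne) ∧ tripartitionTensor F k = ∑ i, coeff i • A i :=
    Nat.sInf_mem (tripartitionTensor_exists_decomposition F k)
  choose a b c habc using hA
  refine ⟨fun i S => coeff i * a i S, b, c, fun S T U => ?_⟩
  rw [← tripartitionTensor_single F k S T U]
  refine Eq.trans ?_ (congrArg (fun B : Trilinear F (ThirdSubset k) =>
    B (Pi.single S 1) (Pi.single T 1) (Pi.single U 1)) hT.symm)
  simp only [LinearMap.sum_apply, LinearMap.smul_apply, habc, Trilinear.ofForms,
    LinearMap.smulRight_apply, linForm_single, smul_eq_mul, mul_assoc]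

theorem Int.isJacobsonRing : IsJacobsonRing ℤ := by
  rw [isJacobsonRing_iff_prime_eq]
  intro P hP
  by_cases h : P = ⊥
  · subst h
    refine le_antisymm (fun x hx => ?_) Ideal.le_jacobson
    -- An `x` in the Jacobson radical makes `x * x + 1` a unit, that is `±1`, which forces `x = 0`.
    have hu := Ideal.mem_jacobson_bot.1 hx x
    rw [Int.isUnit_iff] at hu
    rw [Ideal.mem_bot]
    rcases hu with hu | hu <;> nlinarith
  · have := hP.isMaximal h
    exact Ideal.jacobson_eq_self_of_isMaximal

/-- Finitely many elements of a field generate a ring that maps to a finite field. -/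
theorem exists_finite_field_ringHom {F : Type u} [Field F] {s : Set F} (hs : s.Finite) :
    ∃ (K : Type u) (_ : Field K) (_ : Finite K), Nonempty (Algebra.adjoin ℤ s →+* K) := by
  obtain ⟨I, hI⟩ := Ideal.exists_maximal (Algebra.adjoin ℤ s)
  let _ := Ideal.Quotient.field I
  have : Algebra.FiniteType ℤ (Algebra.adjoin ℤ s) := .adjoin_of_finite hs
  have : Algebra.FiniteType ℤ (Algebra.adjoin ℤ s ⧸ I) :=
    Algebra.FiniteType.of_surjective (Ideal.Quotient.mkₐ ℤ I) (Ideal.Quotient.mkₐ_surjective ℤ I)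
  have := Int.isJacobsonRing
  -- General Nullstellensatz: a field of finite type over a Jacobson ring is a finite module over
  -- it.
  have : Module.Finite ℤ (Algebra.adjoin ℤ s ⧸ I) := finite_of_finite_type_of_isJacobsonRing _ _
  refine ⟨Algebra.adjoin ℤ s ⧸ I, inferInstance, ?_, ⟨Ideal.Quotient.mk I⟩⟩
  obtain ⟨p, hp⟩ := CharP.exists (Algebra.adjoin ℤ s ⧸ I)
  -- In characteristic `0` the ring `ℤ` would embed in a field integral over it and so be a field.
  -- In characteristic `p > 0` the quotient is a finitely generated torsion group, hence finite.
  rcases Nat.eq_zero_or_pos p with rfl | hpos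
  · exfalso
    have := CharP.charP_to_charZero (Algebra.adjoin ℤ s ⧸ I)
    exact Int.not_isField (isField_of_isIntegral_of_isField
      (FaithfulSMul.algebraMap_injective ℤ (Algebra.adjoin ℤ s ⧸ I)) (Field.toIsField _))
  · refine Module.finite_of_fg_torsion _ ?_
    intro x
    refine ⟨⟨(p : ℤ), mem_nonZeroDivisors_of_ne_zero (by exact_mod_cast hpos.ne')⟩, ?_⟩
    change (p : ℤ) • x = 0
    simp

/-- The equations live in the subring generated by the coefficients and have right-hand sides `0` or
`1`, so a ring homomorphism to a finite field carries them over with the same number of terms. -/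
theorem exists_finite_field_decomposition (F : Type u) [Field F] (k : ℕ) :
    ∃ (K : Type u) (_ : Field K) (_ : Finite K)
      (a b c : Fin (tripartitionTensor F k).rank → ThirdSubset k → K),
      ∀ S T U : ThirdSubset k, ∑ i, a i S * b i T * c i U =
        if S.1 ∪ T.1 ∪ U.1 = Finset.univ then 1 else 0 := by
  obtain ⟨a, b, c, h⟩ := rank_decomposition F k
  let f : Fin 3 → Fin (tripartitionTensor F k).rank → ThirdSubset k → F := ![a, b, c]
  let g : Fin 3 × Fin (tripartitionTensor F k).rank × ThirdSubset k → F :=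
    fun p => f p.1 p.2.1 p.2.2
  obtain ⟨K, iK, hK, ⟨φ⟩⟩ := exists_finite_field_ringHom (Set.finite_range g)
  have hg : ∀ h i S, f h i S ∈ Algebra.adjoin ℤ (Set.range g) :=
    fun h i S => Algebra.subset_adjoin ⟨(h, i, S), rfl⟩
  refine ⟨K, iK, hK, fun i S => φ ⟨f 0 i S, hg 0 i S⟩, fun i S => φ ⟨f 1 i S, hg 1 i S⟩,
    fun i S => φ ⟨f 2 i S, hg 2 i S⟩, fun S T U => ?_⟩
  simp only [← map_mul, ← map_sum]
  rw [← map_one φ, ← map_zero φ, ← apply_ite φ]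
  congr 1
  ext
  simp only [AddSubmonoidClass.coe_finsetSum, MulMemClass.coe_mul]
  rw [show ∀ P : Prop, ∀ _ : Decidable P, (((if P then 1 else 0 : Algebra.adjoin ℤ (Set.range g))) : F)
    = if P then 1 else 0 from fun P _ => by split_ifs <;> rfl]
  exact h S T U

/-- The tensor `T_k` is concise. -/
theorem card_le_of_decomposition {K : Type*} [Field K] {k r : ℕ}
    {a b c : Fin r → ThirdSubset k → K}
    (h : ∀ S T U : ThirdSubset k, ∑ i, a i S * b i T * c i U =
      if S.1 ∪ T.1 ∪ U.1 = Finset.univ then 1 else 0) :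
    Nat.choose (3 * k) k ≤ r := by
  classical
  have hcard : Fintype.card (ThirdSubset k) = Nat.choose (3 * k) k := by
    rw [Fintype.card_finset_len, Fintype.card_fin]
  let φ : (ThirdSubset k → K) →ₗ[K] (Fin r → K) := LinearMap.pi fun i => linForm (a i)
  have hφ : Function.Injective φ := by
    rw [injective_iff_map_eq_zero]
    intro x hx
    funext S
    have hc : S.1ᶜ.card = 2 * k := by rw [Finset.card_compl, Fintype.card_fin, S.2]; omega
    -- Let `T` and `U` partition the complement of `S`. The only `k`-set that completes them to a
    -- cover is `S`, so this pair reads off the coordinate `x S`.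
    obtain ⟨T, hTS, hT⟩ := Finset.exists_subset_card_eq (show k ≤ S.1ᶜ.card by omega)
    have hU : (S.1ᶜ \ T).card = k := by rw [Finset.card_sdiff_of_subset hTS]; omega
    have h1 : ∀ i, ∑ R, a i R * x R = 0 := by
      intro i
      have := congrFun hx i
      simpa [φ, linForm, LinearMap.sum_apply] using this
    have h2 : ∑ R : ThirdSubset k, x R * ∑ i, a i R * b i ⟨T, hT⟩ * c i ⟨_, hU⟩ = 0 := by
      calc _ = ∑ i, (∑ R, a i R * x R) * (b i ⟨T, hT⟩ * c i ⟨_, hU⟩) := by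
            simp only [Finset.mul_sum, Finset.sum_mul]
            rw [Finset.sum_comm]
            refine Finset.sum_congr rfl fun i _ => Finset.sum_congr rfl fun R _ => by ring
        _ = 0 := by simp [h1]
    rw [Finset.sum_eq_single S] at h2
    · rw [h, if_pos] at h2
      · simpa using h2
      · simp only
        rw [Finset.union_assoc, Finset.union_sdiff_of_subset hTS, Finset.union_compl]
    · intro R _ hR
      rw [h, if_neg, mul_zero]
      intro hcov
      apply hR
      simp only at hcov
      rw [Finset.union_assoc, Finset.union_sdiff_of_subset hTS] at hcov
      have hsub : S.1 ⊆ R.1 := by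
        intro y hy
        have : y ∈ R.1 ∪ S.1ᶜ := hcov ▸ Finset.mem_univ y
        simp only [Finset.mem_union, Finset.mem_compl] at this
        tauto
      exact (Subtype.ext (Finset.eq_of_subset_of_card_le hsub (by rw [S.2, R.2]))).symm
    · simp
  have := LinearMap.finrank_le_finrank_of_injective hφ
  simpa [hcard] using this

/-! ### Numerical data of a decomposition, as input for a program -/

/-- A decomposition of `T_k` into `r` rank-one tensors over a finite field, in numbers: the field
elements are encoded by numbers below `q`, and the `k`-subsets of `{0, …, 3k - 1}` are numbered. -/
structure Scheme (K : Type*) [Field K] where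
  k : ℕ
  r : ℕ
  N : ℕ
  q : ℕ
  k_pos : 0 < k
  enc : K → ℕ
  dec : ℕ → K
  dec_enc : ∀ x, dec (enc x) = x
  enc_lt : ∀ x, enc x < q
  -- With these two normalisations the result of a toss is already an encoded field element, and
  -- testing a register for zero tests the field element.
  enc_zero : enc 0 = 0
  enc_one : enc 1 = 1
  sub : ℕ → Finset ℕ
  sub_subset : ∀ l < N, sub l ⊆ Finset.range (3 * k)
  card_sub : ∀ l < N, (sub l).card = k
  exists_sub : ∀ S ⊆ Finset.range (3 * k), S.card = k → ∃ l < N, sub l = S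
  co : ℕ → ℕ → ℕ → K
  sum_co : ∀ S < N, ∀ T < N, ∀ U < N, ∑ i ∈ Finset.range r, co 0 i S * co 1 i T * co 2 i U =
    if sub S ∪ sub T ∪ sub U = Finset.range (3 * k) then 1 else 0
  N_eq : N = Nat.choose (3 * k) k
  N_le : N ≤ r
  r_mul_lt : r * 27 ^ k < 8 ^ k * (Nat.choose (3 * k) k * Nat.choose (2 * k) k)

theorem exists_encoding (K : Type*) [Field K] [Finite K] :
    ∃ (q : ℕ) (enc : K → ℕ) (dec : ℕ → K), (∀ x, dec (enc x) = x) ∧ (∀ x, enc x < q) ∧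
      enc 0 = 0 ∧ enc 1 = 1 := by
  classical
  have := Fintype.ofFinite K
  have h1 : 1 < Fintype.card K := Fintype.one_lt_card
  let e0 : K ≃ Fin (Fintype.card K) := Fintype.equivFin K
  let e1 := e0.trans (Equiv.swap (e0 0) ⟨0, by omega⟩)
  let e2 := e1.trans (Equiv.swap (e1 1) ⟨1, h1⟩)
  have h10 : e1 0 = ⟨0, by omega⟩ := by simp [e1]
  have h20 : e2 0 = ⟨0, by omega⟩ := by
    simp only [e2, Equiv.trans_apply]
    rw [Equiv.swap_apply_of_ne_of_ne, h10]
    · intro h; exact zero_ne_one (e1.injective h)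
    · rw [h10]; simp
  have h21 : e2 1 = ⟨1, h1⟩ := by simp [e2]
  refine ⟨Fintype.card K, fun x => e2 x, Function.invFun fun x => (e2 x : ℕ),
    Function.leftInverse_invFun (fun x y h => e2.injective (Fin.ext h)), fun x => (e2 x).2, ?_, ?_⟩
  · simp [h20]
  · simp [h21]

theorem exists_scheme {F : Type u} [Field F] {k : ℕ} (hk : 1 ≤ k)
    (hr : (tripartitionTensor F k).rank * 27 ^ k <
      8 ^ k * (Nat.choose (3 * k) k * Nat.choose (2 * k) k)) :
    ∃ (K : Type u) (_ : Field K), Nonempty (Scheme K) := by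
  classical
  obtain ⟨K, iK, hK, a, b, c, h⟩ := exists_finite_field_decomposition F k
  obtain ⟨q, enc, dec, h1, h2, h3, h4⟩ := exists_encoding K
  have hcard : Fintype.card (ThirdSubset k) = Nat.choose (3 * k) k := by
    rw [Fintype.card_finset_len, Fintype.card_fin]
  let e : ThirdSubset k ≃ Fin (Nat.choose (3 * k) k) := Fintype.equivFinOfCardEq hcard
  let f : Fin 3 → Fin (tripartitionTensor F k).rank → ThirdSubset k → K := ![a, b, c]
  have hinj : Function.Injective (fun x : Fin (3 * k) => (x : ℕ)) := Fin.val_injective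
  have himg : ∀ S : Finset (Fin (3 * k)), S.image (fun x : Fin (3 * k) => (x : ℕ)) ⊆
      Finset.range (3 * k) := by
    intro S x hx
    obtain ⟨y, _, rfl⟩ := Finset.mem_image.1 hx
    exact Finset.mem_range.2 y.2
  have huniv : (Finset.univ : Finset (Fin (3 * k))).image (fun x : Fin (3 * k) => (x : ℕ)) =
      Finset.range (3 * k) := by
    ext x
    simp only [Finset.mem_image, Finset.mem_univ, true_and, Finset.mem_range]
    exact ⟨fun ⟨y, hy⟩ => hy ▸ y.2, fun hx => ⟨⟨x, hx⟩, rfl⟩⟩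
  refine ⟨K, iK, ⟨{
    k := k, r := (tripartitionTensor F k).rank, N := Nat.choose (3 * k) k, q := q, k_pos := hk
    enc := enc, dec := dec, dec_enc := h1, enc_lt := h2, enc_zero := h3, enc_one := h4
    sub := fun l => if hl : l < Nat.choose (3 * k) k then
      (e.symm ⟨l, hl⟩).1.image (fun x : Fin (3 * k) => (x : ℕ)) else ∅
    sub_subset := fun l hl => by simp only [dif_pos hl]; exact himg _
    card_sub := fun l hl => by
      simp only [dif_pos hl]; rw [Finset.card_image_of_injective _ hinj]; exact (e.symm _).2
    exists_sub := ?_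
    co := fun h i l => if hh : h < 3 ∧ i < (tripartitionTensor F k).rank ∧
      l < Nat.choose (3 * k) k then f ⟨h, hh.1⟩ ⟨i, hh.2.1⟩ (e.symm ⟨l, hh.2.2⟩) else 0
    sum_co := ?_
    N_eq := rfl, N_le := card_le_of_decomposition h, r_mul_lt := hr }⟩⟩
  · intro S hS hSk
    let S' : Finset (Fin (3 * k)) := Finset.univ.filter fun x => (x : ℕ) ∈ S
    have hS' : S'.image (fun x : Fin (3 * k) => (x : ℕ)) = S := by
      ext x
      simp only [S', Finset.mem_image, Finset.mem_filter, Finset.mem_univ, true_and]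
      exact ⟨fun ⟨y, hy, hyx⟩ => hyx ▸ hy, fun hx => ⟨⟨x, Finset.mem_range.1 (hS hx)⟩, hx, rfl⟩⟩
    have hc : S'.card = k := by
      rw [← Finset.card_image_of_injective S' hinj, hS', hSk]
    refine ⟨e ⟨S', hc⟩, (e ⟨S', hc⟩).2, ?_⟩
    simpa using hS'
  · intro S hS T hT U hU
    have := h (e.symm ⟨S, hS⟩) (e.symm ⟨T, hT⟩) (e.symm ⟨U, hU⟩)
    simp only [dif_pos hS, dif_pos hT, dif_pos hU]
    rw [← Finset.image_union, ← Finset.image_union, ← huniv]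
    refine Eq.trans ?_ (if_congr (Finset.image_injective hinj).eq_iff.symm rfl rfl)
    rw [← this, Finset.sum_range]
    refine Finset.sum_congr rfl fun i _ => ?_
    rw [dif_pos ⟨by norm_num, i.2, hS⟩, dif_pos ⟨by norm_num, i.2, hT⟩,
      dif_pos ⟨by norm_num, i.2, hU⟩]
    simp [f]

/-! ### Covers and balanced tripartitions -/

/-- `V` is contained in the union of at most `g` of the sets `R 0, …, R (l - 1)`. -/
def Covered (R : ℕ → Finset ℕ) (l : ℕ) : ℕ → Finset ℕ → Prop
  | 0, V => V = ∅
  | g + 1, V => Covered R l g V ∨ ∃ f < l, Covered R l g (V \ R f)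

namespace Covered

variable {R : ℕ → Finset ℕ} {l : ℕ}

theorem mono_left {g g' : ℕ} {V : Finset ℕ} (h : Covered R l g V) (hg : g ≤ g') :
    Covered R l g' V := by
  induction hg with
  | refl => exact h
  | step _ ih => exact Or.inl ih

theorem mono {g : ℕ} {V W : Finset ℕ} (h : Covered R l g V) (hW : W ⊆ V) : Covered R l g W := by
  induction g generalizing V W with
  | zero => exact Finset.subset_empty.1 (h ▸ hW)
  | succ g ih =>
    rcases h with h | ⟨f, hf, h⟩
    · exact Or.inl (ih h hW)
    · exact Or.inr ⟨f, hf, ih h (Finset.sdiff_subset_sdiff hW subset_rfl)⟩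

theorem union {g g' : ℕ} {V V' : Finset ℕ} (h : Covered R l g V) (h' : Covered R l g' V') :
    Covered R l (g + g') (V ∪ V') := by
  induction g generalizing V V' with
  | zero => rw [show V = ∅ from h]; simpa using h'
  | succ g ih =>
    rw [show g + 1 + g' = (g + g') + 1 by ring]
    rcases h with h | ⟨f, hf, h⟩
    · exact Or.inl (ih h h')
    · refine Or.inr ⟨f, hf, ?_⟩
      rw [Finset.union_sdiff_distrib]
      exact ih h (h'.mono Finset.sdiff_subset)

/-- Put the sets of the cover into `A` one after another until the next one would exceed the
capacity `K`. Since each contributes at most `s` elements, the unused capacity is then below `s`. -/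
theorem split {s : ℕ} (hs : ∀ f < l, (R f).card ≤ s) {g : ℕ} {V : Finset ℕ}
    (h : Covered R l g V) (K : ℕ) : ∃ (A B : Finset ℕ) (g₁ g₂ : ℕ), g₁ + g₂ = g ∧ A ∪ B = V ∧
      Disjoint A B ∧ Covered R l g₁ A ∧ Covered R l g₂ B ∧ A.card ≤ K ∧
      (K < A.card + s ∨ B = ∅) := by
  induction g generalizing V K with
  | zero => exact ⟨∅, ∅, 0, 0, rfl, by simp [show V = ∅ from h], by simp, rfl, rfl, by simp, by simp⟩
  | succ g ih =>
    rcases h with h | ⟨f, hf, h⟩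
    · obtain ⟨A, B, g₁, g₂, h1, h2, h3, h4, h5, h6, h7⟩ := ih h K
      exact ⟨A, B, g₁, g₂ + 1, by omega, h2, h3, h4, Or.inl h5, h6, h7⟩
    · by_cases hK : (V ∩ R f).card ≤ K
      -- The set fits: continue with the capacity that remains.
      · obtain ⟨A, B, g₁, g₂, h1, h2, h3, h4, h5, h6, h7⟩ := ih h (K - (V ∩ R f).card)
        have hA : A ⊆ V \ R f := h2 ▸ Finset.subset_union_left
        have hB : B ⊆ V \ R f := h2 ▸ Finset.subset_union_right
        have hdis : ∀ W ⊆ V \ R f, Disjoint (V ∩ R f) W := fun W hW =>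
          Finset.disjoint_left.2 fun x hx hx' =>
            (Finset.mem_sdiff.1 (hW hx')).2 (Finset.mem_inter.1 hx).2
        have hcard : ((V ∩ R f) ∪ A).card = (V ∩ R f).card + A.card :=
          Finset.card_union_of_disjoint (hdis A hA)
        refine ⟨(V ∩ R f) ∪ A, B, g₁ + 1, g₂, by omega, ?_, ?_, Or.inr ⟨f, hf, h4.mono ?_⟩, h5,
          by omega, ?_⟩
        · rw [Finset.union_assoc, h2, Finset.union_comm, Finset.sdiff_union_inter]
        · exact Finset.disjoint_union_left.2 ⟨hdis B hB, h3⟩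
        · intro x hx
          simp only [Finset.mem_sdiff, Finset.mem_union, Finset.mem_inter] at hx
          tauto
        · rcases h7 with h7 | h7
          · left; omega
          · exact Or.inr h7
      -- The set does not fit, so the capacity `K` itself is below `s`: stop here.
      · refine ⟨∅, V, 0, g + 1, by omega, by simp, by simp, rfl, Or.inr ⟨f, hf, h⟩, by simp, ?_⟩
        left
        have := (Finset.card_le_card (Finset.inter_subset_right (s₁ := V) (s₂ := R f))).trans (hs f hf)
        simp only [Finset.card_empty]
        omega

/-- Two greedy cuts. Unless something runs out, `A` and `B` both have more than `K - s` elements, so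
at most `|V| - 2K + 2s ≤ K` are left for `C`. -/
theorem split_three {s : ℕ} (hs : ∀ f < l, (R f).card ≤ s) {g K : ℕ} {V : Finset ℕ}
    (h : Covered R l g V) (hV : V.card + 2 * s ≤ 3 * K) :
    ∃ (A B C : Finset ℕ) (g₁ g₂ g₃ : ℕ), g₁ + g₂ + g₃ = g ∧ A ∪ B ∪ C = V ∧
      Disjoint A B ∧ Disjoint (A ∪ B) C ∧ Covered R l g₁ A ∧ Covered R l g₂ B ∧ Covered R l g₃ C ∧
      A.card ≤ K ∧ B.card ≤ K ∧ C.card ≤ K := by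
  obtain ⟨A, D, g₁, g', h1, h2, h3, h4, h5, h6, h7⟩ := split hs h K
  obtain ⟨B, C, g₂, g₃, k1, k2, k3, k4, k5, k6, k7⟩ := split hs h5 K
  have hAD : A.card + D.card = V.card := by rw [← h2, Finset.card_union_of_disjoint h3]
  have hBC : B.card + C.card = D.card := by rw [← k2, Finset.card_union_of_disjoint k3]
  rw [← k2, Finset.disjoint_union_right] at h3
  refine ⟨A, B, C, g₁, g₂, g₃, by omega, by rw [Finset.union_assoc, k2, h2], h3.1,
    Finset.disjoint_union_left.2 ⟨h3.2, k3⟩, h4, k4, k5, h6, k6, ?_⟩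
  rcases k7 with k7 | k7
  · rcases h7 with h7 | h7
    · omega
    · have : D.card = 0 := by simp [h7]
      omega
  · simp [k7]

end Covered

/-! ### Instances of set cover in terms of `Covered` -/

namespace SetCoverInstance

variable (I : SetCoverInstance)

/-- Row `f` of the incidence matrix, as a set of numbers. -/
def row (f : ℕ) : Finset ℕ := (Finset.range I.n).filter fun e => I.input 1 (f * I.n + e) ≠ 0

theorem mem_row {f : ℕ} (hf : f < I.fam.length) {e : ℕ} :
    e ∈ I.row f ↔ ∃ he : e < I.n, (⟨e, he⟩ : Fin I.n) ∈ I.fam.get ⟨f, hf⟩ := by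
  have h : I.input 1 (f * I.n + e) = if ∃ (i : Fin I.fam.length) (j : Fin I.n),
      f * I.n + e = (i : ℕ) * I.n + (j : ℕ) ∧ j ∈ I.fam.get i then 1 else 0 := rfl
  rw [row, Finset.mem_filter, Finset.mem_range, h]
  constructor
  · rintro ⟨he, h1⟩
    refine ⟨he, ?_⟩
    by_contra h2
    apply h1
    rw [if_neg]
    rintro ⟨i, j, hij, hmem⟩
    have hn : 0 < I.n := by omega
    have e1 : f = i := by
      have := congrArg (· / I.n) hij
      simpa [Nat.add_div_of_dvd_right, Nat.mul_comm _ I.n, Nat.mul_add_div hn, Nat.div_eq_of_lt he,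
        Nat.div_eq_of_lt j.2] using this
    have e2 : e = j := by subst e1; omega
    subst e1 e2
    exact h2 hmem
  · rintro ⟨he, hmem⟩
    refine ⟨he, ?_⟩
    rw [if_pos ⟨⟨f, hf⟩, ⟨e, he⟩, rfl, hmem⟩]
    exact one_ne_zero

theorem card_row {f : ℕ} (hf : f < I.fam.length) : (I.row f).card = (I.fam.get ⟨f, hf⟩).card := by
  rw [← Finset.card_image_of_injective (I.fam.get ⟨f, hf⟩) Fin.val_injective]
  congr 1
  ext e
  rw [I.mem_row hf, Finset.mem_image]
  exact ⟨fun ⟨he, h⟩ => ⟨_, h, rfl⟩, fun ⟨x, h, hx⟩ => by subst hx; exact ⟨x.2, h⟩⟩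

/-- The additional bound by the size of the family matters: `t` may be exponential in the input
length, and the search runs over covering numbers up to the size of the family only. -/
theorem IsYes.covered (h : I.IsYes) :
    ∃ g ≤ I.fam.length, g ≤ I.t ∧ Covered I.row I.fam.length g (Finset.range I.n) := by
  classical
  obtain ⟨G, hG, hcard, hun⟩ := h
  refine ⟨G.card, ?_, hcard, ?_⟩
  · calc G.card ≤ I.fam.toFinset.card := Finset.card_le_card fun X hX => List.mem_toFinset.2 (hG X hX)
      _ ≤ _ := List.toFinset_card_le _
  · have key : ∀ G : Finset (Finset (Fin I.n)), (∀ X ∈ G, X ∈ I.fam) → ∀ V : Finset ℕ,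
        (∀ e ∈ V, ∃ he : e < I.n, ∃ X ∈ G, (⟨e, he⟩ : Fin I.n) ∈ X) →
        Covered I.row I.fam.length G.card V := by
      intro G
      induction G using Finset.induction_on with
      | empty =>
        intro _ V hV
        refine Finset.eq_empty_of_forall_notMem fun e he => ?_
        obtain ⟨_, X, hX, _⟩ := hV e he
        simp at hX
      | insert X G hX ih =>
        intro hG V hV
        rw [Finset.card_insert_of_notMem hX]
        obtain ⟨⟨f, hf⟩, hfX⟩ := List.get_of_mem (hG X (Finset.mem_insert_self _ _))
        refine Or.inr ⟨f, hf, ih (fun Y hY => hG Y (Finset.mem_insert_of_mem hY)) _ ?_⟩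
        intro e he
        rw [Finset.mem_sdiff, I.mem_row hf, hfX] at he
        obtain ⟨hen, Y, hY, heY⟩ := hV e he.1
        refine ⟨hen, Y, ?_, heY⟩
        rcases Finset.mem_insert.1 hY with rfl | hY
        · exact absurd ⟨hen, heY⟩ he.2
        · exact hY
    refine key G hG _ fun e he => ?_
    have hen := Finset.mem_range.1 he
    have : (⟨e, hen⟩ : Fin I.n) ∈ G.biUnion id := hun ▸ Finset.mem_univ _
    obtain ⟨X, hX, hx⟩ := Finset.mem_biUnion.1 this
    exact ⟨hen, X, hX, hx⟩

theorem isYes_of_covered (h : Covered I.row I.fam.length I.t (Finset.range I.n)) : I.IsYes := by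
  classical
  have key : ∀ (g : ℕ) (V : Finset ℕ), Covered I.row I.fam.length g V →
      ∃ G : Finset (Finset (Fin I.n)), (∀ X ∈ G, X ∈ I.fam) ∧ G.card ≤ g ∧
        ∀ e ∈ V, ∀ he : e < I.n, ∃ X ∈ G, (⟨e, he⟩ : Fin I.n) ∈ X := by
    intro g
    induction g with
    | zero => intro V hV; rw [show V = ∅ from hV]; exact ⟨∅, by simp, by simp, by simp⟩
    | succ g ih =>
      rintro V (hV | ⟨f, hf, hV⟩)
      · obtain ⟨G, h1, h2, h3⟩ := ih V hV
        exact ⟨G, h1, by omega, h3⟩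
      · obtain ⟨G, h1, h2, h3⟩ := ih _ hV
        refine ⟨insert (I.fam.get ⟨f, hf⟩) G, ?_, (Finset.card_insert_le _ _).trans (by omega), ?_⟩
        · intro X hX
          rcases Finset.mem_insert.1 hX with rfl | hX
          · exact List.get_mem _ _
          · exact h1 X hX
        · intro e he hen
          by_cases hef : e ∈ I.row f
          · obtain ⟨_, h⟩ := (I.mem_row hf).1 hef
            exact ⟨_, Finset.mem_insert_self _ _, h⟩
          · obtain ⟨X, hX, h⟩ := h3 e (Finset.mem_sdiff.2 ⟨he, hef⟩) hen
            exact ⟨X, Finset.mem_insert_of_mem hX, h⟩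
  obtain ⟨G, h1, h2, h3⟩ := key _ _ h
  refine ⟨G, h1, h2, ?_⟩
  ext ⟨e, he⟩
  simp only [Finset.mem_biUnion, id, Finset.mem_univ, iff_true]
  exact h3 e (Finset.mem_range.2 he) he

end SetCoverInstance

/-- Three disjoint sets of size at most `K` extend to a balanced colouring of `{0, …, 3K - 1}`. -/
theorem exists_balanced_colouring {A B C : Finset ℕ} {n K n' : ℕ} (hn' : n' = 3 * K) (hn : n ≤ n')
    (hU : A ∪ B ∪ C = Finset.range n) (hAB : Disjoint A B) (hABC : Disjoint (A ∪ B) C)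
    (hA : A.card ≤ K) (hB : B.card ≤ K) (hC : C.card ≤ K) :
    ∃ c : ℕ → Fin 3, (∀ h, ((Finset.range n').filter fun x => c x = h).card = K) ∧
      ∀ x < n, (c x = 0 → x ∈ A) ∧ (c x = 1 → x ∈ B) ∧ (c x = 2 → x ∈ C) := by
  classical
  have hcard : A.card + B.card + C.card = n := by
    rw [← Finset.card_union_of_disjoint hAB, ← Finset.card_union_of_disjoint hABC, hU,
      Finset.card_range]
  have hlt : ∀ {x}, x ∈ A ∪ B ∪ C → x < n := fun hx => Finset.mem_range.1 (hU ▸ hx)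
  set P := Finset.Ico n n' with hP
  have hPc : P.card = n' - n := by simp [hP]
  have dAP : Disjoint A P := Finset.disjoint_left.2 fun x hx hx' => by
    have := hlt (x := x) (by simp [hx]); simp [hP] at hx'; omega
  have dBP : Disjoint B P := Finset.disjoint_left.2 fun x hx hx' => by
    have := hlt (x := x) (by simp [hx]); simp [hP] at hx'; omega
  -- `A` and then `B` are filled up to exactly `K` elements with padding from `P`. The remaining
  -- elements form the third class, whose part below `n` lies in `C`.
  obtain ⟨S, hAS, hSP, hS⟩ := Finset.exists_subsuperset_card_eq
    (Finset.subset_union_left (s₁ := A) (s₂ := P)) hA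
    (by rw [Finset.card_union_of_disjoint dAP]; omega)
  have hPS : (P \ S).card = n' - n - (K - A.card) := by
    have e1 : P \ S = P \ (S \ A) := by
      ext x; simp only [Finset.mem_sdiff]
      have : x ∈ P → x ∉ A := fun h h' => (Finset.disjoint_left.1 dAP) h' h
      tauto
    have e2 : S \ A ⊆ P := by
      intro x hx
      have := hSP (Finset.mem_sdiff.1 hx).1
      simp only [Finset.mem_union, Finset.mem_sdiff] at this hx
      tauto
    rw [e1, Finset.card_sdiff_of_subset e2, Finset.card_sdiff_of_subset hAS, hPc, hS]
  obtain ⟨T, hBT, hTP, hT⟩ := Finset.exists_subsuperset_card_eq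
    (Finset.subset_union_left (s₁ := B) (s₂ := P \ S)) hB
    (by rw [Finset.card_union_of_disjoint (dBP.mono_right Finset.sdiff_subset), hPS]; omega)
  have dST : Disjoint S T := by
    refine Finset.disjoint_left.2 fun x hx hx' => ?_
    have h1 := hSP hx
    have h2 := hTP hx'
    simp only [Finset.mem_union, Finset.mem_sdiff] at h1 h2
    have h3 : x ∈ A → x ∉ B := fun h => Finset.disjoint_left.1 hAB h
    have h4 : x ∈ B → x ∉ P := fun h => Finset.disjoint_left.1 dBP h
    tauto
  have hxP : ∀ {x}, x < n → x ∉ P := fun hx h => by simp [hP] at h; omega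
  have hSr : S ⊆ Finset.range n' := by
    intro x hx
    have h1 := hSP hx
    simp only [Finset.mem_union, hP, Finset.mem_Ico] at h1
    rcases h1 with h1 | h1
    · have := hlt (x := x) (by simp [h1]); simp; omega
    · simp; omega
  have hTr : T ⊆ Finset.range n' := by
    intro x hx
    have h1 := hTP hx
    simp only [Finset.mem_union, hP, Finset.mem_Ico, Finset.mem_sdiff] at h1
    rcases h1 with h1 | h1
    · have := hlt (x := x) (by simp [h1]); simp; omega
    · simp; omega
  refine ⟨fun x => if x ∈ S then 0 else if x ∈ T then 1 else 2, ?_, ?_⟩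
  · have hTS : ∀ x, x ∈ T → x ∉ S := fun x h h' => Finset.disjoint_left.1 dST h' h
    intro h
    fin_cases h
    · have : (Finset.range n').filter (fun x => (if x ∈ S then (0 : Fin 3) else
          if x ∈ T then 1 else 2) = 0) = S := by
        ext x
        have := @hSr x
        simp only [Finset.mem_filter]
        split_ifs <;> simp_all
      exact (congrArg Finset.card this).trans hS
    · have : (Finset.range n').filter (fun x => (if x ∈ S then (0 : Fin 3) else
          if x ∈ T then 1 else 2) = 1) = T := by
        ext x
        have h1 := @hTr x
        have h2 := hTS x
        simp only [Finset.mem_filter]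
        split_ifs with h3 h4
        · simp only [zero_ne_one, and_false, false_iff]; exact fun h => h2 h h3
        · simpa [h4] using h1 h4
        · simp [h4]
      exact (congrArg Finset.card this).trans hT
    · have : (Finset.range n').filter (fun x => (if x ∈ S then (0 : Fin 3) else
          if x ∈ T then 1 else 2) = 2) = Finset.range n' \ (S ∪ T) := by
        ext x
        simp only [Finset.mem_filter, Finset.mem_sdiff, Finset.mem_union]
        split_ifs <;> simp_all
      refine (congrArg Finset.card this).trans ?_
      rw [Finset.card_sdiff_of_subset (Finset.union_subset hSr hTr),
        Finset.card_union_of_disjoint dST, hS, hT, Finset.card_range]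
      omega
  · intro x hx
    have hxP := hxP hx
    have h0 : x ∈ A ∪ B ∪ C := hU ▸ Finset.mem_range.2 hx
    have h1 := @hSP x
    have h2 := @hTP x
    have h3 := @hAS x
    have h4 := @hBT x
    simp only [Finset.mem_union, Finset.mem_sdiff] at h0 h1 h2
    refine ⟨?_, ?_, ?_⟩ <;> (simp only; split_ifs) <;> simp <;> tauto

/-! ### Permutations that balance a colouring on every block -/

/-- The number of balanced tripartitions of a set of size `3k`. -/
def triCount (k : ℕ) : ℕ := Nat.choose (3 * k) k * Nat.choose (2 * k) k

theorem triCount_le_card (k : ℕ) : triCount k ≤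
    Fintype.card {f : Fin (3 * k) → Fin 3 // ∀ h, (Finset.univ.filter fun e => f e = h).card = k} := by
  classical
  set P := (Finset.powersetCard k (Finset.univ : Finset (Fin (3 * k)))).sigma
    fun S => Finset.powersetCard k Sᶜ with hP
  have hPc : P.card = triCount k := by
    rw [hP, Finset.card_sigma, Finset.sum_const_nat (m := Nat.choose (2 * k) k)]
    · rw [Finset.card_powersetCard, Finset.card_univ, Fintype.card_fin, triCount]
    · intro S hS
      rw [Finset.card_powersetCard, Finset.card_compl, Fintype.card_fin,
        (Finset.mem_powersetCard.1 hS).2]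
      congr 1; omega
  have hmem : ∀ p ∈ P, p.1.card = k ∧ p.2 ⊆ p.1ᶜ ∧ p.2.card = k := by
    intro p hp
    rw [hP, Finset.mem_sigma, Finset.mem_powersetCard, Finset.mem_powersetCard] at hp
    exact ⟨hp.1.2, hp.2.1, hp.2.2⟩
  let col : (Σ _ : Finset (Fin (3 * k)), Finset (Fin (3 * k))) → Fin (3 * k) → Fin 3 :=
    fun p e => if e ∈ p.1 then 0 else if e ∈ p.2 then 1 else 2
  have h0 : ∀ p e, col p e = 0 ↔ e ∈ p.1 := by
    intro p e; simp only [col]; split_ifs <;> simp_all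
  have h1 : ∀ p e, col p e = 1 ↔ e ∉ p.1 ∧ e ∈ p.2 := by
    intro p e; simp only [col]; split_ifs <;> simp_all
  have h2 : ∀ p e, col p e = 2 ↔ e ∉ p.1 ∧ e ∉ p.2 := by
    intro p e; simp only [col]; split_ifs <;> simp_all
  rw [← hPc, Fintype.card_subtype]
  refine Finset.card_le_card_of_injOn col ?_ ?_
  · intro p hp
    obtain ⟨p1, p2, p3⟩ := hmem p hp
    simp only [Finset.coe_filter, Finset.mem_univ, true_and]
    have hd : Disjoint p.1 p.2 := Finset.disjoint_left.2 fun x hx hx' =>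
      (Finset.mem_compl.1 (p2 hx')) hx
    intro h
    fin_cases h
    · change (Finset.univ.filter fun e => col p e = 0).card = k
      simp only [h0]; simpa using p1
    · change (Finset.univ.filter fun e => col p e = 1).card = k
      refine (congrArg Finset.card (Finset.ext fun e => ?_)).trans p3
      have : e ∈ p.1 → e ∉ p.2 := fun h => Finset.disjoint_left.1 hd h
      simp only [h1, Finset.mem_filter, Finset.mem_univ, true_and]; tauto
    · change (Finset.univ.filter fun e => col p e = 2).card = k
      have : (Finset.univ.filter fun e => col p e = 2) = (p.1 ∪ p.2)ᶜ := by
        ext e; simp [h2]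
      rw [this, Finset.card_compl, Finset.card_union_of_disjoint hd, Fintype.card_fin]; omega
  · intro p hp p' hp' hpp
    obtain ⟨_, p2, _⟩ := hmem p hp
    obtain ⟨_, p2', _⟩ := hmem p' hp'
    have e1 : p.1 = p'.1 := by ext e; rw [← h0, ← h0, hpp]
    have e2 : p.2 = p'.2 := by
      ext e
      have a1 := h1 p e
      have a2 := h1 p' e
      have a3 := @p2 e
      have a4 := @p2' e
      rw [hpp] at a1
      simp only [Finset.mem_compl] at a3 a4
      tauto
    exact Sigma.ext e1 (heq_of_eq e2)

/-- Glue bijections between colour classes of equal size. -/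
theorem exists_perm_comp_eq {α : Type*} [Fintype α] [DecidableEq α] {c d : α → Fin 3}
    (h : ∀ i, (Finset.univ.filter fun x => c x = i).card =
      (Finset.univ.filter fun x => d x = i).card) :
    ∃ τ : Equiv.Perm α, c ∘ τ = d := by
  have he : ∀ i, Nonempty ({x // d x = i} ≃ {x // c x = i}) := fun i =>
    ⟨Fintype.equivOfCardEq (by rw [Fintype.card_subtype, Fintype.card_subtype, h i])⟩
  refine ⟨((Equiv.sigmaFiberEquiv d).symm.trans (Equiv.sigmaCongrRight fun i => (he i).some)).trans
    (Equiv.sigmaFiberEquiv c), ?_⟩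
  funext x
  simp only [Function.comp, Equiv.trans_apply, Equiv.sigmaFiberEquiv, Equiv.coe_fn_symm_mk,
    Equiv.sigmaCongrRight_apply, Equiv.coe_fn_mk]
  exact ((he (d x)).some ⟨x, rfl⟩).2

/-- A uniformly random permutation turns a given colouring into one of `D` with probability at
least `|D| / 3 ^ |α|`, if all members of `D` have the same colour counts as the given colouring. -/
theorem card_perm_comp_mem {α : Type*} [Fintype α] [DecidableEq α] (c : α → Fin 3)
    (D : Finset (α → Fin 3)) (hD : ∀ d ∈ D, ∀ i, (Finset.univ.filter fun x => c x = i).card =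
      (Finset.univ.filter fun x => d x = i).card) :
    D.card * (Fintype.card α).factorial ≤ 3 ^ Fintype.card α *
      (Finset.univ.filter fun σ : Equiv.Perm α => c ∘ σ ∈ D).card := by
  -- `S` is the order of the stabiliser of `c`. By translation every fibre of `σ ↦ c ∘ σ` has at
  -- most `S` elements, and fibres over `D` have at least `S`. There are `3 ^ |α|` possible
  -- colourings, so `|α|! ≤ 3 ^ |α| * S`.
  set S := (Finset.univ.filter fun σ : Equiv.Perm α => c ∘ σ = c).card with hS
  have hle : ∀ d, (Finset.univ.filter fun σ : Equiv.Perm α => c ∘ σ = d).card ≤ S := by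
    intro d
    by_cases hne : ∃ τ : Equiv.Perm α, c ∘ τ = d
    · obtain ⟨τ, rfl⟩ := hne
      refine Finset.card_le_card_of_injOn (fun σ => σ * τ⁻¹) ?_ ?_
      · intro σ hσ
        simp only [Finset.coe_filter, Finset.mem_univ, true_and, Set.mem_ofPred_eq] at hσ ⊢
        funext x
        have := congrFun hσ (τ⁻¹ x)
        simpa using this
      · intro a _ b _ hab
        exact mul_right_cancel hab
    · rw [Finset.filter_false_of_mem]
      · simp
      · exact fun σ _ h => hne ⟨σ, h⟩
  have hge : ∀ d ∈ D, S ≤ (Finset.univ.filter fun σ : Equiv.Perm α => c ∘ σ = d).card := by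
    intro d hd
    obtain ⟨τ, rfl⟩ := exists_perm_comp_eq (hD d hd)
    refine Finset.card_le_card_of_injOn (fun σ => σ * τ) ?_ ?_
    · intro σ hσ
      simp only [Finset.coe_filter, Finset.mem_univ, true_and, Set.mem_ofPred_eq] at hσ ⊢
      funext x
      have := congrFun hσ (τ x)
      simpa using this
    · intro a _ b _ hab
      exact mul_right_cancel hab
  have htot : (Fintype.card α).factorial ≤ 3 ^ Fintype.card α * S := by
    rw [← Fintype.card_perm, ← Finset.card_univ,
      Finset.card_eq_sum_card_fiberwise (f := fun σ : Equiv.Perm α => c ∘ σ)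
        (t := (Finset.univ : Finset (α → Fin 3))) (fun _ _ => Finset.mem_univ _)]
    refine (Finset.sum_le_card_nsmul _ _ S fun d _ => hle d).trans ?_
    simp
  have hsum : D.card * S ≤ (Finset.univ.filter fun σ : Equiv.Perm α => c ∘ σ ∈ D).card := by
    rw [Finset.card_eq_sum_card_fiberwise (f := fun σ : Equiv.Perm α => c ∘ σ) (t := D)]
    · rw [← smul_eq_mul]
      refine Finset.card_nsmul_le_sum _ _ _ fun d hd => (hge d hd).trans ?_
      refine Finset.card_le_card fun σ hσ => ?_
      simp only [Finset.mem_filter, Finset.mem_univ, true_and] at hσ ⊢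
      exact ⟨hσ ▸ hd, hσ⟩
    · intro σ hσ
      simpa using hσ
  calc D.card * (Fintype.card α).factorial ≤ D.card * (3 ^ Fintype.card α * S) := by gcongr
    _ = 3 ^ Fintype.card α * (D.card * S) := by ring
    _ ≤ _ := by gcongr

/-- The permutations of `m` blocks of size `3k` that balance the colouring `c` on every block. -/
def balancingPerms (m k : ℕ) (c : Fin (m * (3 * k)) → Fin 3) :
    Finset (Equiv.Perm (Fin (m * (3 * k)))) :=
  Finset.univ.filter fun σ => ∀ b h,
    (Finset.univ.filter fun e : Fin (3 * k) => c (σ (finProdFinEquiv (b, e))) = h).card = k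

/-- Apply `card_perm_comp_mem` to the colourings that are balanced on every block. Independent
choices in the blocks give at least `triCount k ^ m` of them, and each has every colour `m * k`
times, as `c` does. -/
theorem card_balancingPerms {m k : ℕ} (c : Fin (m * (3 * k)) → Fin 3)
    (hc : ∀ h, (Finset.univ.filter fun x => c x = h).card = m * k) :
    triCount k ^ m * (m * (3 * k)).factorial ≤ 27 ^ (m * k) * (balancingPerms m k c).card := by
  classical
  let D : Finset (Fin (m * (3 * k)) → Fin 3) := Finset.univ.filter fun d => ∀ b h,
    (Finset.univ.filter fun e : Fin (3 * k) => d (finProdFinEquiv (b, e)) = h).card = k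
  have hDcard : triCount k ^ m ≤ D.card := by
    calc triCount k ^ m ≤ (Fintype.card {f : Fin (3 * k) → Fin 3 //
          ∀ h, (Finset.univ.filter fun e => f e = h).card = k}) ^ m :=
          Nat.pow_le_pow_left (triCount_le_card k) m
      _ = Fintype.card (Fin m → {f : Fin (3 * k) → Fin 3 //
          ∀ h, (Finset.univ.filter fun e => f e = h).card = k}) := by simp
      _ ≤ D.card := by
        rw [← Finset.card_univ]
        refine Finset.card_le_card_of_injOn
          (fun F x => (F (finProdFinEquiv.symm x).1).1 (finProdFinEquiv.symm x).2) ?_ ?_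
        · intro F _
          simp only [D, Finset.coe_filter, Finset.mem_univ, true_and, Set.mem_ofPred_eq,
            Equiv.symm_apply_apply]
          exact fun b h => (F b).2 h
        · intro F _ G _ hFG
          funext b
          apply Subtype.ext
          funext e
          have := congrFun hFG (finProdFinEquiv (b, e))
          simpa only [Equiv.symm_apply_apply] using this
  have h := card_perm_comp_mem c D (by
    intro d hd i
    rw [hc]
    simp only [D, Finset.mem_filter, Finset.mem_univ, true_and] at hd
    rw [Finset.card_filter, ← Equiv.sum_comp finProdFinEquiv, Fintype.sum_prod_type]
    simp_rw [← Finset.card_filter, hd]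
    simp)
  rw [Fintype.card_fin] at h
  calc triCount k ^ m * (m * (3 * k)).factorial ≤ D.card * (m * (3 * k)).factorial := by gcongr
    _ ≤ _ := h
    _ = 27 ^ (m * k) * (balancingPerms m k c).card := by
      have e1 : (3 : ℕ) ^ (m * (3 * k)) = 27 ^ (m * k) := by
        rw [show m * (3 * k) = 3 * (m * k) by ring, pow_mul]; norm_num
      rw [e1]
      congr 2
      ext σ
      simp [D, balancingPerms]

/-! ### Shuffling -/

/-- The permutation that results from swapping `i` and `J i` for `i = 0, …, j - 1`. -/
def shuffle (J : ℕ → ℕ) : ℕ → Equiv.Perm ℕ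
  | 0 => 1
  | j + 1 => shuffle J j * Equiv.swap j (J j)

theorem shuffle_congr {J J' : ℕ → ℕ} {j : ℕ} (h : ∀ i < j, J i = J' i) :
    shuffle J j = shuffle J' j := by
  induction j with
  | zero => rfl
  | succ j ih => rw [shuffle, shuffle, ih fun i hi => h i (by omega), h j (by omega)]

theorem shuffle_lt {J : ℕ → ℕ} {n j : ℕ} (hj : j ≤ n) (hJ : ∀ i < j, J i < n) {x : ℕ} (hx : x < n) :
    shuffle J j x < n := by
  induction j generalizing x with
  | zero => simpa [shuffle]
  | succ j ih =>
    rw [shuffle, Equiv.Perm.mul_apply]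
    apply ih (by omega) fun i hi => hJ i (by omega)
    rw [Equiv.swap_apply_def]
    split_ifs
    · exact hJ j (by omega)
    · omega
    · exact hx

theorem shuffle_symm_lt {J : ℕ → ℕ} {n j : ℕ} (hj : j ≤ n) (hJ : ∀ i < j, J i < n) {x : ℕ}
    (hx : x < n) : (shuffle J j)⁻¹ x < n := by
  by_contra hcon
  have himg : (Finset.range n).image (shuffle J j) = Finset.range n := by
    refine Finset.eq_of_subset_of_card_le ?_ ?_
    · intro y hy
      obtain ⟨z, hz, rfl⟩ := Finset.mem_image.1 hy
      exact Finset.mem_range.2 (shuffle_lt hj hJ (Finset.mem_range.1 hz))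
    · rw [Finset.card_image_of_injective _ (shuffle J j).injective]
  have : x ∈ (Finset.range n).image (shuffle J j) := by rw [himg]; exact Finset.mem_range.2 hx
  obtain ⟨z, hz, rfl⟩ := Finset.mem_image.1 this
  apply hcon
  simpa using hz

/-- Every permutation is the result of some shuffle. -/
theorem exists_shuffle {n : ℕ} (σ : Equiv.Perm (Fin n)) :
    ∃ J : ℕ → ℕ, (∀ i < n, i ≤ J i ∧ J i < n) ∧ ∀ x : Fin n, shuffle J n x = σ x := by
  have key : ∀ j ≤ n, ∃ J : ℕ → ℕ, (∀ i < j, i ≤ J i ∧ J i < n) ∧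
      ∀ x : Fin n, (x : ℕ) < j → shuffle J j x = σ x := by
    intro j
    induction j with
    | zero => exact fun _ => ⟨fun _ => 0, by simp, by simp⟩
    | succ j ih =>
      intro hj
      obtain ⟨J, h1, h2⟩ := ih (by omega)
      -- `y` is the current position of the value that must come to position `j`. It is not below
      -- `j`, because those positions already hold other values of `σ`; so it is a legitimate swap
      -- index.
      set y := (shuffle J j)⁻¹ (σ ⟨j, by omega⟩) with hy
      have hyn : y < n := shuffle_symm_lt (by omega) (fun i hi => (h1 i hi).2) (σ _).2
      have hsy : shuffle J j y = σ ⟨j, by omega⟩ := by simp [hy]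
      have hyj : j ≤ y := by
        by_contra hcon
        have := h2 ⟨y, hyn⟩ (by simpa using hcon)
        simp only at this
        rw [hsy] at this
        have := σ.injective (Fin.ext this)
        simp only [Fin.mk.injEq] at this
        omega
      have hc : ∀ i < j, Function.update J j y i = J i := fun i hi =>
        Function.update_of_ne (by omega) _ _
      refine ⟨Function.update J j y, ?_, ?_⟩
      · intro i hi
        rcases Nat.lt_succ_iff_lt_or_eq.1 hi with hi | rfl
        · rw [hc i hi]; exact h1 i hi
        · simp [hyj, hyn]
      · intro x hx
        rw [shuffle, shuffle_congr hc, Equiv.Perm.mul_apply, Function.update_self]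
        rcases Nat.lt_succ_iff_lt_or_eq.1 hx with hx | hx
        · rw [Equiv.swap_apply_of_ne_of_ne (by omega) (by omega), h2 x hx]
        · rw [hx, Equiv.swap_apply_left, hsy]
          congr 2
          exact Fin.ext hx.symm
  obtain ⟨J, h1, h2⟩ := key n le_rfl
  exact ⟨J, h1, fun x => h2 x x.2⟩

/-! ### Coin tosses -/

/-- The probability of an event that depends on a sequence of tosses of a fair coin. -/
noncomputable def prob (P : (ℕ → Bool) → Prop) : ℝ := (coinMeasure {ω | P ω}).toReal

/-- The sequence of tosses without its first `T` members. -/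
def later (T : ℕ) (ω : ℕ → Bool) : ℕ → Bool := fun i => ω (T + i)

@[simp] theorem later_apply (T : ℕ) (ω : ℕ → Bool) (i : ℕ) : later T ω i = ω (T + i) := rfl

theorem later_later (S T : ℕ) (ω : ℕ → Bool) : later S (later T ω) = later (T + S) ω := by
  funext i; simp [add_assoc]

@[simp] theorem later_zero (ω : ℕ → Bool) : later 0 ω = ω := by funext i; simp

/-- The first `T` tosses of `ω`, followed by `ω'`. -/
def joinCoins (T : ℕ) (ω ω' : ℕ → Bool) : ℕ → Bool := fun i => if i < T then ω i else ω' (i - T)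

theorem joinCoins_of_lt {T i : ℕ} (h : i < T) (ω ω' : ℕ → Bool) : joinCoins T ω ω' i = ω i :=
  if_pos h

@[simp] theorem later_joinCoins (T : ℕ) (ω ω' : ℕ → Bool) : later T (joinCoins T ω ω') = ω' := by
  funext i; simp [joinCoins]

/-- The value of `f` is determined by the first `T` tosses. -/
def FirstCoins {β : Sort*} (T : ℕ) (f : (ℕ → Bool) → β) : Prop :=
  ∀ ω ω', (∀ i < T, ω i = ω' i) → f ω = f ω'

theorem FirstCoins.measurableSet {T : ℕ} {P : (ℕ → Bool) → Prop} (h : FirstCoins T P) :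
    MeasurableSet {ω | P ω} := by
  have : {ω | P ω} = (fun (ω : ℕ → Bool) (i : Fin T) => ω i) ⁻¹'
      {u | P fun i => if hi : i < T then u ⟨i, hi⟩ else false} := by
    ext ω
    simp only [Set.mem_preimage, Set.mem_ofPred_eq]
    exact iff_of_eq (h _ _ fun i hi => by simp [hi])
  rw [this]
  exact (measurable_pi_lambda _ fun i => measurable_pi_apply _) (Set.toFinite _).measurableSet

instance : IsProbabilityMeasure coinMeasure := by unfold coinMeasure; infer_instance

theorem measurable_joinCoins (T : ℕ) :
    Measurable fun p : (ℕ → Bool) × (ℕ → Bool) => joinCoins T p.1 p.2 := by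
  refine measurable_pi_lambda _ fun i => ?_
  unfold joinCoins
  split_ifs
  · exact (measurable_pi_apply i).comp measurable_fst
  · exact (measurable_pi_apply (i - T)).comp measurable_snd

/-- It suffices to compare cylinder sets, whose coordinates split into those below `T` and the
shifted rest. This makes Fubini available for conditioning on the first `T` tosses. -/
theorem map_joinCoins (T : ℕ) :
    (coinMeasure.prod coinMeasure).map (fun p => joinCoins T p.1 p.2) = coinMeasure := by
  classical
  refine Measure.eq_infinitePi _ fun s t ht => ?_
  rw [Measure.map_apply (measurable_joinCoins T) (MeasurableSet.pi s.countable_toSet fun i _ => ht i)]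
  have hpre : (fun p : (ℕ → Bool) × (ℕ → Bool) => joinCoins T p.1 p.2) ⁻¹' Set.pi s t =
      (Set.pi (s.filter (· < T)) t) ×ˢ
        (Set.pi ((s.filter fun i => ¬ i < T).image (· - T)) fun i => t (T + i)) := by
    ext ⟨ω, ω'⟩
    simp only [Set.mem_preimage, Set.mem_pi, Set.mem_prod, Finset.mem_coe, Finset.mem_filter,
      Finset.mem_image]
    constructor
    · intro h
      refine ⟨fun i ⟨hi, hT⟩ => by simpa [joinCoins, hT] using h i hi, ?_⟩
      rintro _ ⟨i, ⟨hi, hT⟩, rfl⟩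
      rw [show T + (i - T) = i by omega]
      simpa [joinCoins, hT] using h i hi
    · rintro ⟨h1, h2⟩ i hi
      by_cases hT : i < T
      · simpa [joinCoins, hT] using h1 i ⟨hi, hT⟩
      · have := h2 (i - T) ⟨i, ⟨hi, hT⟩, rfl⟩
        rw [show T + (i - T) = i by omega] at this
        simpa [joinCoins, hT] using this
  rw [hpre, Measure.prod_prod, coinMeasure, Measure.infinitePi_pi _ fun i _ => ht i,
    Measure.infinitePi_pi _ fun i _ => ht _, Finset.prod_image,
    ← Finset.prod_filter_mul_prod_filter_not s (· < T)]
  · congr 1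
    refine Finset.prod_congr rfl fun i hi => ?_
    have := (Finset.mem_filter.1 hi).2
    rw [show T + (i - T) = i by omega]
  · intro i hi j hj hij
    simp only [Finset.coe_filter, Set.mem_ofPred_eq] at hi hj hij
    omega

/-- What happens after the first `T` tosses is independent of them. -/
theorem prob_and_later {T S : ℕ} {E F : (ℕ → Bool) → Prop} (hE : FirstCoins T E)
    (hF : FirstCoins S F) : prob (fun ω => E ω ∧ F (later T ω)) = prob E * prob F := by
  have hmeas : MeasurableSet {ω | E ω ∧ F (later T ω)} := by
    refine FirstCoins.measurableSet (T := T + S) fun ω ω' h => ?_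
    rw [hE ω ω' fun i hi => h i (by omega), hF (later T ω) (later T ω') fun i hi => h _ (by omega)]
  have hpre : (fun p : (ℕ → Bool) × (ℕ → Bool) => joinCoins T p.1 p.2) ⁻¹'
      {ω | E ω ∧ F (later T ω)} = {ω | E ω} ×ˢ {ω | F ω} := by
    ext ⟨ω, ω'⟩
    simp only [Set.mem_preimage, Set.mem_ofPred_eq, Set.mem_prod, later_joinCoins]
    rw [hE (joinCoins T ω ω') ω fun i hi => joinCoins_of_lt hi _ _]
  unfold prob
  rw [← ENNReal.toReal_mul, ← Measure.prod_prod, ← hpre,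
    ← Measure.map_apply (measurable_joinCoins T) hmeas, map_joinCoins]

/-- Fubini as a rule for conditioning: if the first tosses satisfy `E`, then the later ones produce
`P` with probability at least `b`. In contrast to `prob_and_later`, the later event may depend on
the first tosses. -/
theorem le_prob_and {T S : ℕ} {E P : (ℕ → Bool) → Prop} {b : ℝ} (hE : FirstCoins T E)
    (hP : FirstCoins S P) (hb : ∀ ω, E ω → b ≤ prob fun ω' => P (joinCoins T ω ω')) :
    prob E * b ≤ prob P := by
  by_cases hb0 : b ≤ 0
  · exact (mul_nonpos_of_nonneg_of_nonpos ENNReal.toReal_nonneg hb0).trans ENNReal.toReal_nonneg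
  have hm : MeasurableSet ((fun p : (ℕ → Bool) × (ℕ → Bool) => joinCoins T p.1 p.2) ⁻¹'
      {ω | P ω}) := measurable_joinCoins T hP.measurableSet
  have key : coinMeasure {ω | E ω} * ENNReal.ofReal b ≤ coinMeasure {ω | P ω} := by
    rw [← map_joinCoins T, Measure.map_apply (measurable_joinCoins T) hP.measurableSet,
      map_joinCoins T, Measure.prod_apply hm, mul_comm, ← lintegral_indicator_const hE.measurableSet]
    refine lintegral_mono fun ω => ?_
    by_cases h : E ω
    · rw [Set.indicator_of_mem (by exact h)]
      exact ENNReal.ofReal_le_of_le_toReal (hb ω h)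
    · rw [Set.indicator_of_notMem (by exact h)]
      exact zero_le
  have := ENNReal.toReal_mono (measure_ne_top _ _) key
  rwa [ENNReal.toReal_mul, ENNReal.toReal_ofReal (by linarith)] at this

theorem prob_mono {P Q : (ℕ → Bool) → Prop} (h : ∀ ω, P ω → Q ω) : prob P ≤ prob Q :=
  ENNReal.toReal_mono (measure_ne_top _ _) (measure_mono h)

theorem prob_true {P : (ℕ → Bool) → Prop} (h : ∀ ω, P ω) : prob P = 1 := by
  unfold prob
  rw [Set.eq_univ_of_forall (s := {ω | P ω}) h, measure_univ, ENNReal.toReal_one]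

theorem prob_nonneg (P : (ℕ → Bool) → Prop) : 0 ≤ prob P := ENNReal.toReal_nonneg

theorem prob_not {T : ℕ} {P : (ℕ → Bool) → Prop} (hP : FirstCoins T P) :
    prob (fun ω => ¬ P ω) = 1 - prob P := by
  unfold prob
  rw [show {ω | ¬ P ω} = {ω | P ω}ᶜ from rfl, prob_compl_eq_one_sub hP.measurableSet,
    ENNReal.toReal_sub_of_le prob_le_one ENNReal.one_ne_top, ENNReal.toReal_one]

theorem prob_later {S : ℕ} (T : ℕ) {F : (ℕ → Bool) → Prop} (hF : FirstCoins S F) :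
    prob (fun ω => F (later T ω)) = prob F := by
  have := prob_and_later (T := T) (E := fun _ => True) (fun _ _ _ => rfl) hF
  simpa [prob_true] using this

theorem sum_prob_le {ι : Type*} (s : Finset ι) {T : ℕ} {P : ι → (ℕ → Bool) → Prop}
    {Q : (ℕ → Bool) → Prop} (hP : ∀ i ∈ s, FirstCoins T (P i)) (hQ : ∀ i ∈ s, ∀ ω, P i ω → Q ω)
    (hdis : ∀ i ∈ s, ∀ j ∈ s, ∀ ω, P i ω → P j ω → i = j) :
    ∑ i ∈ s, prob (P i) ≤ prob Q := by
  unfold prob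
  rw [← ENNReal.toReal_sum fun i _ => measure_ne_top _ _, ← measure_biUnion_finset]
  · refine ENNReal.toReal_mono (measure_ne_top _ _) (measure_mono ?_)
    exact Set.iUnion₂_subset fun i hi ω hω => hQ i hi ω hω
  · intro i hi j hj hij
    exact Set.disjoint_left.2 fun ω h1 h2 => hij (hdis i hi j hj ω h1 h2)
  · exact fun i hi => (hP i hi).measurableSet

theorem map_not_uniform : ((PMF.uniformOfFintype Bool).toMeasure).map not =
    (PMF.uniformOfFintype Bool).toMeasure := by
  refine Measure.ext_of_singleton fun b => ?_
  rw [Measure.map_apply (measurable_of_countable _) (measurableSet_singleton b),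
    show not ⁻¹' {b} = {!b} by ext x; cases x <;> cases b <;> simp,
    PMF.toMeasure_apply_singleton _ _ (measurableSet_singleton _),
    PMF.toMeasure_apply_singleton _ _ (measurableSet_singleton _)]
  simp

theorem prob_coin (b : Bool) : prob (fun ω => ω 0 = b) = 1 / 2 := by
  unfold prob
  have : {ω : ℕ → Bool | ω 0 = b} = Set.pi (({0} : Finset ℕ) : Set ℕ) fun _ => {b} := by
    ext ω; simp
  rw [this, coinMeasure, Measure.infinitePi_pi _ fun i _ => measurableSet_singleton b]
  simp [PMF.toMeasure_apply_singleton _ _ (measurableSet_singleton b)]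

/-- The involution that reverses toss `w`. -/
def flipCoin (w : ℕ) (ω : ℕ → Bool) : ℕ → Bool := fun i => (if i = w then not else id) (ω i)

theorem prob_flipCoin (w : ℕ) {T : ℕ} {P : (ℕ → Bool) → Prop} (hP : FirstCoins T P) :
    prob (fun ω => P (flipCoin w ω)) = prob P := by
  have hmap : coinMeasure.map (flipCoin w) = coinMeasure := by
    have := Measure.infinitePi_map_pi (X := fun _ : ℕ => Bool) (Y := fun _ : ℕ => Bool)
      (fun _ : ℕ => (PMF.uniformOfFintype Bool).toMeasure)
      (f := fun i : ℕ => if i = w then not else id) (fun i => measurable_of_countable _)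
    unfold coinMeasure
    refine this.trans ?_
    congr 1
    funext i
    split_ifs
    · exact map_not_uniform
    · exact Measure.map_id
  unfold prob
  conv_rhs => rw [← hmap]
  rw [Measure.map_apply _ hP.measurableSet]
  · rfl
  · refine measurable_pi_lambda _ fun i => ?_
    exact (measurable_of_countable _).comp (measurable_pi_apply i)

/-! ### Random zero-one values of multilinear forms -/

section Multilinear

variable {K : Type*} [Field K]

/-- The result of a toss, as a field element. -/
def coinVal (K : Type*) [Field K] (b : Bool) : K := if b then 1 else 0

-- Reversing toss `w` changes the sum by `±c w ≠ 0`, so of two outcomes that differ only there at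
-- least one gives a nonzero sum. As the reversal preserves the measure, no assumption on the size
-- of `K` is needed.
open Classical in
theorem half_le_prob_linear {P : ℕ} (c : ℕ → K) {w : ℕ} (hw : w < P) (hc : c w ≠ 0) :
    1 / 2 ≤ prob fun ω => ∑ i ∈ Finset.range P, c i * coinVal K (ω i) ≠ 0 := by
  set A : (ℕ → Bool) → Prop := fun ω => ∑ i ∈ Finset.range P, c i * coinVal K (ω i) ≠ 0 with hA
  have hdep : FirstCoins P A := by
    intro ω ω' h
    simp only [hA]
    rw [Finset.sum_congr rfl fun i hi => by rw [h i (Finset.mem_range.1 hi)]]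
  have hdep' : FirstCoins P fun ω => A (flipCoin w ω) := by
    intro ω ω' h
    exact hdep _ _ fun i hi => by simp [flipCoin, h i hi]
  have hor : ∀ ω, ¬ A ω → A (flipCoin w ω) := by
    intro ω h1 h2
    simp only [hA, not_not] at h1
    apply hc
    have h3 : ∑ i ∈ Finset.range P, (c i * coinVal K (flipCoin w ω i) - c i * coinVal K (ω i)) = 0 := by
      rw [Finset.sum_sub_distrib, h1, h2, sub_zero]
    rw [Finset.sum_eq_single_of_mem w (Finset.mem_range.2 hw)] at h3
    · simp only [flipCoin, if_true, coinVal] at h3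
      cases hω : ω w <;> simpa [hω] using h3
    · intro i _ hi
      simp [flipCoin, hi]
  have h1 := prob_mono hor
  rw [prob_not hdep, prob_flipCoin w hdep] at h1
  linarith

/-- The first `P` tosses leave a nonzero coefficient at `w` with probability at least `1 / 2`; given
this, the linear case applies to the next `P` tosses. -/
theorem quarter_le_prob_bilinear {P : ℕ} (c : ℕ → ℕ → K) {v w : ℕ} (hv : v < P) (hw : w < P)
    (hc : c v w ≠ 0) :
    1 / 4 ≤ prob fun ω => ∑ i ∈ Finset.range P, ∑ j ∈ Finset.range P,
      c i j * coinVal K (ω i) * coinVal K (ω (P + j)) ≠ 0 := by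
  have h := le_prob_and (T := P) (S := P + P) (b := 1 / 2)
    (E := fun ω => ∑ i ∈ Finset.range P, c i w * coinVal K (ω i) ≠ 0)
    (P := fun ω => ∑ i ∈ Finset.range P, ∑ j ∈ Finset.range P,
      c i j * coinVal K (ω i) * coinVal K (ω (P + j)) ≠ 0) ?_ ?_ ?_
  · have := half_le_prob_linear (fun i => c i w) hv hc
    linarith
  · intro ω ω' h
    simp only
    rw [Finset.sum_congr rfl fun i hi => by rw [h i (Finset.mem_range.1 hi)]]
  · intro ω ω' h
    simp only
    rw [Finset.sum_congr rfl fun i hi => Finset.sum_congr rfl fun j hj => by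
      rw [h i (by have := Finset.mem_range.1 hi; omega),
        h (P + j) (by have := Finset.mem_range.1 hj; omega)]]
  · intro ω hω
    refine (half_le_prob_linear (fun j => ∑ i ∈ Finset.range P, c i j * coinVal K (ω i)) hw hω).trans
      (prob_mono fun ω' h => ?_)
    convert h using 1
    rw [Finset.sum_comm]
    refine Finset.sum_congr rfl fun j _ => ?_
    rw [Finset.sum_mul]
    refine Finset.sum_congr rfl fun i hi => ?_
    rw [joinCoins_of_lt (Finset.mem_range.1 hi)]
    simp [joinCoins]

/-- Conditioning on the first `P` tosses reduces this to the bilinear case. The bound depends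
neither on the field nor on the number of variables. -/
theorem eighth_le_prob_trilinear {P : ℕ} (c : ℕ → ℕ → ℕ → K) {u v w : ℕ} (hu : u < P) (hv : v < P)
    (hw : w < P) (hc : c u v w ≠ 0) :
    1 / 8 ≤ prob fun ω => ∑ i ∈ Finset.range P, ∑ j ∈ Finset.range P, ∑ l ∈ Finset.range P,
      c i j l * coinVal K (ω i) * coinVal K (ω (P + j)) * coinVal K (ω (P + P + l)) ≠ 0 := by
  have h := le_prob_and (T := P) (S := P + P + P) (b := 1 / 4)
    (E := fun ω => ∑ i ∈ Finset.range P, c i v w * coinVal K (ω i) ≠ 0)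
    (P := fun ω => ∑ i ∈ Finset.range P, ∑ j ∈ Finset.range P, ∑ l ∈ Finset.range P,
      c i j l * coinVal K (ω i) * coinVal K (ω (P + j)) * coinVal K (ω (P + P + l)) ≠ 0) ?_ ?_ ?_
  · have := half_le_prob_linear (fun i => c i v w) hu hc
    linarith
  · intro ω ω' h
    simp only
    rw [Finset.sum_congr rfl fun i hi => by rw [h i (Finset.mem_range.1 hi)]]
  · intro ω ω' h
    simp only
    rw [Finset.sum_congr rfl fun i hi => Finset.sum_congr rfl fun j hj =>
      Finset.sum_congr rfl fun l hl => by
      rw [h i (by have := Finset.mem_range.1 hi; omega),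
        h (P + j) (by have := Finset.mem_range.1 hj; omega),
        h (P + P + l) (by have := Finset.mem_range.1 hl; omega)]]
  · intro ω hω
    refine (quarter_le_prob_bilinear (fun j l => ∑ i ∈ Finset.range P, c i j l * coinVal K (ω i))
      hv hw hω).trans (prob_mono fun ω' h => ?_)
    convert h using 1
    rw [Finset.sum_comm]
    refine Finset.sum_congr rfl fun j _ => ?_
    rw [Finset.sum_comm]
    refine Finset.sum_congr rfl fun l _ => ?_
    rw [Finset.sum_mul, Finset.sum_mul]
    refine Finset.sum_congr rfl fun i hi => ?_
    rw [joinCoins_of_lt (Finset.mem_range.1 hi)]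
    have h1 : joinCoins P ω ω' (P + j) = ω' j := by simp [joinCoins]
    have h2 : joinCoins P ω ω' (P + P + l) = ω' (P + l) := by
      rw [joinCoins, if_neg (by omega)]; congr 1; omega
    rw [h1, h2]

end Multilinear

/-! ### Random numbers and random permutations -/

/-- The number with binary digits `ω 0, …, ω (L - 1)`. -/
def bitsVal (ω : ℕ → Bool) : ℕ → ℕ
  | 0 => 0
  | L + 1 => 2 * bitsVal ω L + (ω L).toNat

theorem bitsVal_lt (ω : ℕ → Bool) (L : ℕ) : bitsVal ω L < 2 ^ L := by
  induction L with
  | zero => simp [bitsVal]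
  | succ L ih => have := Bool.toNat_le (ω L); rw [bitsVal, pow_succ]; omega

theorem bitsVal_congr {ω ω' : ℕ → Bool} {L : ℕ} (h : ∀ i < L, ω i = ω' i) :
    bitsVal ω L = bitsVal ω' L := by
  induction L with
  | zero => rfl
  | succ L ih => rw [bitsVal, bitsVal, ih fun i hi => h i (by omega), h L (by omega)]

theorem prob_bitsVal {L v : ℕ} (hv : v < 2 ^ L) : prob (fun ω => bitsVal ω L = v) = (1 / 2) ^ L := by
  induction L generalizing v with
  | zero => rw [prob_true]; · simp
            · intro ω; simp at hv; simp [bitsVal, hv]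
  | succ L ih =>
    have hE : FirstCoins L fun ω => bitsVal ω L = v / 2 := fun ω ω' h => by
      simp only; rw [bitsVal_congr h]
    have hF : FirstCoins 1 fun ω : ℕ → Bool => ω 0 = decide (v % 2 = 1) := fun ω ω' h => by
      simp only; rw [h 0 (by omega)]
    have := prob_and_later hE hF
    rw [ih (by rw [pow_succ] at hv; omega), prob_coin] at this
    rw [pow_succ, ← this]
    congr 1
    funext ω
    rw [bitsVal, later_apply, Nat.add_zero]
    apply propext
    cases ω L
    · simp only [Bool.toNat_false, Bool.false_eq, decide_eq_false_iff_not]; omega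
    · simp only [Bool.toNat_true, Bool.true_eq, decide_eq_true_eq]; omega

/-- Fair coins produce uniform residues only approximately: at least `⌊2 ^ L / d⌋` of the `2 ^ L`
values fall into each class, a relative loss of at most `d / 2 ^ L`. -/
theorem le_prob_bitsVal_mod {L d x : ℕ} (hx : x < d) :
    (1 - d / 2 ^ L) / (d : ℝ) ≤ prob fun ω => bitsVal ω L % d = x := by
  have hd : 0 < d := by omega
  have hmul : ∀ y < 2 ^ L / d, x + d * y < 2 ^ L := by
    intro y hy
    calc x + d * y < d * (y + 1) := by rw [mul_add]; omega
      _ ≤ d * (2 ^ L / d) := by gcongr; omega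
      _ ≤ 2 ^ L := Nat.mul_div_le _ _
  have h := sum_prob_le (Finset.range (2 ^ L / d)) (T := L)
    (P := fun y ω => bitsVal ω L = x + d * y) (Q := fun ω => bitsVal ω L % d = x)
    (fun y _ ω ω' h => by simp only; rw [bitsVal_congr h])
    (fun y _ ω h => by rw [h, Nat.add_mul_mod_self_left, Nat.mod_eq_of_lt hx])
    (fun y _ y' _ ω h h' => by
      rw [h] at h'
      exact Nat.eq_of_mul_eq_mul_left hd (by omega))
  rw [Finset.sum_congr rfl fun y hy => prob_bitsVal (hmul y (Finset.mem_range.1 hy)),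
    Finset.sum_const, Finset.card_range, nsmul_eq_mul] at h
  refine le_trans ?_ h
  have h1 : (2 : ℝ) ^ L ≤ d * ((2 ^ L / d : ℕ) : ℝ) + d := by
    have h2 := Nat.div_add_mod (2 ^ L) d
    have h3 := Nat.mod_lt (2 ^ L) hd
    have : 2 ^ L ≤ d * (2 ^ L / d) + d := by omega
    exact_mod_cast this
  have hd' : (0 : ℝ) < d := by exact_mod_cast hd
  have h2 : (0 : ℝ) < 2 ^ L := by positivity
  rw [div_le_iff₀ hd', one_div, inv_pow, ← div_eq_mul_inv, div_mul_eq_mul_div, le_div_iff₀ h2,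
    sub_mul, div_mul_cancel₀ _ h2.ne']
  linarith

/-- The random indices that control a shuffle of `n` objects; each uses `L` tosses. -/
def shuffleIndex (L n : ℕ) (ω : ℕ → Bool) (i : ℕ) : ℕ := i + bitsVal (later (i * L) ω) L % (n - i)

theorem shuffleIndex_congr {L n i : ℕ} {ω ω' : ℕ → Bool} (h : ∀ j < (i + 1) * L, ω j = ω' j) :
    shuffleIndex L n ω i = shuffleIndex L n ω' i := by
  unfold shuffleIndex
  rw [bitsVal_congr (ω := later (i * L) ω) (ω' := later (i * L) ω') fun j hj =>
    h _ (by rw [add_mul]; omega)]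

theorem shuffleIndex_lt {L n : ℕ} (ω : ℕ → Bool) {i : ℕ} (hi : i < n) :
    shuffleIndex L n ω i < n := by
  have := Nat.mod_lt (bitsVal (later (i * L) ω) L) (show 0 < n - i by omega)
  unfold shuffleIndex
  omega

/-- The indices are independent, and index `i` is hit with probability at least `(1 - n / 2 ^ L) /
(n - i)`. By Bernoulli's inequality the errors cost together at most a factor `2`. -/
theorem le_prob_shuffleIndex {L n : ℕ} (hL : 2 * n ^ 2 ≤ 2 ^ L) {J : ℕ → ℕ}
    (hJ : ∀ i < n, i ≤ J i ∧ J i < n) :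
    1 / (2 * (n.factorial : ℝ)) ≤ prob fun ω => ∀ i < n, shuffleIndex L n ω i = J i := by
  have hpow : (0 : ℝ) < 2 ^ L := by positivity
  have hL' : 2 * (n : ℝ) ^ 2 ≤ 2 ^ L := by exact_mod_cast hL
  have h01 : (n : ℝ) / 2 ^ L ≤ 1 := by
    rw [div_le_one hpow]
    have : n ≤ 2 * n ^ 2 := by nlinarith
    have : (n : ℝ) ≤ 2 * (n : ℝ) ^ 2 := by exact_mod_cast this
    linarith
  have key : ∀ j ≤ n, (1 - (n : ℝ) / 2 ^ L) ^ j * ((n - j).factorial / n.factorial) ≤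
      prob fun ω => ∀ i < j, shuffleIndex L n ω i = J i := by
    intro j
    induction j with
    | zero =>
      intro _
      rw [prob_true (by simp)]
      simp [Nat.factorial_ne_zero]
    | succ j ih =>
      intro hj
      have hE : FirstCoins (j * L) fun ω => ∀ i < j, shuffleIndex L n ω i = J i := by
        intro ω ω' h
        simp only [eq_iff_iff]
        refine forall₂_congr fun i hi => ?_
        rw [shuffleIndex_congr fun l hl => h l (hl.trans_le (Nat.mul_le_mul_right _ (by omega)))]
      have hF : FirstCoins L fun ω => bitsVal ω L % (n - j) = J j - j := fun ω ω' h => by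
        simp only; rw [bitsVal_congr h]
      have h1 := prob_and_later hE hF
      have h2 := le_prob_bitsVal_mod (L := L) (d := n - j) (x := J j - j)
        (by have := hJ j (by omega); omega)
      have h3 : prob (fun ω => (∀ i < j, shuffleIndex L n ω i = J i) ∧
          bitsVal (later (j * L) ω) L % (n - j) = J j - j) =
          prob fun ω => ∀ i < j + 1, shuffleIndex L n ω i = J i := by
        congr 1
        funext ω
        apply propext
        have hj2 := hJ j (by omega)
        constructor
        · rintro ⟨h4, h5⟩ i hi
          rcases Nat.lt_succ_iff_lt_or_eq.1 hi with hi | rfl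
          · exact h4 i hi
          · unfold shuffleIndex; omega
        · intro h4
          refine ⟨fun i hi => h4 i (by omega), ?_⟩
          have := h4 j (by omega)
          unfold shuffleIndex at this; omega
      rw [← h3, h1]
      have hnj : (0 : ℝ) < ((n - j : ℕ) : ℝ) := by exact_mod_cast (by omega : 0 < n - j)
      have hf : ((n - j).factorial : ℝ) = (n - j : ℕ) * (n - (j + 1)).factorial := by
        rw [show n - j = (n - (j + 1)) + 1 by omega, Nat.factorial_succ]; push_cast; ring
      calc (1 - (n : ℝ) / 2 ^ L) ^ (j + 1) * ((n - (j + 1)).factorial / n.factorial)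
          = ((1 - (n : ℝ) / 2 ^ L) ^ j * ((n - j).factorial / n.factorial)) *
            ((1 - (n : ℝ) / 2 ^ L) / (n - j : ℕ)) := by
            rw [hf]; generalize (1 - (n : ℝ) / 2 ^ L) = z; field_simp; ring
        _ ≤ _ := by
            refine mul_le_mul (ih (by omega)) (le_trans ?_ h2) ?_ (prob_nonneg _)
            · gcongr
              omega
            · have : 0 ≤ 1 - (n : ℝ) / 2 ^ L := by linarith
              positivity
  have h := key n le_rfl
  refine le_trans ?_ h
  have hb := one_add_mul_le_pow (a := -((n : ℝ) / 2 ^ L)) (by linarith) n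
  have hhalf : (1 : ℝ) / 2 ≤ (1 - (n : ℝ) / 2 ^ L) ^ n := by
    rw [← sub_eq_add_neg] at hb
    refine le_trans ?_ hb
    have : (n : ℝ) * (n / 2 ^ L) ≤ 1 / 2 := by
      rw [← mul_div_assoc, div_le_iff₀ hpow]; nlinarith
    linarith
  have hfac : (0 : ℝ) < n.factorial := by exact_mod_cast n.factorial_pos
  calc 1 / (2 * (n.factorial : ℝ)) = 1 / 2 * (1 / n.factorial) := by field_simp
    _ ≤ (1 - (n : ℝ) / 2 ^ L) ^ n * (1 / n.factorial) := by gcongr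
    _ = _ := by simp

/-- Each permutation gets at least half of its uniform probability, and different permutations are
disjoint events. -/
theorem le_prob_shuffle_mem {L n : ℕ} (hL : 2 * n ^ 2 ≤ 2 ^ L) (G : Finset (Equiv.Perm (Fin n))) :
    G.card / (2 * (n.factorial : ℝ)) ≤
      prob fun ω => ∃ σ ∈ G, ∀ x : Fin n, shuffle (shuffleIndex L n ω) n x = σ x := by
  choose J hJ hJσ using fun σ : Equiv.Perm (Fin n) => exists_shuffle σ
  have hsh : ∀ σ ω, (∀ i < n, shuffleIndex L n ω i = J σ i) →
      ∀ x : Fin n, shuffle (shuffleIndex L n ω) n x = σ x := by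
    intro σ ω h x
    rw [shuffle_congr h, hJσ]
  refine le_trans ?_ (sum_prob_le G (T := n * L)
    (P := fun σ ω => ∀ i < n, shuffleIndex L n ω i = J σ i) ?_ ?_ ?_)
  · rw [div_eq_mul_one_div, ← nsmul_eq_mul]
    exact Finset.card_nsmul_le_sum _ _ _ fun σ _ => le_prob_shuffleIndex hL (hJ σ)
  · intro σ _ ω ω' h
    simp only [eq_iff_iff]
    refine forall₂_congr fun i hi => ?_
    rw [shuffleIndex_congr fun l hl => h l (hl.trans_le (Nat.mul_le_mul_right _ (by omega)))]
  · exact fun σ hσ ω h => ⟨σ, hσ, hsh σ ω h⟩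
  · intro σ _ τ _ ω h h'
    ext x
    rw [← hsh σ ω h x, hsh τ ω h' x]

/-! ### Independent trials -/

/-- All `N` trials fail with probability `(1 - p) ^ N ≤ exp (-2) ≤ 1 / 3`. The offset `g` permits a
run of trials in the middle of a longer sequence. -/
theorem two_thirds_le_prob_exists {T N : ℕ} {A : (ℕ → Bool) → Prop} (hA : FirstCoins T A)
    (hN : 2 ≤ N * prob A) (g : ℕ) :
    2 / 3 ≤ prob fun ω => ∃ i < N, A (later ((g + i) * T) ω) := by
  have hF : ∀ N, FirstCoins (N * T) fun ω => ∀ i < N, ¬ A (later (i * T) ω) := by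
    intro N ω ω' h
    simp only [eq_iff_iff]
    refine forall₂_congr fun i hi => ?_
    rw [hA (later (i * T) ω) (later (i * T) ω') fun l hl => h _ ?_]
    calc i * T + l < (i + 1) * T := by rw [add_mul]; omega
      _ ≤ N * T := Nat.mul_le_mul_right _ hi
  have hnot : FirstCoins T fun ω => ¬ A ω := fun ω ω' h => by simp only; rw [hA ω ω' h]
  have hpow : ∀ N, prob (fun ω => ∀ i < N, ¬ A (later (i * T) ω)) = (1 - prob A) ^ N := by
    intro N
    induction N with
    | zero => rw [prob_true (by simp)]; simp
    | succ N ih =>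
      rw [pow_succ, ← ih, ← prob_not hA, mul_comm, ← prob_and_later hnot (hF N)]
      congr 1
      funext ω
      apply propext
      simp only [later_later]
      constructor
      · intro h
        refine ⟨by simpa using h 0 (by omega), fun i hi => ?_⟩
        have := h (i + 1) (by omega)
        rwa [show (i + 1) * T = T + i * T by ring] at this
      · rintro ⟨h1, h2⟩ i hi
        cases i with
        | zero => simpa using h1
        | succ i =>
          rw [show (i + 1) * T = T + i * T by ring]
          exact h2 i (by omega)
  have h1 := prob_not (hF N)
  rw [hpow] at h1
  have hp1 : prob A ≤ 1 := by
    have := prob_not hA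
    have := prob_nonneg fun ω => ¬ A ω
    linarith
  have h2 : (1 - prob A) ^ N ≤ 1 / 3 := by
    calc (1 - prob A) ^ N ≤ (Real.exp (-prob A)) ^ N := by
          refine pow_le_pow_left₀ (by linarith) ?_ N
          have := Real.add_one_le_exp (-prob A)
          linarith
      _ = Real.exp (-(N * prob A)) := by rw [← Real.exp_nat_mul]; ring_nf
      _ ≤ Real.exp (-2) := Real.exp_le_exp.2 (by linarith)
      _ = (Real.exp 2)⁻¹ := Real.exp_neg _
      _ ≤ 1 / 3 := by
          rw [one_div]
          have := Real.add_one_le_exp (2 : ℝ)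
          exact inv_anti₀ (by norm_num) (by linarith)
  have h3 : prob (fun ω => ¬ ∀ i < N, ¬ A (later (i * T) ω)) =
      prob fun ω => ∃ i < N, A (later ((g + i) * T) ω) := by
    rw [← prob_later (g * T) (F := fun ω => ¬ ∀ i < N, ¬ A (later (i * T) ω)) (S := N * T)]
    · congr 1
      funext ω
      simp only [later_later, add_mul]
      push Not
      rfl
    · intro ω ω' h
      exact congrArg Not (hF N ω ω' h)
  linarith

/-! ### Digits and tensor powers -/

/-- Digit `b` of `w` in base `N`. -/
def dig (N w b : ℕ) : ℕ := w / N ^ b % N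

theorem dig_lt {N : ℕ} (hN : 0 < N) (w b : ℕ) : dig N w b < N := Nat.mod_lt _ hN

theorem dig_add_of_lt {N : ℕ} (hN : 0 < N) (w i : ℕ) {j b : ℕ} (hb : b < j) :
    dig N (w + N ^ j * i) b = dig N w b := by
  unfold dig
  obtain ⟨c, rfl⟩ : ∃ c, j = b + 1 + c := ⟨j - (b + 1), by omega⟩
  rw [show w + N ^ (b + 1 + c) * i = w + N ^ b * (N * (N ^ c * i)) by ring,
    Nat.add_mul_div_left _ _ (by positivity), Nat.add_mul_mod_self_left]

theorem dig_add_self {N : ℕ} {w i j : ℕ} (hw : w < N ^ j) (hi : i < N) :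
    dig N (w + N ^ j * i) j = i := by
  unfold dig
  rw [Nat.add_mul_div_left _ _ (by omega), Nat.div_eq_of_lt hw, zero_add, Nat.mod_eq_of_lt hi]

theorem exists_digits {N : ℕ} (hN : 0 < N) (m : ℕ) (l : ℕ → ℕ) (hl : ∀ b < m, l b < N) :
    ∃ w < N ^ m, ∀ b < m, dig N w b = l b := by
  induction m with
  | zero => exact ⟨0, by simp, by simp⟩
  | succ m ih =>
    obtain ⟨w, hw, h⟩ := ih fun b hb => hl b (by omega)
    refine ⟨w + N ^ m * l m, ?_, ?_⟩
    · have := hl m (by omega)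
      calc w + N ^ m * l m < N ^ m * (l m + 1) := by rw [mul_add]; omega
        _ ≤ N ^ m * N := by gcongr; omega
        _ = N ^ (m + 1) := (pow_succ _ _).symm
    · intro b hb
      rcases Nat.lt_succ_iff_lt_or_eq.1 hb with hb | rfl
      · rw [dig_add_of_lt hN _ _ hb, h b hb]
      · rw [dig_add_self hw (hl _ (by omega))]

theorem sum_range_mul' {M : Type*} [AddCommMonoid M] (a b : ℕ) (f : ℕ → M) :
    ∑ w ∈ Finset.range (a * b), f w =
      ∑ i ∈ Finset.range b, ∑ w ∈ Finset.range a, f (w + a * i) := by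
  induction b with
  | zero => simp
  | succ b ih =>
    rw [Nat.mul_succ, Finset.sum_range_add, Finset.sum_range_succ, ih]
    simp only [add_comm]

/-- Distributivity: the `m` digits of a number below `r ^ m` range independently over the digits in
base `r`. -/
theorem sum_prod_dig {R : Type*} [CommRing R] {r : ℕ} (hr : 0 < r) (m : ℕ) (g : ℕ → ℕ → R) :
    ∑ w ∈ Finset.range (r ^ m), ∏ b ∈ Finset.range m, g b (dig r w b) =
      ∏ b ∈ Finset.range m, ∑ i ∈ Finset.range r, g b i := by
  induction m with
  | zero => simp
  | succ m ih =>
    rw [pow_succ, sum_range_mul', Finset.prod_range_succ, ← ih, Finset.sum_mul_sum, Finset.sum_comm]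
    refine Finset.sum_congr rfl fun w hw => Finset.sum_congr rfl fun i hi => ?_
    rw [Finset.prod_range_succ, dig_add_self (Finset.mem_range.1 hw) (Finset.mem_range.1 hi)]
    congr 1
    refine Finset.prod_congr rfl fun b hb => ?_
    rw [dig_add_of_lt hr _ _ (Finset.mem_range.1 hb)]

namespace Scheme

variable {K : Type*} [Field K] (sch : Scheme K)

theorem N_pos : 0 < sch.N := by
  rw [sch.N_eq]; exact Nat.choose_pos (by omega)

theorem r_pos : 0 < sch.r := sch.N_pos.trans_le sch.N_le

/-- The coefficients of the `j`-th tensor power of the decomposition. -/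
def coPow (h j w S : ℕ) : K := ∏ b ∈ Finset.range j, sch.co h (dig sch.r w b) (dig sch.N S b)

/-- The coefficients of the `m`-th tensor power of `T_k`. -/
def tripart (m S T U : ℕ) : K := ∏ b ∈ Finset.range m,
  if sch.sub (dig sch.N S b) ∪ sch.sub (dig sch.N T b) ∪ sch.sub (dig sch.N U b) =
    Finset.range (3 * sch.k) then 1 else 0

/-- The tensor power of a decomposition into `r` terms is a decomposition of the tensor power into
`r ^ m` terms. -/
theorem sum_coPow (m S T U : ℕ) :
    ∑ w ∈ Finset.range (sch.r ^ m), sch.coPow 0 m w S * sch.coPow 1 m w T * sch.coPow 2 m w U =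
      sch.tripart m S T U := by
  simp only [coPow, ← Finset.prod_mul_distrib]
  rw [sum_prod_dig sch.r_pos m fun b i => sch.co 0 i (dig sch.N S b) * sch.co 1 i (dig sch.N T b) *
    sch.co 2 i (dig sch.N U b)]
  exact Finset.prod_congr rfl fun b _ => sch.sum_co _ (dig_lt sch.N_pos _ _) _
    (dig_lt sch.N_pos _ _) _ (dig_lt sch.N_pos _ _)

/-- The vector `x` after the decomposition has been applied to its `j` lowest digits. -/
def partialTransform (x : ℕ → K) (h j w d : ℕ) : K :=
  ∑ S ∈ Finset.range (sch.N ^ j), sch.coPow h j w S * x (S + sch.N ^ j * d)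

theorem partialTransform_zero (x : ℕ → K) (h w d : ℕ) : sch.partialTransform x h 0 w d = x d := by
  simp [partialTransform, coPow]

/-- The recursion behind Yates's algorithm: one more digit is converted from base `N` (sets) to base
`r` (terms) at `N` operations per entry. -/
theorem partialTransform_succ (x : ℕ → K) (h j d : ℕ) {w i : ℕ} (hw : w < sch.r ^ j)
    (hi : i < sch.r) : sch.partialTransform x h (j + 1) (w + sch.r ^ j * i) d =
      ∑ l ∈ Finset.range sch.N, sch.co h i l * sch.partialTransform x h j w (l + sch.N * d) := by
  unfold partialTransform
  rw [pow_succ, sum_range_mul']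
  refine Finset.sum_congr rfl fun l hl => ?_
  rw [Finset.mul_sum]
  refine Finset.sum_congr rfl fun S hS => ?_
  have e : sch.coPow h (j + 1) (w + sch.r ^ j * i) (S + sch.N ^ j * l) =
      sch.coPow h j w S * sch.co h i l := by
    unfold coPow
    rw [Finset.prod_range_succ, dig_add_self hw hi,
      dig_add_self (Finset.mem_range.1 hS) (Finset.mem_range.1 hl)]
    congr 1
    refine Finset.prod_congr rfl fun b hb => ?_
    rw [dig_add_of_lt sch.r_pos _ _ (Finset.mem_range.1 hb),
      dig_add_of_lt sch.N_pos _ _ (Finset.mem_range.1 hb)]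
  rw [e, show S + sch.N ^ j * l + sch.N ^ j * sch.N * d = S + sch.N ^ j * (l + sch.N * d) by ring]
  ring

/-- The value of the `m`-th tensor power of `T_k`. -/
def tensorValue (m : ℕ) (x y z : ℕ → K) : K :=
  ∑ S ∈ Finset.range (sch.N ^ m), ∑ T ∈ Finset.range (sch.N ^ m), ∑ U ∈ Finset.range (sch.N ^ m),
    sch.tripart m S T U * x S * y T * z U

/-- After three linear transformations the value of the tensor power is a sum of only `r ^ m`
products. -/
theorem sum_partialTransform (m : ℕ) (x y z : ℕ → K) :
    ∑ w ∈ Finset.range (sch.r ^ m), sch.partialTransform x 0 m w 0 *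
      sch.partialTransform y 1 m w 0 * sch.partialTransform z 2 m w 0 = sch.tensorValue m x y z := by
  have hprod : ∀ (s : Finset ℕ) (f g h : ℕ → K), (∑ i ∈ s, f i) * (∑ i ∈ s, g i) * (∑ i ∈ s, h i) =
      ∑ i ∈ s, ∑ j ∈ s, ∑ l ∈ s, f i * g j * h l := by
    intro s f g h
    rw [Finset.sum_mul_sum, Finset.sum_mul]
    exact Finset.sum_congr rfl fun i _ => by rw [Finset.sum_mul_sum]
  simp only [partialTransform, tensorValue, mul_zero, add_zero, hprod]
  simp only [← sum_coPow, Finset.sum_mul]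
  rw [Finset.sum_comm]
  refine Finset.sum_congr rfl fun S _ => ?_
  rw [Finset.sum_comm]
  refine Finset.sum_congr rfl fun T _ => ?_
  rw [Finset.sum_comm]
  refine Finset.sum_congr rfl fun U _ => Finset.sum_congr rfl fun w _ => ?_
  ring

/-! ### A single trial -/

/-- The elements of `{0, …, n - 1}` in the set with code `w`, if position `p` holds `σ p`. -/
def elems (n m : ℕ) (σ : ℕ → ℕ) (w : ℕ) : Finset ℕ :=
  ((Finset.range m).biUnion fun b => (sch.sub (dig sch.N w b)).image fun e =>
    σ (b * (3 * sch.k) + e)).filter (· < n)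

/-- The bit mask of a finite set of numbers. -/
def _root_.mask (S : Finset ℕ) : ℕ := ∑ x ∈ S, 2 ^ x

/-- The bit of the element `x`; elements from `n` on do not count. -/
def _root_.bitWeight (n x : ℕ) : ℕ := if x < n then 2 ^ x else 0

theorem mem_elems {n m : ℕ} {σ : ℕ → ℕ} {w x : ℕ} : x ∈ sch.elems n m σ w ↔
    x < n ∧ ∃ b < m, ∃ e ∈ sch.sub (dig sch.N w b), σ (b * (3 * sch.k) + e) = x := by
  simp [elems, and_comm]

theorem elems_subset (n m : ℕ) (σ : ℕ → ℕ) (w : ℕ) : sch.elems n m σ w ⊆ Finset.range n := by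
  intro x hx
  exact Finset.mem_range.2 (sch.mem_elems.1 hx).1

theorem card_elems_le (n m : ℕ) (σ : ℕ → ℕ) (w : ℕ) : (sch.elems n m σ w).card ≤ m * sch.k := by
  refine (Finset.card_filter_le _ _).trans (Finset.card_biUnion_le.trans ?_)
  refine (Finset.sum_le_card_nsmul _ _ sch.k fun b _ => ?_).trans (by simp)
  exact Finset.card_image_le.trans (sch.card_sub _ (dig_lt sch.N_pos _ _)).le

/-- Different block entries are different positions, and `σ` is injective, so no bit is added twice;
padding elements have weight `0`. -/
theorem sum_bitWeight (n m : ℕ) {σ : ℕ → ℕ} (hσ : Function.Injective σ) (w : ℕ) :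
    ∑ b ∈ Finset.range m, ∑ e ∈ sch.sub (dig sch.N w b), bitWeight n (σ (b * (3 * sch.k) + e)) =
      mask (sch.elems n m σ w) := by
  have hk := sch.k_pos
  have hlt : ∀ b e, e ∈ sch.sub (dig sch.N w b) → e < 3 * sch.k := fun b e he =>
    Finset.mem_range.1 (sch.sub_subset _ (dig_lt sch.N_pos _ _) he)
  unfold mask elems
  rw [Finset.sum_filter, Finset.sum_biUnion]
  · refine Finset.sum_congr rfl fun b _ => ?_
    rw [Finset.sum_image]
    · rfl
    · intro e _ e' _ h
      have := hσ h
      omega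
  · intro b _ b' _ hbb
    rw [Function.onFun, Finset.disjoint_left]
    intro x hx hx'
    obtain ⟨e, he, rfl⟩ := Finset.mem_image.1 hx
    obtain ⟨e', he', h⟩ := Finset.mem_image.1 hx'
    have h1 := hσ h
    have h2 := hlt b e he
    have h3 := hlt b' e' he'
    apply hbb
    have h4 : (b' * (3 * sch.k) + e') / (3 * sch.k) = b' := by
      rw [mul_comm, Nat.mul_add_div (by omega), Nat.div_eq_of_lt h3, add_zero]
    have h5 : (b * (3 * sch.k) + e) / (3 * sch.k) = b := by
      rw [mul_comm, Nat.mul_add_div (by omega), Nat.div_eq_of_lt h2, add_zero]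
    rw [← h4, ← h5, h1]

/-- The number of tosses used for each index of a shuffle of `n` objects. -/
def _root_.bitCount (n : ℕ) : ℕ := 2 * n + 1

theorem _root_.two_mul_sq_le (n : ℕ) : 2 * n ^ 2 ≤ 2 ^ bitCount n := by
  have h : n < 2 ^ n := Nat.lt_two_pow_self
  calc 2 * n ^ 2 ≤ 2 * (2 ^ n) ^ 2 := by gcongr
    _ = 2 ^ bitCount n := by rw [bitCount, ← pow_mul, pow_succ, mul_comm 2 n, mul_comm]

/-- The random permutation of the positions. -/
def trialPerm (m : ℕ) (ω : ℕ → Bool) : Equiv.Perm ℕ :=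
  shuffle (shuffleIndex (bitCount (m * (3 * sch.k))) (m * (3 * sch.k)) ω) (m * (3 * sch.k))

/-- The number of tosses used for the random permutation. -/
def permTosses (m : ℕ) : ℕ := m * (3 * sch.k) * bitCount (m * (3 * sch.k))

/-- The random vectors: the entry for a set is `0` unless the set has small covering number. -/
def trialVec (n m : ℕ) (mc thr : ℕ → ℕ) (ω : ℕ → Bool) (h w : ℕ) : K :=
  if mc (mask (sch.elems n m (sch.trialPerm m ω) w)) < thr h then
    coinVal K (ω (sch.permTosses m + h * sch.N ^ m + w)) else 0

/-- The result of a trial. -/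
def trialValue (n m : ℕ) (mc thr : ℕ → ℕ) (ω : ℕ → Bool) : K :=
  sch.tensorValue m (sch.trialVec n m mc thr ω 0) (sch.trialVec n m mc thr ω 1)
    (sch.trialVec n m mc thr ω 2)

/-- The number of tosses used in a trial. -/
def trialTosses (m : ℕ) : ℕ := sch.permTosses m + 3 * sch.N ^ m

theorem trialPerm_congr {m : ℕ} {ω ω' : ℕ → Bool} (h : ∀ i < sch.permTosses m, ω i = ω' i) :
    sch.trialPerm m ω = sch.trialPerm m ω' :=
  shuffle_congr fun _ hi => shuffleIndex_congr fun j hj =>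
    h j (hj.trans_le (Nat.mul_le_mul_right _ hi))

theorem firstCoins_trialValue (n m : ℕ) (mc thr : ℕ → ℕ) :
    FirstCoins (sch.trialTosses m) fun ω => sch.trialValue n m mc thr ω ≠ 0 := by
  intro ω ω' h
  have hv : ∀ j < 3, ∀ w < sch.N ^ m,
      sch.trialVec n m mc thr ω j w = sch.trialVec n m mc thr ω' j w := by
    intro j hj w hw
    unfold trialVec
    rw [sch.trialPerm_congr fun i hi => h i (by unfold trialTosses; omega), h]
    have : j * sch.N ^ m ≤ 2 * sch.N ^ m := Nat.mul_le_mul_right _ (by omega)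
    unfold trialTosses
    omega
  simp only [trialValue, tensorValue]
  rw [Finset.sum_congr rfl fun S hS => Finset.sum_congr rfl fun T hT => Finset.sum_congr rfl
    fun U hU => by rw [hv 0 (by norm_num) S (Finset.mem_range.1 hS),
      hv 1 (by norm_num) T (Finset.mem_range.1 hT), hv 2 (by norm_num) U (Finset.mem_range.1 hU)]]

/-- The table `mc` holds covering numbers of all subsets of `{0, …, n - 1}` of size at most `c`. -/
def _root_.SetCoverInstance.IsCoverTable (I : SetCoverInstance) (c : ℕ) (mc : ℕ → ℕ) : Prop :=
  ∀ S ⊆ Finset.range I.n, S.card ≤ c →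
    (mc (mask S) ≤ I.fam.length + I.t → Covered I.row I.fam.length (mc (mask S)) S) ∧
    ∀ j ≤ I.fam.length, Covered I.row I.fam.length j S → mc (mask S) ≤ j

/-- The thresholds for the covering numbers of the three parts. -/
def _root_.threshold (t j₁ j₂ : ℕ) : ℕ → ℕ
  | 0 => j₁ + 1
  | 1 => j₂ + 1
  -- If `j₁ + j₂ > t` this is `0`, and no entry passes the strict comparison with it.
  | _ => t + 1 - (j₁ + j₂)

theorem tripart_ne_zero {m S T U : ℕ} : sch.tripart m S T U ≠ 0 ↔ ∀ b < m,
    sch.sub (dig sch.N S b) ∪ sch.sub (dig sch.N T b) ∪ sch.sub (dig sch.N U b) =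
      Finset.range (3 * sch.k) := by
  rw [tripart, Finset.prod_ne_zero_iff]
  simp

variable {sch}

/-- There are no false positives. A nonzero value has a nonzero term; its three sets together
contain every element, and their covering numbers add up to at most `t`. The randomness plays no
role here. -/
theorem isYes_of_trialValue_ne_zero {I : SetCoverInstance} {m : ℕ} {mc : ℕ → ℕ} {j₁ j₂ : ℕ}
    (hmc : I.IsCoverTable (m * sch.k) mc) (hn : I.n ≤ m * (3 * sch.k))
    (h₁ : j₁ ≤ I.fam.length) (h₂ : j₂ ≤ I.fam.length) {ω : ℕ → Bool}
    (h : sch.trialValue I.n m mc (threshold I.t j₁ j₂) ω ≠ 0) : I.IsYes := by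
  rw [trialValue, tensorValue] at h
  obtain ⟨S, -, h⟩ := Finset.exists_ne_zero_of_sum_ne_zero h
  obtain ⟨T, -, h⟩ := Finset.exists_ne_zero_of_sum_ne_zero h
  obtain ⟨U, -, h⟩ := Finset.exists_ne_zero_of_sum_ne_zero h
  simp only [mul_ne_zero_iff] at h
  obtain ⟨⟨⟨hτ, hS⟩, hT⟩, hU⟩ := h
  rw [tripart_ne_zero] at hτ
  have hv : ∀ i w, sch.trialVec I.n m mc (threshold I.t j₁ j₂) ω i w ≠ 0 →
      mc (mask (sch.elems I.n m (sch.trialPerm m ω) w)) < threshold I.t j₁ j₂ i := by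
    intro i w h
    by_contra hcon
    exact h (if_neg hcon)
  have hcov := fun w => (hmc _ (sch.elems_subset I.n m (sch.trialPerm m ω) w)
    (sch.card_elems_le I.n m (sch.trialPerm m ω) w)).1
  have hS := hv 0 S hS
  have hT := hv 1 T hT
  have hU := hv 2 U hU
  simp only [threshold] at hS hT hU
  -- The bounds on `j₁` and `j₂` exclude entries of the table that stand for infinity.
  have hSc := hcov S (by omega)
  have hTc := hcov T (by omega)
  have hUc := hcov U (by omega)
  apply I.isYes_of_covered
  refine (((hSc.union hTc).union hUc).mono ?_).mono_left (show _ ≤ I.t by omega)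
  intro x hx
  have hxn := Finset.mem_range.1 hx
  -- `p` is the position that holds `x`; division by `3k` gives its block and its place in the
  -- block.
  set p := (sch.trialPerm m ω)⁻¹ x with hp
  have hk := sch.k_pos
  have hpn : p < m * (3 * sch.k) :=
    shuffle_symm_lt le_rfl (fun i hi => shuffleIndex_lt ω hi) (hxn.trans_le hn)
  have hpx : sch.trialPerm m ω p = x := by simp [hp]
  have hb : p / (3 * sch.k) < m := Nat.div_lt_of_lt_mul (by rwa [mul_comm] at hpn)
  have he : p % (3 * sch.k) ∈ Finset.range (3 * sch.k) :=
    Finset.mem_range.2 (Nat.mod_lt _ (by omega))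
  have hpe : p / (3 * sch.k) * (3 * sch.k) + p % (3 * sch.k) = p := Nat.div_add_mod' _ _
  rw [← hτ _ hb] at he
  simp only [Finset.mem_union, mem_elems] at he ⊢
  rcases he with (he | he) | he
  · exact Or.inl (Or.inl ⟨hxn, _, hb, _, he, by rw [hpe, hpx]⟩)
  · exact Or.inl (Or.inr ⟨hxn, _, hb, _, he, by rw [hpe, hpx]⟩)
  · exact Or.inr ⟨hxn, _, hb, _, he, by rw [hpe, hpx]⟩

/-- If the permutation balances a colouring, then the colour classes have codes. -/
theorem exists_codes {m : ℕ} {c : ℕ → Fin 3} {σ : Equiv.Perm (Fin (m * (3 * sch.k)))}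
    {ρ : ℕ → ℕ} (hρ : ∀ x : Fin (m * (3 * sch.k)), ρ x = σ x)
    (hσ : σ ∈ balancingPerms m sch.k fun x => c x) (h : Fin 3) :
    ∃ w < sch.N ^ m, ∀ b < m, sch.sub (dig sch.N w b) =
      (Finset.range (3 * sch.k)).filter fun e => c (ρ (b * (3 * sch.k) + e)) = h := by
  have hl : ∀ b, ∃ l, b < m → l < sch.N ∧ sch.sub l =
      (Finset.range (3 * sch.k)).filter fun e => c (ρ (b * (3 * sch.k) + e)) = h := by
    intro b
    by_cases hb : b < m
    · have hbal := (Finset.mem_filter.1 hσ).2 ⟨b, hb⟩ h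
      obtain ⟨l, hl, hls⟩ := sch.exists_sub ((Finset.range (3 * sch.k)).filter fun e =>
        c (ρ (b * (3 * sch.k) + e)) = h) (Finset.filter_subset _ _) (by
          refine Eq.trans (Eq.symm ?_) hbal
          refine Finset.card_bij (fun e _ => (e : ℕ)) ?_ ?_ ?_
          · intro e he
            simp only [Finset.mem_filter, Finset.mem_univ, true_and, Finset.mem_range] at he ⊢
            refine ⟨e.2, ?_⟩
            rw [← hρ] at he
            rw [← he, finProdFinEquiv_apply_val]
            simp only
            rw [mul_comm, add_comm]
          · intro e _ e' _ hee
            exact Fin.ext hee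
          · intro e he
            simp only [Finset.mem_filter, Finset.mem_univ, true_and, Finset.mem_range] at he ⊢
            refine ⟨⟨e, he.1⟩, ?_, rfl⟩
            rw [← hρ, finProdFinEquiv_apply_val]
            simp only
            rw [mul_comm, add_comm]
            exact he.2)
      exact ⟨l, fun _ => ⟨hl, hls⟩⟩
    · exact ⟨0, fun h => absurd h hb⟩
  choose l hl using hl
  obtain ⟨w, hw, hd⟩ := exists_digits sch.N_pos m l fun b hb => (hl b hb).1
  exact ⟨w, hw, fun b hb => by rw [hd b hb, (hl b hb).2]⟩

/-- The constant is `16 = 2 * 8`: the inexact shuffle loses a factor `2`, the random zero-one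
vectors a factor `8`. The rest is the probability that the permutation balances the colouring
obtained from a cover, whose parts have covering numbers at most `j₁`, `j₂` and `t - j₁ - j₂`. -/
theorem exists_le_prob_trialValue {I : SetCoverInstance} {m s : ℕ} {mc : ℕ → ℕ}
    (hmc : I.IsCoverTable (m * sch.k) mc) (hs : ∀ X ∈ I.fam, X.card ≤ s)
    (hn : I.n + 2 * s ≤ m * (3 * sch.k)) (hI : I.IsYes) :
    ∃ j₁ ≤ I.fam.length, ∃ j₂ ≤ I.fam.length,
      (triCount sch.k : ℝ) ^ m / (16 * 27 ^ (m * sch.k)) ≤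
        prob fun ω => sch.trialValue I.n m mc (threshold I.t j₁ j₂) ω ≠ 0 := by
  obtain ⟨g, hgl, hgt, hg⟩ := hI.covered
  have hrow : ∀ f < I.fam.length, (I.row f).card ≤ s := by
    intro f hf
    rw [I.card_row hf]
    exact hs _ (List.get_mem _ _)
  obtain ⟨A, B, C, g₁, g₂, g₃, hsum, hU, hAB, hABC, hA, hB, hC, hAc, hBc, hCc⟩ :=
    hg.split_three hrow (K := m * sch.k) (by
      rw [Finset.card_range]; convert hn using 1; ring)
  obtain ⟨c, hc, hcA⟩ := exists_balanced_colouring (n' := m * (3 * sch.k)) (by ring) (by omega)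
    hU hAB hABC hAc hBc hCc
  refine ⟨g₁, by omega, g₂, by omega, ?_⟩
  set G := balancingPerms m sch.k fun x => c x with hG
  have hcard : triCount sch.k ^ m * (m * (3 * sch.k)).factorial ≤ 27 ^ (m * sch.k) * G.card := by
    refine card_balancingPerms _ fun h => ?_
    rw [← hc h]
    refine Finset.card_bij (fun x _ => (x : ℕ)) ?_ ?_ ?_
    · intro x hx
      simp only [Finset.mem_filter, Finset.mem_univ, true_and, Finset.mem_range] at hx ⊢
      exact ⟨x.2, hx⟩
    · intro x _ x' _ hxx
      exact Fin.ext hxx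
    · intro x hx
      simp only [Finset.mem_filter, Finset.mem_univ, true_and, Finset.mem_range] at hx ⊢
      exact ⟨⟨x, hx.1⟩, hx.2, rfl⟩
  set E : (ℕ → Bool) → Prop := fun ω => ∃ σ ∈ G, ∀ x : Fin (m * (3 * sch.k)),
    sch.trialPerm m ω x = σ x with hE
  have hEG : (G.card : ℝ) / (2 * ((m * (3 * sch.k)).factorial : ℝ)) ≤ prob E :=
    le_prob_shuffle_mem (two_mul_sq_le _) G
  have hEdep : FirstCoins (sch.permTosses m) E := by
    intro ω ω' h
    simp only [hE]
    rw [sch.trialPerm_congr h]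
  -- Condition on the tosses used for the permutation; the entries of the vectors use fresh ones.
  have hmain := le_prob_and (b := 1 / 8) hEdep
    (sch.firstCoins_trialValue I.n m mc (threshold I.t g₁ g₂)) ?_
  · refine le_trans ?_ hmain
    have hfac : (0 : ℝ) < ((m * (3 * sch.k)).factorial : ℝ) := by
      exact_mod_cast Nat.factorial_pos _
    have hcard' : (triCount sch.k : ℝ) ^ m * ((m * (3 * sch.k)).factorial : ℝ) ≤
        27 ^ (m * sch.k) * (G.card : ℝ) := by exact_mod_cast hcard
    calc (triCount sch.k : ℝ) ^ m / (16 * 27 ^ (m * sch.k))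
        ≤ (G.card : ℝ) / (2 * ((m * (3 * sch.k)).factorial : ℝ)) * (1 / 8) := by
          rw [div_mul_div_comm, div_le_div_iff₀ (by positivity) (by positivity)]
          nlinarith
      _ ≤ _ := by gcongr
  · rintro ω ⟨σ, hσG, hσ⟩
    obtain ⟨S, hS, hSd⟩ := exists_codes hσ hσG 0
    obtain ⟨T, hT, hTd⟩ := exists_codes hσ hσG 1
    obtain ⟨U, hU', hUd⟩ := exists_codes hσ hσG 2
    have hsub : ∀ (h : Fin 3) (W : Finset ℕ) (w : ℕ), (∀ x < I.n, c x = h → x ∈ W) →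
        (∀ b < m, sch.sub (dig sch.N w b) = (Finset.range (3 * sch.k)).filter fun e =>
          c (sch.trialPerm m ω (b * (3 * sch.k) + e)) = h) →
        sch.elems I.n m (sch.trialPerm m ω) w ⊆ W := by
      intro h W w hW hw x hx
      obtain ⟨hxn, b, hb, e, he, rfl⟩ := sch.mem_elems.1 hx
      rw [hw b hb] at he
      exact hW _ hxn (Finset.mem_filter.1 he).2
    have hle : ∀ (W : Finset ℕ) (w j : ℕ), sch.elems I.n m (sch.trialPerm m ω) w ⊆ W →
        j ≤ I.fam.length → Covered I.row I.fam.length j W →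
        mc (mask (sch.elems I.n m (sch.trialPerm m ω) w)) ≤ j := fun W w j hW hj hcov =>
      (hmc _ (sch.elems_subset _ _ _ _) (sch.card_elems_le _ _ _ _)).2 j hj (hcov.mono hW)
    have hS1 := hle A S g₁ (hsub 0 A S (fun x hx => (hcA x hx).1) hSd) (by omega) hA
    have hT1 := hle B T g₂ (hsub 1 B T (fun x hx => (hcA x hx).2.1) hTd) (by omega) hB
    have hU1 := hle C U g₃ (hsub 2 C U (fun x hx => (hcA x hx).2.2) hUd) (by omega) hC
    -- With the permutation fixed, the support conditions are constants. The value is a trilinear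
    -- form in the fresh tosses whose coefficient at `(S, T, U)` is nonzero.
    let ind : ℕ → ℕ → K := fun h w =>
      if mc (mask (sch.elems I.n m (sch.trialPerm m ω) w)) < threshold I.t g₁ g₂ h then 1 else 0
    have hτ : sch.tripart m S T U ≠ 0 := by
      rw [sch.tripart_ne_zero]
      intro b hb
      rw [hSd b hb, hTd b hb, hUd b hb]
      ext e
      simp only [Finset.mem_union, Finset.mem_filter]
      have : ∀ y : Fin 3, y = 0 ∨ y = 1 ∨ y = 2 := by decide
      have := this (c (sch.trialPerm m ω (b * (3 * sch.k) + e)))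
      tauto
    refine (eighth_le_prob_trilinear (K := K) (P := sch.N ^ m)
      (fun S T U => sch.tripart m S T U * ind 0 S * ind 1 T * ind 2 U) hS hT hU' ?_).trans
      (prob_mono fun ω' h => ?_)
    · have i0 : ind 0 S = 1 := if_pos (by simp only [threshold]; omega)
      have i1 : ind 1 T = 1 := if_pos (by simp only [threshold]; omega)
      have i2 : ind 2 U = 1 := if_pos (by simp only [threshold]; omega)
      simpa [i0, i1, i2] using hτ
    · convert h using 1
      have hv : ∀ h w, sch.trialVec I.n m mc (threshold I.t g₁ g₂)
          (joinCoins (sch.permTosses m) ω ω') h w = ind h w * coinVal K (ω' (h * sch.N ^ m + w)) := by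
        intro h w
        unfold trialVec
        rw [sch.trialPerm_congr (ω' := ω) fun i hi => joinCoins_of_lt hi _ _,
          show joinCoins (sch.permTosses m) ω ω' (sch.permTosses m + h * sch.N ^ m + w) =
            ω' (h * sch.N ^ m + w) by rw [joinCoins, if_neg (by omega)]; congr 1; omega]
        simp only [ind]
        split_ifs <;> simp
      simp only [trialValue, tensorValue, hv, zero_mul, zero_add, one_mul]
      refine Finset.sum_congr rfl fun S _ => Finset.sum_congr rfl fun T _ =>
        Finset.sum_congr rfl fun U _ => ?_
      rw [two_mul]
      ring

end Scheme

/-! ### Preparations: tables, powers, bit weights -/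

local notation "vBLOCKS" => (8 : ℕ)
local notation "vSIZE" => (9 : ℕ)
local notation "aWEIGHT" => (10 : ℕ)
local notation "aLIST" => (15 : ℕ)
local notation "aCARD" => (16 : ℕ)
local notation "vCOUNT" => (17 : ℕ)
local notation "aCOVER" => (18 : ℕ)
local notation "vMASK" => (19 : ℕ)
local notation "vTMP" => (26 : ℕ)

open RExpr (var lit get)

namespace RProg

variable {ω : ℕ → Bool} {L X : ℕ} {m : Memory} {t : ℕ}

/-- Makes the register bound available inside a proof; a copied value then needs no separate
estimate. -/
theorem WP.of_small {p : RProg} {Q : Memory → ℕ → Prop}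
    (h : (∀ a i, m a i < 2 ^ L) → WP ω L X p m t Q) : WP ω L X p m t Q := fun hm => h hm hm

/-- Write the values `f 0, …, f (len - 1)` into array `a`. -/
def table (a : ℕ) (f : ℕ → ℕ) : ℕ → RProg
  | 0 => .skip
  | i + 1 => .seq (table a f i) (.store a (lit i) (lit (f i)))

theorem mem_writes_table {a b : ℕ} {f : ℕ → ℕ} {len : ℕ} (h : b ∈ (table a f len).writes) :
    b = a := by
  induction len with
  | zero => simp [table, writes] at h
  | succ len ih =>
    simp only [table, writes, List.mem_append, List.mem_singleton] at h
    exact h.elim ih id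

theorem wp_table {a : ℕ} {f : ℕ → ℕ} {len : ℕ} (hf : ∀ i < len, f i < 2 ^ L) (hX : 1 ≤ X) :
    WP ω L X (table a f len) m t fun m' t' => (∀ i < len, m' a i = f i) ∧ t' = t := by
  induction len with
  | zero => exact wp_skip hX ⟨by simp, rfl⟩
  | succ len ih =>
    refine wp_seq ((ih fun i hi => hf i (by omega)).mono fun m' t' ⟨h, ht⟩ => ?_)
    refine wp_store hX (hf len (by omega)) ⟨fun i hi => ?_, ht⟩
    simp only [RExpr.eval_lit, Memory.write_index]
    split_ifs with hil
    · rw [hil]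
    · exact h i (by omega)

/-- Compute the power of a constant whose exponent is the number of blocks. -/
def power (dst base : ℕ) : RProg :=
  set dst 1 ;; forLoop 40 (var vBLOCKS) (set dst (var dst * lit base))

theorem wp_power {dst base M : ℕ} (hd : dst ≠ 8) (hd' : dst ≠ 40) (hb : 0 < base)
    (hM : m vBLOCKS 0 = M) (hML : M < 2 ^ L) (hL : base ^ M < 2 ^ L) (hX : M + 1 ≤ X) :
    WP ω L X (power dst base) m t fun m' t' => m' dst 0 = base ^ M ∧ t' = t := by
  have h1 : 1 < 2 ^ L := lt_of_le_of_lt (Nat.one_le_pow _ _ hb) hL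
  refine wp_seq (wp_store (by omega) (by simpa using h1) ?_)
  refine wp_forLoop (X := 1) M (fun j m' t' => m' dst 0 = base ^ j ∧ t' = t)
    (by simp [writes, hd'.symm]) le_rfl ?_ hML ?_ ?_ ?_ (by omega) (fun _ _ h _ => h)
  · intro m' h
    simp [h 8 (by simp [forLoop, writes, hd.symm]), hM, hd.symm]
  · intro j m' t' v h
    simpa [hd'] using h
  · simp
  · rintro j m' t' hj - - ⟨h, ht⟩
    refine wp_store le_rfl ?_ ?_
    · simp only [RExpr.eval_mul, RExpr.eval_get, RExpr.eval_lit, h, ← pow_succ]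
      exact lt_of_le_of_lt (Nat.pow_le_pow_right hb hj) hL
    · simp [h, ht, pow_succ]

/-- Compute the bit weights `2 ^ e` for `e < n`. -/
def weights : RProg :=
  set vTMP 1 ;; forLoop 40 (var 0) (.store aWEIGHT (var 40) (var vTMP) ;; set vTMP (var vTMP * 2))

/-- The array must start out as zero because the entries from `n` on are never written: they are the
zero weights of the padding elements. -/
theorem wp_weights {n : ℕ} (hn : m 0 0 = n) (h0 : m aWEIGHT = 0) (hL : 2 ^ n < 2 ^ L)
    (hX : n + 1 ≤ X) :
    WP ω L X weights m t fun m' t' => m' aWEIGHT = bitWeight n ∧ t' = t := by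
  have h1 : 1 < 2 ^ L := lt_of_le_of_lt Nat.one_le_two_pow hL
  have hnL : n < 2 ^ L := Nat.lt_two_pow_self.trans hL
  refine wp_seq (wp_store (by omega) (by simpa using h1) ?_)
  refine wp_forLoop (X := 1) n (fun j m' t' => m' aWEIGHT = bitWeight j ∧ m' vTMP 0 = 2 ^ j ∧ t' = t)
    (by simp [writes]) le_rfl ?_ hnL ?_ ?_ ?_ (by omega) (fun _ _ h _ => ⟨h.1, h.2.2⟩)
  · intro m' h
    simp [h 0 (by simp [forLoop, writes]), hn]
  · intro j m' t' v h
    simpa using h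
  · simp only [RExpr.eval_ofNat]
    refine ⟨?_, by simp, trivial⟩
    rw [Memory.write_of_ne _ _ _ (by decide), h0]
    funext e
    simp [bitWeight]
  · rintro j m' t' hj hij - ⟨h, h2, ht⟩
    have hpow : 2 ^ (j + 1) < 2 ^ L := lt_of_le_of_lt (Nat.pow_le_pow_right (by norm_num) hj) hL
    refine wp_seq (wp_store le_rfl ?_ (wp_store le_rfl ?_ ⟨?_, ?_, ht⟩))
    · simp only [RExpr.eval_get, RExpr.eval_lit, h2]; rw [pow_succ] at hpow; omega
    · simpa [h2, pow_succ] using hpow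
    · simp only [RExpr.eval_get, RExpr.eval_lit, hij, h2]
      rw [Memory.write_of_ne _ _ _ (by decide)]
      funext e
      rw [Memory.write_index, h]
      simp only [bitWeight]
      split_ifs <;> first | omega | simp_all
    · simp [h2, pow_succ]

/-! ### Bit masks -/

theorem _root_.mask_div_mod (S : Finset ℕ) (e : ℕ) : mask S / 2 ^ e % 2 = if e ∈ S then 1 else 0 := by
  have h1 : e ∈ S ↔ (mask S).testBit e := by
    rw [← Nat.mem_bitIndices, ← List.mem_toFinset, mask, Finset.toFinset_bitIndices_sum_two_pow]
  rw [Nat.testBit_eq_decide_div_mod_eq, decide_eq_true_eq] at h1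
  split_ifs with h
  · exact h1.1 h
  · have := Nat.mod_two_eq_zero_or_one (mask S / 2 ^ e)
    tauto

theorem _root_.mask_injective : Function.Injective mask := by
  intro S T h
  ext e
  have h1 := mask_div_mod S e
  rw [h, mask_div_mod] at h1
  by_cases hS : e ∈ S <;> by_cases hT : e ∈ T <;> simp_all

theorem _root_.mask_lt {S : Finset ℕ} {n : ℕ} (h : S ⊆ Finset.range n) : mask S < 2 ^ n := by
  calc mask S ≤ mask (Finset.range n) := Finset.sum_le_sum_of_subset h
    _ < 2 ^ n := by
      have := Nat.geomSum_eq (le_refl 2) n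
      unfold mask
      rw [this]
      have : 0 < 2 ^ n := by positivity
      simp only [Nat.add_one_sub_one, Nat.div_one]
      omega

/-! ### Listing the small subsets -/

/-- The memory lists the sets that satisfy `P`, without repetitions, as `F 0, …, F (cnt - 1)`. -/
def Listing (m : Memory) (P : Finset ℕ → Prop) (cnt : ℕ) (F : ℕ → Finset ℕ) : Prop :=
  m vCOUNT 0 = cnt ∧ (∀ i < cnt, m aLIST i = mask (F i) ∧ m aCARD i = (F i).card) ∧
    (∀ i < cnt, ∀ j < cnt, F i = F j → i = j) ∧ ∀ S, P S ↔ ∃ i < cnt, F i = S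

theorem Listing.congr {m m' : Memory} {P : Finset ℕ → Prop} {cnt : ℕ} {F : ℕ → Finset ℕ}
    (h : Listing m P cnt F) (h1 : m' vCOUNT = m vCOUNT) (h2 : m' aLIST = m aLIST)
    (h3 : m' aCARD = m aCARD) : Listing m' P cnt F := by
  unfold Listing at *
  rwa [h1, h2, h3]

theorem Listing.count_le {P : Finset ℕ → Prop} {cnt : ℕ} {F : ℕ → Finset ℕ}
    (h : Listing m P cnt F) (s : Finset (Finset ℕ)) (hs : ∀ S, P S → S ∈ s) : cnt ≤ s.card := by
  rw [← Finset.card_range cnt]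
  exact Finset.card_le_card_of_injOn F
    (fun i hi => hs _ ((h.2.2.2 _).2 ⟨i, Finset.mem_range.1 hi, rfl⟩))
    (fun i hi j hj hij => h.2.2.1 i (Finset.mem_range.1 hi) j (Finset.mem_range.1 hj) hij)

/-- Extend each listed set of size less than `K` by the element `e`. -/
def listStep (K e : RExpr) : RProg :=
  .store aLIST (var vCOUNT) (get aLIST (var 41) + get aWEIGHT e) ;;
  .store aCARD (var vCOUNT) (get aCARD (var 41) + 1) ;;
  -- Without a branch: the count grows exactly when the old set has fewer than `K` elements.
  -- Otherwise the entry just written stays beyond the end of the list.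
  set vCOUNT (var vCOUNT + (1 - (get aCARD (var 41) + 1 - K)))

/-- List the bit masks of all subsets of `{0, …, n - 1}` of size at most `k` times the number of
blocks. -/
def listSets (k : ℕ) : RProg :=
  .store aLIST 0 0 ;; .store aCARD 0 0 ;; set vCOUNT 1 ;;
  -- The old count is saved because `vCOUNT` grows during the inner loop, whose bound must stay
  -- fixed.
  forLoop 40 (var 0) (set vTMP (var vCOUNT) ;;
    forLoop 41 (var vTMP) (listStep (var vBLOCKS * lit k) (var 40)))

/-- The subsets of `{0, …, n - 1}` of size at most `K`. -/
def _root_.IsSmallSubset (n K : ℕ) (S : Finset ℕ) : Prop := S ⊆ Finset.range n ∧ S.card ≤ K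

/-- The number of subsets of an `n`-element set of size at most `K`. -/
def _root_.smallSubsetCount (n K : ℕ) : ℕ :=
  ((Finset.range n).powerset.filter fun S => S.card ≤ K).card

theorem _root_.smallSubsetCount_mono {n n' : ℕ} (h : n ≤ n') (K : ℕ) :
    smallSubsetCount n K ≤ smallSubsetCount n' K :=
  Finset.card_le_card (Finset.filter_subset_filter _
    (Finset.powerset_mono.2 (Finset.range_mono h)))

theorem _root_.smallSubsetCount_le (n K : ℕ) : smallSubsetCount n K ≤ 2 ^ n := by
  refine (Finset.card_filter_le _ _).trans ?_
  rw [Finset.card_powerset, Finset.card_range]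

theorem Listing.count_le_smallSubsetCount {n K cnt : ℕ} {F : ℕ → Finset ℕ}
    (h : Listing m (IsSmallSubset n K) cnt F) : cnt ≤ smallSubsetCount n K :=
  h.count_le _ fun _ hS => Finset.mem_filter.2 ⟨Finset.mem_powerset.2 hS.1, hS.2⟩

/-- The sets listed while the element `e` is being added to the first `q` of the sets `F i`. -/
def PartialExtension (K e c q : ℕ) (F : ℕ → Finset ℕ) (S : Finset ℕ) : Prop :=
  (∃ i < c, F i = S) ∨ ∃ i < q, (F i).card < K ∧ insert e (F i) = S

theorem Listing.extend {K e c q n : ℕ} {F G : ℕ → Finset ℕ} {cnt : ℕ}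
    (hF : Listing m (PartialExtension K e c q F) cnt G) (hFG : ∀ i < c, G i = F i) (hc : c ≤ cnt)
    (hq : q < c) (hsub : ∀ i < c, F i ⊆ Finset.range e)
    (hinj : ∀ i < c, ∀ j < c, F i = F j → i = j) (hen : e < n) (hw : m aWEIGHT e = 2 ^ e)
    (hnL : 2 ^ n < 2 ^ L) (hcard : ∀ i < c, (F i).card ≤ K) (hK : K + 1 < 2 ^ L)
    (hcL : cnt + 1 < 2 ^ L) (h40 : m 40 0 = e) (h41 : m 41 0 = q) {Ke : RExpr}
    (hKe : ∀ m' : Memory, m' vBLOCKS = m vBLOCKS → Ke.eval m' = K) :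
    WP ω L 1 (listStep Ke (var 40)) m t fun m' t' => t' = t ∧ ∃ cnt' G', c ≤ cnt' ∧
      (∀ i < c, G' i = F i) ∧ Listing m' (PartialExtension K e c (q + 1) F) cnt' G' := by
  obtain ⟨h1, h2, h3, h4⟩ := hF
  have hq' : q < cnt := by omega
  have hGq : G q = F q := hFG q hq
  have hlist : m aLIST q = mask (F q) := by rw [(h2 q hq').1, hGq]
  have hcrd : m aCARD q = (F q).card := by rw [(h2 q hq').2, hGq]
  have he : e ∉ F q := fun h => by simpa using hsub q hq h
  have hins : mask (insert e (F q)) = mask (F q) + 2 ^ e := by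
    unfold mask; rw [Finset.sum_insert he, add_comm]
  have hlt : mask (insert e (F q)) < 2 ^ n := mask_lt (by
    intro x hx
    rw [Finset.mem_insert] at hx
    rcases hx with rfl | hx
    · simpa using hen
    · have := Finset.mem_range.1 (hsub q hq hx); simp; omega)
  refine wp_seq (wp_store le_rfl ?_ (wp_seq (wp_store le_rfl ?_ (wp_store le_rfl ?_ ⟨rfl, ?_⟩))))
  · simp only [RExpr.eval_add, RExpr.eval_get, RExpr.eval_lit, h40, h41, hlist, hw]
    omega
  · simp [h41, hcrd]
    have := hcard q hq
    omega
  · simp only [RExpr.eval_add, RExpr.eval_get, RExpr.eval_lit, RExpr.eval_sub, RExpr.eval_ofNat]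
    simp [h1]
    omega
  · have hcnt : (cnt = q) = False := by simp; omega
    have hcnt' : (q = cnt) = False := by simp; omega
    simp only [RExpr.eval_add, RExpr.eval_get, RExpr.eval_lit, RExpr.eval_sub, RExpr.eval_ofNat]
    simp only [Memory.write_of_ne, ne_eq, Nat.reduceEqDiff, not_false_eq_true, Memory.write_index,
      h1, h41, h40, hlist, hcrd, hcnt', if_false, hw, hKe]
    by_cases hlt' : (F q).card < K
    · refine ⟨cnt + 1, Function.update G cnt (insert e (F q)), by omega, ?_, ?_, ?_, ?_, ?_⟩
      · intro i hi
        rw [Function.update_of_ne (by omega), hFG i hi]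
      · simp; omega
      · intro i hi
        simp only [Memory.write_of_ne, ne_eq, Nat.reduceEqDiff, not_false_eq_true,
          Memory.write_index, Function.update_apply]
        split_ifs with hic
        · exact ⟨hins.symm, by rw [Finset.card_insert_of_notMem he]⟩
        · exact h2 i (by omega)
      -- The sets listed before this round do not contain `e`; extensions made in this round differ
      -- because the sets without `e` do.
      · have hnew : ∀ i < cnt, G i ≠ insert e (F q) := by
          intro i hi hcon
          rcases (h4 (G i)).2 ⟨i, hi, rfl⟩ with ⟨j, hj, hj'⟩ | ⟨j, hj, -, hj'⟩
          · have : e ∈ F j := by rw [hj', hcon]; exact Finset.mem_insert_self _ _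
            simpa using hsub j hj this
          · rw [hcon] at hj'
            have hej : e ∉ F j := fun h => by simpa using hsub j (by omega) h
            have := congrArg (Finset.erase · e) hj'
            simp only [Finset.erase_insert hej, Finset.erase_insert he] at this
            have := hinj j (by omega) q hq this
            omega
        intro i hi j hj hij
        simp only [Function.update_apply] at hij
        split_ifs at hij with hi' hj' hj'
        · omega
        · exact absurd hij.symm (hnew j (by omega))
        · exact absurd hij (hnew i (by omega))
        · exact h3 i (by omega) j (by omega) hij
      · intro S
        have := h4 S
        constructor
        · rintro (h | ⟨i, hi, h⟩)
          · obtain ⟨i, hi, hS⟩ := this.1 (Or.inl h)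
            exact ⟨i, by omega, by rw [Function.update_of_ne (by omega), hS]⟩
          · rcases Nat.lt_succ_iff_lt_or_eq.1 hi with hi | rfl
            · obtain ⟨i, hi, hS⟩ := this.1 (Or.inr ⟨i, hi, h⟩)
              exact ⟨i, by omega, by rw [Function.update_of_ne (by omega), hS]⟩
            · exact ⟨cnt, by omega, by rw [Function.update_self, h.2]⟩
        · rintro ⟨i, hi, hS⟩
          rw [Function.update_apply] at hS
          split_ifs at hS with hic
          · exact Or.inr ⟨q, by omega, hlt', hS⟩
          · rcases this.2 ⟨i, by omega, hS⟩ with h | ⟨i, hi, h⟩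
            · exact Or.inl h
            · exact Or.inr ⟨i, by omega, h⟩
    · refine ⟨cnt, G, hc, hFG, ?_, ?_, h3, ?_⟩
      · simp; omega
      · intro i hi
        have : (i = cnt) = False := by simp; omega
        simp only [Memory.write_of_ne, ne_eq, Nat.reduceEqDiff, not_false_eq_true,
          Memory.write_index, this, if_false]
        exact h2 i hi
      · intro S
        rw [← h4 S]
        constructor
        · rintro (h | ⟨i, hi, h⟩)
          · exact Or.inl h
          · rcases Nat.lt_succ_iff_lt_or_eq.1 hi with hi | rfl
            · exact Or.inr ⟨i, hi, h⟩
            · exact absurd h.1 hlt'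
        · rintro (h | ⟨i, hi, h⟩)
          · exact Or.inl h
          · exact Or.inr ⟨i, by omega, h⟩

/-- A small set either avoids `e`, or arises by inserting `e` into a set that is smaller by one. -/
theorem partialExtension_all {K e c : ℕ} {F : ℕ → Finset ℕ}
    (hF : ∀ S, IsSmallSubset e K S ↔ ∃ i < c, F i = S) (S : Finset ℕ) :
    PartialExtension K e c c F S ↔ IsSmallSubset (e + 1) K S := by
  constructor
  · rintro (h | ⟨i, hi, hlt, rfl⟩)
    · obtain ⟨h1, h2⟩ := (hF S).2 h
      exact ⟨h1.trans (Finset.range_mono (by omega)), h2⟩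
    · obtain ⟨h1, h2⟩ := (hF (F i)).2 ⟨i, hi, rfl⟩
      refine ⟨?_, (Finset.card_insert_le _ _).trans hlt⟩
      rw [Finset.range_add_one]
      exact Finset.insert_subset_insert _ h1
  · rintro ⟨h1, h2⟩
    by_cases he : e ∈ S
    · right
      have hc := Finset.card_erase_of_mem he
      have hpos : 0 < S.card := Finset.card_pos.2 ⟨e, he⟩
      obtain ⟨i, hi, hS⟩ := (hF (S.erase e)).1 ⟨fun x hx => by
        have := Finset.mem_range.1 (h1 (Finset.mem_of_mem_erase hx))
        have := Finset.ne_of_mem_erase hx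
        simp; omega, by omega⟩
      exact ⟨i, hi, by rw [hS]; omega, by rw [hS, Finset.insert_erase he]⟩
    · left
      refine (hF S).1 ⟨fun x hx => ?_, h2⟩
      have := Finset.mem_range.1 (h1 hx)
      have : x ≠ e := fun h => he (h ▸ hx)
      simp; omega

/-- The enumeration passes through small sets only, so its cost is governed by their number and not
by `2 ^ n`. -/
theorem wp_listSets {n k M : ℕ} (hn : m 0 0 = n) (hM : m vBLOCKS 0 = M)
    (hw : m aWEIGHT = bitWeight n) (hL : 2 ^ (n + 1) < 2 ^ L) (hK : M * k + 1 < 2 ^ L)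
    (hX : (smallSubsetCount n (M * k) + 1) * (n + 1) ≤ X) :
    WP ω L X (listSets k) m t fun m' t' => t' = t ∧
      ∃ cnt F, Listing m' (IsSmallSubset n (M * k)) cnt F := by
  have hnL : 2 ^ n < 2 ^ L := lt_of_le_of_lt (Nat.pow_le_pow_right (by norm_num) (by omega)) hL
  have h1L : 1 < 2 ^ L := by omega
  have hX1 : 1 ≤ X := le_trans (Nat.mul_pos (by omega) (by omega)) hX
  refine wp_seq (wp_store hX1 (by simp) (wp_seq (wp_store hX1
    (by simp) (wp_seq (wp_store hX1 (by simpa using h1L) ?_)))))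
  refine wp_forLoop (X := smallSubsetCount n (M * k) + 1) n
    (fun e m' t' => t' = t ∧ ∃ cnt F, Listing m' (IsSmallSubset e (M * k)) cnt F)
    (by simp [writes, forLoop, listStep]) (by omega) ?_ (Nat.lt_two_pow_self.trans hnL) ?_ ?_ ?_ hX
    (fun _ _ h _ => h)
  · intro m' h
    simp [h 0 (by simp [forLoop, writes, listStep]), hn]
  · rintro e m' t' v ⟨ht, cnt, F, h⟩
    exact ⟨ht, cnt, F, h.congr (by simp) (by simp) (by simp)⟩
  · refine ⟨rfl, 1, fun _ => ∅, by simp, by simp [mask], ?_, ?_⟩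
    · intro i hi j hj _; omega
    · intro S
      constructor
      · rintro ⟨h, -⟩; exact ⟨0, by omega, (Finset.subset_empty.1 h).symm⟩
      · rintro ⟨_, _, rfl⟩; exact ⟨by simp, by simp⟩
  · rintro e m' t' he h40 hfr ⟨ht, c, F, hF⟩
    have hc2 : c ≤ smallSubsetCount n (M * k) :=
      hF.count_le_smallSubsetCount.trans (smallSubsetCount_mono he.le _)
    have hcn := hc2.trans (smallSubsetCount_le n _)
    have hsub : ∀ i < c, F i ⊆ Finset.range e := fun i hi => ((hF.2.2.2 _).2 ⟨i, hi, rfl⟩).1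
    have hcd : ∀ i < c, (F i).card ≤ M * k := fun i hi => ((hF.2.2.2 _).2 ⟨i, hi, rfl⟩).2
    refine wp_seq (wp_store (by omega) (by simp [hF.1]; omega) ?_)
    refine wp_forLoop (X := 1) c (fun q m'' t'' => t'' = t ∧ ∃ cnt G, c ≤ cnt ∧
      (∀ i < c, G i = F i) ∧ Listing m'' (PartialExtension (M * k) e c q F) cnt G)
      (by simp [writes, listStep]) le_rfl ?_ (by omega) ?_ ?_ ?_ (by omega) ?_
    · intro m'' h
      simp [h 26 (by simp [forLoop, writes, listStep]), hF.1]
    · rintro q m'' t'' v ⟨ht, cnt, G, hc, hG, h⟩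
      exact ⟨ht, cnt, G, hc, hG, h.congr (by simp) (by simp) (by simp)⟩
    · refine ⟨ht, c, F, le_rfl, fun _ _ => rfl, ?_⟩
      refine ⟨by simp [hF.1], by simpa using hF.2.1, hF.2.2.1, fun S => ?_⟩
      simp [PartialExtension]
    · rintro q m'' t'' hq h41 hfr' ⟨ht, cnt, G, hc, hG, h⟩
      have hcnt : cnt ≤ 2 ^ n := by
        refine (h.count_le (Finset.range n).powerset fun S hS => ?_).trans
          (by rw [Finset.card_powerset, Finset.card_range])
        rw [Finset.mem_powerset]
        have hr : Finset.range e ⊆ Finset.range n := Finset.range_mono he.le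
        rcases hS with ⟨i, hi, rfl⟩ | ⟨i, hi, -, rfl⟩
        · exact (hsub i hi).trans hr
        · exact Finset.insert_subset (by simpa using he) ((hsub i (by omega)).trans hr)
      have hw2 : m'' aWEIGHT e = 2 ^ e := by
        rw [hfr' 10 (by simp [forLoop, writes, listStep]), Memory.write_of_ne _ _ _ (by decide),
          hfr 10 (by simp [forLoop, writes, listStep])]
        simp [hw, bitWeight, he]
      have hb2 : m'' vBLOCKS 0 = M := by
        rw [hfr' 8 (by simp [forLoop, writes, listStep]), Memory.write_of_ne _ _ _ (by decide),
          hfr 8 (by simp [forLoop, writes, listStep])]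
        simp [hM]
      have h402 : m'' 40 0 = e := by
        rw [hfr' 40 (by simp [forLoop, writes, listStep]), Memory.write_of_ne _ _ _ (by decide), h40]
      have h2n : 2 ^ (n + 1) = 2 * 2 ^ n := by ring
      have : 1 ≤ 2 ^ n := Nat.one_le_two_pow
      refine (h.extend hG hc hq hsub hF.2.2.1 he hw2 hnL hcd hK ?_ h402 h41 ?_).mono ?_
      · by_cases h0 : n = 0
        · omega
        · have : 2 ^ 1 ≤ 2 ^ n := Nat.pow_le_pow_right (by norm_num) (by omega)
          omega
      · intro m3 h3
        simp [h3, hb2]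
      · rintro m3 t3 ⟨h3, h4⟩
        exact ⟨h3.trans ht, h4⟩
    · rintro m'' t'' ⟨ht, cnt, G, hc, hG, h⟩ -
      exact ⟨ht, cnt, G, h.1, h.2.1, h.2.2.1, fun S => by
        rw [← partialExtension_all hF.2.2.2, h.2.2.2]⟩

end RProg

/-! ### The table of covering numbers -/

namespace SetCoverInstance

variable (I : SetCoverInstance)

/-- Entries of `g` that are at most `l + t` are upper bounds for covering numbers. -/
def CoverSound (K : ℕ) (g : ℕ → ℕ) : Prop := ∀ S, IsSmallSubset I.n K S →
  g (mask S) ≤ I.fam.length + I.t → Covered I.row I.fam.length (g (mask S)) S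

/-- The entries of `g` are correct for sets of covering number at most `j`. -/
def CoverComplete (K j : ℕ) (g : ℕ → ℕ) : Prop := ∀ S, IsSmallSubset I.n K S →
  ∀ i ≤ j, Covered I.row I.fam.length i S → g (mask S) ≤ i

/-- Improve the entry for `S` with the help of the set in row `f`. -/
def relax (S : Finset ℕ) (f : ℕ) (g : ℕ → ℕ) : ℕ → ℕ :=
  -- In truncated subtraction `a - (a - b)` is `min a b`.
  Function.update g (mask S) (g (mask S) - (g (mask S) - (1 + g (mask (S \ I.row f)))))

variable {I}

theorem relax_le (S : Finset ℕ) (f : ℕ) (g : ℕ → ℕ) (x : ℕ) : I.relax S f g x ≤ g x := by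
  unfold relax
  rw [Function.update_apply]
  split_ifs with h
  · rw [h]; omega
  · rfl

theorem relax_self_le (S : Finset ℕ) (f : ℕ) (g : ℕ → ℕ) :
    I.relax S f g (mask S) ≤ 1 + g (mask (S \ I.row f)) := by
  unfold relax
  rw [Function.update_self]
  omega

theorem CoverSound.relax {K : ℕ} {g : ℕ → ℕ} (h : I.CoverSound K g) {S : Finset ℕ}
    (hS : IsSmallSubset I.n K S) {f : ℕ} (hf : f < I.fam.length) :
    I.CoverSound K (I.relax S f g) := by
  intro T hT hle
  by_cases hTS : T = S
  · subst hTS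
    unfold SetCoverInstance.relax at hle ⊢
    rw [Function.update_self] at hle ⊢
    have h' := h (T \ I.row f) ⟨Finset.sdiff_subset.trans hT.1,
      (Finset.card_le_card Finset.sdiff_subset).trans hT.2⟩
    by_cases hlt : 1 + g (mask (T \ I.row f)) < g (mask T)
    · rw [show g (mask T) - (g (mask T) - (1 + g (mask (T \ I.row f)))) =
        g (mask (T \ I.row f)) + 1 by omega] at hle ⊢
      exact Or.inr ⟨f, hf, h' (by omega)⟩
    · rw [show g (mask T) - (g (mask T) - (1 + g (mask (T \ I.row f)))) = g (mask T) by omega]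
        at hle ⊢
      exact h T hT hle
  · unfold SetCoverInstance.relax at hle ⊢
    rw [Function.update_of_ne (fun h => hTS (mask_injective h))] at hle ⊢
    exact h T hT hle

theorem CoverComplete.of_le {K j : ℕ} {g g' : ℕ → ℕ} (h : I.CoverComplete K j g)
    (hle : ∀ x, g' x ≤ g x) : I.CoverComplete K j g' :=
  fun S hS i hi hc => (hle _).trans (h S hS i hi hc)

end SetCoverInstance

namespace RProg

variable {ω : ℕ → Bool} {L X : ℕ} {m : Memory} {t : ℕ}

/-- Compute the mask of the `q`-th listed set without the elements of row `f`, and use it to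
improve the table entry of the `q`-th set, where `q`, `f` are the values of variables `41`, `42`. -/
def relaxProg : RProg :=
  set vMASK 0 ;;
  forLoop 43 (var 0) (set vMASK (var vMASK + get aWEIGHT (var 43) *
    (get aLIST (var 41) / get aWEIGHT (var 43) % 2) * (1 - get 1 (var 42 * var 0 + var 43)))) ;;
  .store aCOVER (get aLIST (var 41)) (get aCOVER (get aLIST (var 41)) -
    (get aCOVER (get aLIST (var 41)) - (1 + get aCOVER (var vMASK))))

/-- Compute the table of covering numbers. -/
def coverTable : RProg :=
  -- The value `l + t + 1`, with `l` the size of the family, stands for infinity.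
  forLoop 41 (var vCOUNT) (.store aCOVER (get aLIST (var 41)) (get 0 2 + get 0 1 + 1)) ;;
  .store aCOVER 0 0 ;;
  forLoop 40 (get 0 2) (forLoop 41 (var vCOUNT) (forLoop 42 (get 0 2) relaxProg))

theorem _root_.mask_filter_succ (S : Finset ℕ) (j : ℕ) :
    mask (S.filter (· < j + 1)) = mask (S.filter (· < j)) + 2 ^ j * (mask S / 2 ^ j % 2) := by
  rw [mask_div_mod]
  split_ifs with h
  · have : S.filter (· < j + 1) = insert j (S.filter (· < j)) := by
      ext x
      simp only [Finset.mem_filter, Finset.mem_insert]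
      constructor
      · rintro ⟨h1, h2⟩; by_cases hx : x = j
        · exact Or.inl hx
        · exact Or.inr ⟨h1, by omega⟩
      · rintro (rfl | ⟨h1, h2⟩)
        · exact ⟨h, by omega⟩
        · exact ⟨h1, by omega⟩
    rw [this, mask, Finset.sum_insert (by simp), mul_one, add_comm]
    rfl
  · have : S.filter (· < j + 1) = S.filter (· < j) := by
      ext x
      simp only [Finset.mem_filter]
      constructor
      · rintro ⟨h1, h2⟩
        have : x ≠ j := fun hx => h (hx ▸ h1)
        exact ⟨h1, by omega⟩
      · rintro ⟨h1, h2⟩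
        exact ⟨h1, by omega⟩
    rw [this, mul_zero, add_zero]

theorem wp_relaxProg {I : SetCoverInstance} {K cnt q f : ℕ} {F : ℕ → Finset ℕ}
    (hin0 : m 0 = I.input 0) (hin1 : m 1 = I.input 1) (hw : m aWEIGHT = bitWeight I.n)
    (hF : Listing m (IsSmallSubset I.n K) cnt F) (hq : q < cnt)
    (h41 : m 41 0 = q) (h42 : m 42 0 = f) (hL : 2 ^ I.n < 2 ^ L) :
    WP ω L (I.n + 1) relaxProg m t fun m' t' => t' = t ∧
      m' aCOVER = I.relax (F q) f (m aCOVER) := by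
  have hm0 : m 0 0 = I.n := by rw [hin0]; rfl
  have hFq : IsSmallSubset I.n K (F q) := (hF.2.2.2 _).2 ⟨q, hq, rfl⟩
  have hlist : m aLIST q = mask (F q) := (hF.2.1 q hq).1
  refine wp_seq (wp_store (by omega) (by simp) ?_)
  refine wp_seq (wp_forLoop (X := 1) I.n (fun e m' t' => t' = t ∧
    m' vMASK 0 = mask ((F q \ I.row f).filter (· < e))) (by simp [writes]) le_rfl ?_
    (Nat.lt_two_pow_self.trans hL) ?_ ?_ ?_ (by omega) ?_)
  · intro m' h
    simp [h 0 (by simp [forLoop, writes]), hm0]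
  · intro e m' t' v h
    simpa using h
  · exact ⟨rfl, by simp [mask]⟩
  · rintro e m' t' he h43 hfr ⟨ht, hacc⟩
    have g0 : m' 0 = m 0 := by
      rw [hfr 0 (by simp [forLoop, writes]), Memory.write_of_ne _ _ _ (by decide)]
    have g1 : m' 1 = m 1 := by
      rw [hfr 1 (by simp [forLoop, writes]), Memory.write_of_ne _ _ _ (by decide)]
    have g10 : m' 10 = m 10 := by
      rw [hfr 10 (by simp [forLoop, writes]), Memory.write_of_ne _ _ _ (by decide)]
    have g15 : m' 15 = m 15 := by
      rw [hfr 15 (by simp [forLoop, writes]), Memory.write_of_ne _ _ _ (by decide)]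
    have g41 : m' 41 = m 41 := by
      rw [hfr 41 (by simp [forLoop, writes]), Memory.write_of_ne _ _ _ (by decide)]
    have g42 : m' 42 = m 42 := by
      rw [hfr 42 (by simp [forLoop, writes]), Memory.write_of_ne _ _ _ (by decide)]
    have hval : (var vMASK + get aWEIGHT (var 43) *
        (get aLIST (var 41) / get aWEIGHT (var 43) % 2) *
        (1 - get 1 (var 42 * var 0 + var 43))).eval m' =
        mask ((F q \ I.row f).filter (· < e + 1)) := by
      rw [mask_filter_succ, mask_div_mod]
      have hb := mask_div_mod (F q) e
      have hrow : e ∈ I.row f ↔ I.input 1 (f * I.n + e) ≠ 0 := by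
        simp [SetCoverInstance.row, he]
      simp only [RExpr.eval_add, RExpr.eval_mul, RExpr.eval_get, RExpr.eval_lit, RExpr.eval_mod,
        RExpr.eval_div, RExpr.eval_sub, RExpr.eval_ofNat, h43, g0, g1, g10, g15, g41, g42, hm0, h41,
        h42, hw, hlist, hin1, bitWeight, if_pos he, hb, hacc, Finset.mem_sdiff, hrow]
      by_cases h1 : e ∈ F q <;> by_cases h2 : I.input 1 (f * I.n + e) = 0
      · simp [h1, h2]
      · simp [h1, h2]; omega
      · simp [h1]
      · simp [h1]
    refine wp_store le_rfl ?_ ⟨ht, ?_⟩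
    · rw [hval]
      refine lt_of_lt_of_le (mask_lt (fun x hx => ?_)) hL.le
      exact hFq.1 (Finset.mem_sdiff.1 (Finset.mem_filter.1 hx).1).1
    · rw [hval]; simp
  · rintro m' t' ⟨ht, hacc⟩ hfr
    have hfull : (F q \ I.row f).filter (· < I.n) = F q \ I.row f := by
      refine Finset.filter_true_of_mem fun x hx => ?_
      simpa using hFq.1 (Finset.mem_sdiff.1 hx).1
    rw [hfull] at hacc
    have g15 : m' 15 = m 15 := by
      rw [hfr 15 (by simp [forLoop, writes]), Memory.write_of_ne _ _ _ (by decide)]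
    have g18 : m' 18 = m 18 := by
      rw [hfr 18 (by simp [forLoop, writes]), Memory.write_of_ne _ _ _ (by decide)]
    have g41 : m' 41 = m 41 := by
      rw [hfr 41 (by simp [forLoop, writes]), Memory.write_of_ne _ _ _ (by decide)]
    refine WP.of_small fun hsmall => wp_store (by omega) ?_ ⟨ht, ?_⟩
    · exact lt_of_le_of_lt (Nat.sub_le _ _) (hsmall _ _)
    · simp only [RExpr.eval_get, RExpr.eval_lit, RExpr.eval_sub, RExpr.eval_add, RExpr.eval_ofNat,
        g15, g18, g41, h41, hlist, hacc, SetCoverInstance.relax]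
      funext x
      rw [Memory.write_index, Function.update_apply, g18]

/-- As in the Bellman–Ford algorithm, after `j` rounds the entries are correct for covering numbers
at most `j`. Updating in place is harmless, since entries never increase and finite ones always
remain upper bounds. -/
theorem wp_coverTable {I : SetCoverInstance} {K cnt : ℕ} {F : ℕ → Finset ℕ}
    (hin0 : m 0 = I.input 0) (hin1 : m 1 = I.input 1) (hw : m aWEIGHT = bitWeight I.n)
    (hF : Listing m (IsSmallSubset I.n K) cnt F) (hL : 2 ^ I.n < 2 ^ L)
    (hINF : I.fam.length + I.t + 1 < 2 ^ L)
    (hX : (I.n + 1) * (I.fam.length + 1) * (smallSubsetCount I.n K + 1) * (I.fam.length + 1) ≤ X) :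
    WP ω L X coverTable m t fun m' t' => t' = t ∧ I.IsCoverTable K (m' aCOVER) := by
  have hm1 : m 0 1 = I.t := by rw [hin0]; rfl
  have hm2 : m 0 2 = I.fam.length := by rw [hin0]; rfl
  have hm17 : m 17 0 = cnt := hF.1
  have hc := hF.count_le_smallSubsetCount
  have hcL : cnt < 2 ^ L := lt_of_le_of_lt (hc.trans (smallSubsetCount_le _ _)) hL
  have hX2 : (I.n + 1) * (I.fam.length + 1) * (cnt + 1) * (I.fam.length + 1) ≤ X :=
    le_trans (by gcongr) hX
  have hX1 : cnt + 1 ≤ X := by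
    refine le_trans ?_ hX2
    calc cnt + 1 = 1 * 1 * (cnt + 1) * 1 := by ring
      _ ≤ _ := by gcongr <;> omega
  refine wp_seq (wp_forLoop (X := 1) cnt (fun q m' t' => t' = t ∧
    ∀ i < q, m' aCOVER (mask (F i)) = I.fam.length + I.t + 1) (by simp [writes]) le_rfl ?_ hcL ?_ ?_
    ?_ (by omega) ?_)
  · intro m' h
    simp [h 17 (by simp [forLoop, writes]), hm17]
  · intro q m' t' v h
    simpa using h
  · exact ⟨rfl, by simp⟩
  · rintro q m' t' hq h41 hfr ⟨ht, h⟩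
    have g0 : m' 0 = m 0 := hfr 0 (by simp [forLoop, writes])
    have g15 : m' 15 = m 15 := hfr 15 (by simp [forLoop, writes])
    refine wp_store le_rfl ?_ ⟨ht, fun i hi => ?_⟩
    · simpa [g0, hm1, hm2] using hINF
    · simp only [RExpr.eval_get, RExpr.eval_lit, RExpr.eval_add, RExpr.eval_ofNat, g0, g15, h41,
        (hF.2.1 q hq).1, hm1, hm2, Memory.write_index]
      split_ifs with hiq
      · rfl
      · refine h i ?_
        have : i ≠ q := fun h => hiq (h ▸ rfl)
        omega
  rintro m1 t1 ⟨ht1, hINF1⟩ hfr1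
  refine wp_seq (wp_store (by omega) (by simp) ?_)
  set m2 := m1.write 18 ((0 : RExpr).eval m1) ((0 : RExpr).eval m1) with hm2def
  have g2 : ∀ a, a ≠ 18 → a ≠ 41 → m2 a = m a := by
    intro a h1 h2
    rw [hm2def, Memory.write_of_ne _ _ _ h1, hfr1 a (by simp [forLoop, writes, h1, h2])]
  -- Only the empty set has mask `0`, so the single store at index `0` corrects exactly its entry.
  have hcov2 : ∀ S, IsSmallSubset I.n K S → m2 18 (mask S) =
      if S = ∅ then 0 else I.fam.length + I.t + 1 := by
    intro S hS
    obtain ⟨i, hi, rfl⟩ := (hF.2.2.2 S).1 hS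
    simp only [hm2def, RExpr.eval_ofNat, Memory.write_index]
    have h0 : mask (F i) = 0 ↔ F i = ∅ :=
      ⟨fun h => mask_injective (by simpa [mask] using h), fun h => by simp [h, mask]⟩
    simp only [h0, hINF1 i hi]
  refine wp_forLoop (X := (I.n + 1) * (I.fam.length + 1) * (cnt + 1)) I.fam.length
    (fun j m' t' => t' = t ∧ I.CoverSound K (m' aCOVER) ∧ I.CoverComplete K j (m' aCOVER))
    (by simp [forLoop, writes, relaxProg]) (Nat.mul_pos (Nat.mul_pos (by omega) (by omega))
      (by omega)) ?_ (by omega) ?_ ?_ ?_ hX2 ?_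
  · intro m' h
    simp [h 0 (by simp [forLoop, writes, relaxProg]), g2 0 (by simp) (by simp), hm2]
  · intro j m' t' v h
    simpa using h
  · refine ⟨ht1, fun S hS hle => ?_, fun S hS i hi hc => ?_⟩
    · rw [hcov2 S hS] at hle ⊢
      split_ifs at hle ⊢ with h
      · exact h
      · omega
    · obtain rfl : i = 0 := by omega
      rw [hcov2 S hS, if_pos (show S = ∅ from hc)]
  · rintro j m' t' hj h40 hfr ⟨ht, hs, hcm⟩
    refine wp_forLoop (X := (I.n + 1) * (I.fam.length + 1)) cnt
      (fun q m' t' => t' = t ∧ I.CoverSound K (m' aCOVER) ∧ I.CoverComplete K j (m' aCOVER) ∧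
        ∀ i < q, Covered I.row I.fam.length (j + 1) (F i) → m' aCOVER (mask (F i)) ≤ j + 1)
      (by simp [forLoop, writes, relaxProg]) (Nat.mul_pos (by omega) (by omega)) ?_ hcL ?_ ?_ ?_
      le_rfl ?_
    · intro m'' h
      simp [h 17 (by simp [forLoop, writes, relaxProg]),
        hfr 17 (by simp [forLoop, writes, relaxProg]), g2 17 (by simp) (by simp), hm17]
    · intro q m'' t'' v h
      simpa using h
    · exact ⟨ht, hs, hcm, by simp⟩
    · rintro q m3 t3 hq h41 hfr3 ⟨ht, hs, hcm, hdone⟩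
      refine wp_forLoop (X := I.n + 1) I.fam.length
        (fun f m' t' => t' = t ∧ I.CoverSound K (m' aCOVER) ∧ I.CoverComplete K j (m' aCOVER) ∧
          (∀ i < q, Covered I.row I.fam.length (j + 1) (F i) → m' aCOVER (mask (F i)) ≤ j + 1) ∧
          ∀ f' < f, Covered I.row I.fam.length j (F q \ I.row f') →
            m' aCOVER (mask (F q)) ≤ j + 1)
        (by simp [forLoop, writes, relaxProg]) (by omega) ?_ (by omega) ?_ ?_ ?_ le_rfl ?_
      · intro m'' h
        simp [h 0 (by simp [forLoop, writes, relaxProg]),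
          hfr3 0 (by simp [forLoop, writes, relaxProg]),
          hfr 0 (by simp [forLoop, writes, relaxProg]), g2 0 (by simp) (by simp), hm2]
      · intro f m'' t'' v h
        simpa using h
      · exact ⟨ht, hs, hcm, hdone, by simp⟩
      · rintro f m4 t4 hf h42 hfr4 ⟨ht, hs, hcm, hdone, hrows⟩
        have g4 : ∀ a, a ∉ (forLoop 40 (get 0 2) (forLoop 41 (var vCOUNT)
            (forLoop 42 (get 0 2) relaxProg))).writes → m4 a = m a := by
          intro a ha
          simp only [forLoop, writes, relaxProg, List.cons_append,
            List.nil_append, List.mem_cons, List.not_mem_nil, or_false, not_or] at ha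
          rw [hfr4 a (by simp [forLoop, writes, relaxProg]; tauto),
            hfr3 a (by simp [forLoop, writes, relaxProg]; tauto),
            hfr a (by simp [forLoop, writes, relaxProg]; tauto), g2 a (by tauto) (by tauto)]
        have h41' : m4 41 0 = q := by
          rw [hfr4 41 (by simp [forLoop, writes, relaxProg]), h41]
        refine (wp_relaxProg (I := I) (K := K) (cnt := cnt) (q := q) (f := f) (F := F) ?_ ?_ ?_ ?_
          hq h41' h42 hL).mono ?_
        · rw [g4 0 (by simp [forLoop, writes, relaxProg]), hin0]
        · rw [g4 1 (by simp [forLoop, writes, relaxProg]), hin1]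
        · rw [g4 10 (by simp [forLoop, writes, relaxProg]), hw]
        · exact hF.congr (g4 17 (by simp [forLoop, writes, relaxProg]))
            (g4 15 (by simp [forLoop, writes, relaxProg]))
            (g4 16 (by simp [forLoop, writes, relaxProg]))
        · rintro m5 t5 ⟨ht5, h5⟩
          have hFq : IsSmallSubset I.n K (F q) := (hF.2.2.2 _).2 ⟨q, hq, rfl⟩
          have hle : ∀ x, m5 18 x ≤ m4 18 x := fun x => by
            rw [h5]; exact SetCoverInstance.relax_le _ _ _ _
          refine ⟨ht5.trans ht, by rw [h5]; exact hs.relax hFq hf, hcm.of_le hle,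
            fun i hi hc => (hle _).trans (hdone i hi hc), fun f' hf' hc => ?_⟩
          rcases Nat.lt_succ_iff_lt_or_eq.1 hf' with hf' | rfl
          · exact (hle _).trans (hrows f' hf' hc)
          · rw [h5]
            have h6 := SetCoverInstance.relax_self_le (I := I) (F q) f' (m4 18)
            -- What row `f'` leaves uncovered needs `j` sets, and its entry was already correct
            -- after the previous rounds.
            have h7 := hcm (F q \ I.row f') ⟨Finset.sdiff_subset.trans hFq.1,
              (Finset.card_le_card Finset.sdiff_subset).trans hFq.2⟩ j le_rfl hc
            omega
      · rintro m5 t5 ⟨ht, hs, hcm, hdone, hrows⟩ -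
        have hFq : IsSmallSubset I.n K (F q) := (hF.2.2.2 _).2 ⟨q, hq, rfl⟩
        refine ⟨ht, hs, hcm, fun i hi hc => ?_⟩
        rcases Nat.lt_succ_iff_lt_or_eq.1 hi with hi | rfl
        · exact hdone i hi hc
        · rcases hc with hc | ⟨f, hf, hc⟩
          · exact (hcm _ hFq j le_rfl hc).trans (by omega)
          · exact hrows f hf hc
    · rintro m3 t3 ⟨ht, hs, hcm, hdone⟩ -
      refine ⟨ht, hs, fun S hS i' hi' hc => ?_⟩
      rcases Nat.le_succ_iff.1 hi' with hi' | rfl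
      · exact hcm S hS i' hi' hc
      · obtain ⟨i, hi, rfl⟩ := (hF.2.2.2 S).1 hS
        exact hdone i hi hc
  · rintro m' t' ⟨ht, hs, hcm⟩ -
    exact ⟨ht, fun S hS hcard => ⟨hs S ⟨hS, hcard⟩, hcm S ⟨hS, hcard⟩⟩⟩

end RProg

/-! ### The parts of a trial -/

local notation "aADD" => (2 : ℕ)
local notation "aMUL" => (3 : ℕ)
local notation "aSUB" => (4 : ℕ)
local notation "vCODES" => (11 : ℕ)
local notation "aPERM" => (23 : ℕ)
local notation "vRANDOM" => (24 : ℕ)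
local notation "vCOIN" => (25 : ℕ)
local notation "vINDEX" => (27 : ℕ)
local notation "aOUT" => (28 : ℕ)
local notation "vQUOT" => (29 : ℕ)
local notation "vLEN" => (30 : ℕ)
local notation "vACC" => (31 : ℕ)
local notation "vCODE" => (33 : ℕ)
local notation "aTHR" => (34 : ℕ)

namespace RProg

variable {ω : ℕ → Bool} {L X : ℕ} {m : Memory} {t : ℕ}

/-- Store a random number of `2 * size + 1` bits. -/
def randomNumber : RProg :=
  set vRANDOM 0 ;; forLoop 41 (var vSIZE * 2 + 1)
    (.toss vCOIN 0 ;; set vRANDOM (2 * var vRANDOM + var vCOIN))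

theorem wp_randomNumber {n : ℕ} (hn : m vSIZE 0 = n) (hL : bitCount n ≤ L)
    (hX : bitCount n + 1 ≤ X) :
    WP ω L X randomNumber m t fun m' t' => t' = t + bitCount n ∧
      m' vRANDOM 0 = bitsVal (later t ω) (bitCount n) := by
  have hL1 : 1 ≤ L := le_trans (by unfold bitCount; omega) hL
  refine wp_seq (wp_store (by omega) (by simp) ?_)
  refine wp_forLoop (X := 1) (bitCount n)
    (fun b m' t' => t' = t + b ∧ m' vRANDOM 0 = bitsVal (later t ω) b)
    (by simp [writes]) le_rfl ?_ (hL.trans_lt Nat.lt_two_pow_self) ?_ ?_ ?_ (by omega)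
    (fun _ _ h _ => h)
  · intro m' h
    simp [h 9 (by simp [forLoop, writes]), hn, bitCount, mul_comm]
  · intro b m' t' v h
    simpa using h
  · exact ⟨rfl, by simp [bitsVal]⟩
  · rintro b m' t' hb - - ⟨rfl, h⟩
    have hval : 2 * bitsVal (later t ω) b + (ω (t + b)).toNat = bitsVal (later t ω) (b + 1) := rfl
    refine wp_seq (wp_toss le_rfl hL1 (wp_store le_rfl ?_ ⟨by ring, ?_⟩))
    · simp only [RExpr.eval_add, RExpr.eval_mul, RExpr.eval_get, RExpr.eval_lit, RExpr.eval_ofNat,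
        Memory.write_same, Memory.write_of_ne, ne_eq, Nat.reduceEqDiff, not_false_eq_true, h, hval]
      exact (bitsVal_lt _ _).trans_le (Nat.pow_le_pow_right (by norm_num) (by omega))
    · simp [h, hval]

/-- Swap two entries of the permutation. -/
def swapEntries : RProg :=
  set vTMP (get aPERM (var 40)) ;; .store aPERM (var 40) (get aPERM (var vINDEX)) ;;
    .store aPERM (var vINDEX) (var vTMP)

/-- Compute a random permutation. -/
def randomPerm : RProg :=
  forLoop 40 (var vSIZE) (.store aPERM (var 40) (var 40)) ;;
  forLoop 40 (var vSIZE) (randomNumber ;;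
    set vINDEX (var 40 + var vRANDOM % (var vSIZE - var 40)) ;; swapEntries)

theorem wp_swapEntries {σ : Equiv.Perm ℕ} {n i j : ℕ} (hσ : ∀ x < n, m aPERM x = σ x) (hi : i < n)
    (hj : j < n) (h40 : m 40 0 = i) (hidx : m vINDEX 0 = j) (hX : 1 ≤ X) :
    WP ω L X swapEntries m t fun m' t' => t' = t ∧
      ∀ x < n, m' aPERM x = (σ * Equiv.swap i j) x := by
  refine WP.of_small fun hsm => wp_seq (wp_store hX (hsm _ _) (wp_seq (wp_store hX ?_
    (wp_store hX ?_ ⟨rfl, fun x hx => ?_⟩))))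
  · simpa using hsm _ _
  · simpa using hsm _ _
  · simp only [RExpr.eval_get, RExpr.eval_lit, RExpr.eval_ofNat, Memory.write_of_ne, ne_eq,
      Nat.reduceEqDiff, not_false_eq_true, Memory.write_index, h40, hidx, if_true,
      Equiv.Perm.mul_apply, Equiv.swap_apply_def]
    split_ifs with h1 h2 h2
    · rw [hσ i hi, ← h2, h1]
    · rw [hσ i hi]
    · rw [hσ j hj]
    · rw [hσ x hx]

theorem wp_randomPerm {n : ℕ} (hn : m vSIZE 0 = n) (hL : bitCount n ≤ L)
    (hX : (bitCount n + 1) * (n + 1) ≤ X) :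
    WP ω L X randomPerm m t fun m' t' => t' = t + n * bitCount n ∧
      ∀ x < n, m' aPERM x = shuffle (shuffleIndex (bitCount n) n (later t ω)) n x := by
  have hnL : n < 2 ^ L := lt_of_le_of_lt (by unfold bitCount at hL; omega) Nat.lt_two_pow_self
  have hX1 : 1 * (n + 1) ≤ X := le_trans (Nat.mul_le_mul_right _ (by omega)) hX
  refine wp_seq_frame (wp_forLoop (X := 1) n (fun i m' t' => t' = t ∧ ∀ x < i, m' aPERM x = x)
    (by simp [writes]) le_rfl ?_ hnL ?_ ?_ ?_ hX1 (fun _ _ h _ => h)) ?_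
  · intro m' h
    simp [h 9 (by simp [forLoop, writes]), hn]
  · intro b m' t' v h
    simpa using h
  · exact ⟨rfl, by simp⟩
  · rintro i m' t' hi h40 - ⟨rfl, h⟩
    refine wp_store le_rfl (by simp [h40]; omega) ⟨rfl, fun x hx => ?_⟩
    simp only [RExpr.eval_get, RExpr.eval_lit, h40, Memory.write_index]
    split_ifs with hxi
    · exact hxi.symm
    · exact h x (by omega)
  rintro m1 t1 hfr1 ⟨rfl, h1⟩
  have hn1 : m1 9 0 = n := by rw [hfr1 9 (by simp [forLoop, writes]), hn]
  refine wp_forLoop (X := bitCount n + 1) n (fun i m' t' => t' = t1 + i * bitCount n ∧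
    ∀ x < n, m' aPERM x = shuffle (shuffleIndex (bitCount n) n (later t1 ω)) i x)
    (by simp [writes, randomNumber, forLoop, swapEntries]) (by omega) ?_ hnL ?_ ?_ ?_ hX
    (fun _ _ h _ => h)
  · intro m' h
    simp [h 9 (by simp [forLoop, writes, randomNumber, swapEntries]), hn1]
  · intro b m' t' v h
    simpa using h
  · exact ⟨by simp, by simpa [shuffle] using h1⟩
  · rintro i m' t' hi h40 hfr ⟨rfl, h⟩
    have hn' : m' 9 0 = n := by
      rw [hfr 9 (by simp [forLoop, writes, randomNumber, swapEntries]), hn1]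
    refine wp_seq_frame (wp_randomNumber hn' hL le_rfl) ?_
    rintro m2 t2 hfr2 ⟨rfl, h2⟩
    have hn2 : m2 9 0 = n := by rw [hfr2 9 (by simp [forLoop, writes, randomNumber]), hn']
    have h402 : m2 40 0 = i := by rw [hfr2 40 (by simp [forLoop, writes, randomNumber]), h40]
    have h232 : m2 23 = m' 23 := hfr2 23 (by simp [forLoop, writes, randomNumber])
    have hidx : i + bitsVal (later (t1 + i * bitCount n) ω) (bitCount n) % (n - i) =
        shuffleIndex (bitCount n) n (later t1 ω) i := by
      unfold shuffleIndex; rw [later_later]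
    have hlt := shuffleIndex_lt (L := bitCount n) (later t1 ω) hi
    refine wp_seq (wp_store (by omega) ?_ ?_)
    · simp only [RExpr.eval_add, RExpr.eval_mod, RExpr.eval_get, RExpr.eval_lit, RExpr.eval_sub,
        h402, h2, hn2, hidx]
      omega
    · refine (wp_swapEntries (σ := shuffle (shuffleIndex (bitCount n) n (later t1 ω)) i) ?_ hi hlt
        ?_ ?_ (by omega)).mono ?_
      · intro x hx
        simpa [h232] using h x hx
      · simpa using h402
      · simp [h402, h2, hn2, hidx]
      · rintro m3 t3 ⟨rfl, h3⟩
        exact ⟨by ring, h3⟩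

/-- Compute the mask of the set whose code is the value of variable `40`. -/
def codeMask (N k : ℕ) : RProg :=
  set vMASK 0 ;; set vCODE (var 40) ;;
  forLoop 41 (var vBLOCKS) (
    forLoop 42 (lit (3 * k)) (set vMASK (var vMASK +
      get aSUB (var vCODE % lit N * lit (3 * k) + var 42) *
        get aWEIGHT (get aPERM (var 41 * lit (3 * k) + var 42)))) ;;
    set vCODE (var vCODE / lit N))

/-- Fill the `h`-th vector with random entries. -/
def fillVector (h N k : ℕ) : RProg :=
  forLoop 40 (var vCODES) (codeMask N k ;; .toss vCOIN 0 ;;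
    -- The factor is `1` if the covering number is below the threshold and `0` otherwise. The coin
    -- is tossed in either case, so the toss number of an entry does not depend on the data.
    .store (20 + h) (var 40) (var vCOIN * (1 - (get aCOVER (var vMASK) + 1 - get aTHR (lit h)))))

end RProg

namespace Scheme

open RProg

variable {K : Type*} [Field K] {sch : Scheme K}
variable {ω : ℕ → Bool} {L X : ℕ} {m : Memory} {t : ℕ}

/-- The tables and constants that a trial uses are in place. -/
structure Ready (sch : Scheme K) (n M : ℕ) (m : Memory) : Prop where
  add : ∀ x y, m aADD (sch.enc x * sch.q + sch.enc y) = sch.enc (x + y)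
  mul : ∀ x y, m aMUL (sch.enc x * sch.q + sch.enc y) = sch.enc (x * y)
  sub : ∀ l < sch.N, ∀ e < 3 * sch.k, m aSUB (l * (3 * sch.k) + e) = if e ∈ sch.sub l then 1 else 0
  co : ∀ h < 3, ∀ i < sch.r, ∀ l < sch.N, m (5 + h) (i * sch.N + l) = sch.enc (sch.co h i l)
  blocks : m vBLOCKS 0 = M
  size : m vSIZE 0 = M * (3 * sch.k)
  weight : m aWEIGHT = bitWeight n
  codes : m vCODES 0 = sch.N ^ M

theorem Ready.congr {n M : ℕ} {m' : Memory} (h : sch.Ready n M m)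
    (hm : ∀ a, 2 ≤ a → a ≤ 11 → m' a = m a) : sch.Ready n M m' where
  add := by rw [hm 2 (by omega) (by omega)]; exact h.add
  mul := by rw [hm 3 (by omega) (by omega)]; exact h.mul
  sub := by rw [hm 4 (by omega) (by omega)]; exact h.sub
  co := fun i hi => by rw [hm (5 + i) (by omega) (by omega)]; exact h.co i hi
  blocks := by rw [hm 8 (by omega) (by omega)]; exact h.blocks
  size := by rw [hm 9 (by omega) (by omega)]; exact h.size
  weight := by rw [hm 10 (by omega) (by omega)]; exact h.weight
  codes := by rw [hm 11 (by omega) (by omega)]; exact h.codes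

theorem wp_codeMask {n M w : ℕ} {σ : Equiv.Perm ℕ} (hr : sch.Ready n M m)
    (hσ : ∀ x < M * (3 * sch.k), m aPERM x = σ x) (h40 : m 40 0 = w) (hw : w < 2 ^ L)
    (hn : 2 ^ n < 2 ^ L) (hM : M < 2 ^ L) (hk : 3 * sch.k < 2 ^ L)
    (hX : (3 * sch.k + 1) * (M + 1) ≤ X) :
    WP ω L X (codeMask sch.N sch.k) m t fun m' t' => t' = t ∧
      m' vMASK 0 = mask (sch.elems n M σ w) := by
  have hX1 : 1 ≤ X := le_trans (Nat.mul_pos (by omega) (by omega)) hX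
  let term : ℕ → ℕ → ℕ := fun b e =>
    (if e ∈ sch.sub (dig sch.N w b) then 1 else 0) * bitWeight n (σ (b * (3 * sch.k) + e))
  have hinner : ∀ b, ∑ e ∈ Finset.range (3 * sch.k), term b e =
      ∑ e ∈ sch.sub (dig sch.N w b), bitWeight n (σ (b * (3 * sch.k) + e)) := by
    intro b
    simp only [term, ite_mul, one_mul, zero_mul]
    rw [← Finset.sum_filter, Finset.filter_mem_eq_inter,
      Finset.inter_eq_right.2 (sch.sub_subset _ (dig_lt sch.N_pos _ _))]
  have htotal : ∑ b ∈ Finset.range M, ∑ e ∈ Finset.range (3 * sch.k), term b e =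
      mask (sch.elems n M σ w) := by
    simp only [hinner]
    exact sch.sum_bitWeight n M σ.injective w
  -- Partial sums are at most the complete mask, which is below `2 ^ n`; hence no overflow.
  have hlt : ∀ b < M, ∀ e < 3 * sch.k, ∑ b ∈ Finset.range b, ∑ e ∈ Finset.range (3 * sch.k),
      term b e + ∑ e ∈ Finset.range (e + 1), term b e < 2 ^ L := by
    intro b hb e he
    refine lt_of_le_of_lt ?_ ((mask_lt (sch.elems_subset n M σ w)).trans hn)
    rw [← htotal]
    calc _ ≤ ∑ b ∈ Finset.range b, ∑ e ∈ Finset.range (3 * sch.k), term b e +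
          ∑ e ∈ Finset.range (3 * sch.k), term b e := by
          gcongr; omega
      _ = ∑ b ∈ Finset.range (b + 1), ∑ e ∈ Finset.range (3 * sch.k), term b e :=
          (Finset.sum_range_succ _ _).symm
      _ ≤ _ := Finset.sum_le_sum_of_subset (Finset.range_mono hb)
  refine wp_seq (wp_store hX1 (by simp) (wp_seq (wp_store hX1 (by simpa [h40] using hw) ?_)))
  refine wp_forLoop (X := 3 * sch.k + 1) M (fun b m' t' => t' = t ∧ m' vCODE 0 = w / sch.N ^ b ∧
    m' vMASK 0 = ∑ b ∈ Finset.range b, ∑ e ∈ Finset.range (3 * sch.k), term b e)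
    (by simp [forLoop, writes]) (by omega) ?_ hM ?_ ?_ ?_ hX
    (fun _ _ h _ => ⟨h.1, by rw [h.2.2, htotal]⟩)
  · intro m' h
    simp [h 8 (by simp [forLoop, writes]), hr.blocks]
  · intro b m' t' v h
    simpa using h
  · simp [h40]
  · rintro b m1 t1 hb h41 hfr1 ⟨ht1, hcode, hmask⟩
    refine wp_seq_frame (wp_forLoop (X := 1) (3 * sch.k) (fun e m' t' => t' = t ∧
      m' vMASK 0 = ∑ b ∈ Finset.range b, ∑ e ∈ Finset.range (3 * sch.k), term b e +
        ∑ e ∈ Finset.range e, term b e) (by simp [writes]) le_rfl (by simp) hk ?_ ?_ ?_ (by omega)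
        (fun _ _ h _ => h)) ?_
    · intro e m' t' v h
      simpa using h
    · simpa using ⟨ht1, hmask⟩
    · rintro e m2 t2 he h42 hfr2 ⟨ht2, hmask2⟩
      have g : ∀ a, a ≠ 19 → a ≠ 42 → a ≠ 41 → a ≠ 33 → m2 a = m a := by
        intro a h1 h2 h3 h4
        rw [hfr2 a (by simp [forLoop, writes, h1, h2]),
          hfr1 a (by simp [forLoop, writes, h1, h2, h3, h4]), Memory.write_of_ne _ _ _ h4,
          Memory.write_of_ne _ _ _ h1]
      have g33 : m2 33 0 = w / sch.N ^ b := by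
        rw [hfr2 33 (by simp [forLoop, writes]), hcode]
      have g41 : m2 41 0 = b := by
        rw [hfr2 41 (by simp [forLoop, writes]), h41]
      have hpos : b * (3 * sch.k) + e < M * (3 * sch.k) := by
        calc b * (3 * sch.k) + e < (b + 1) * (3 * sch.k) := by rw [add_mul]; omega
          _ ≤ M * (3 * sch.k) := Nat.mul_le_mul_right _ hb
      have hval : (var vMASK + get aSUB (var vCODE % lit sch.N * lit (3 * sch.k) + var 42) *
          get aWEIGHT (get aPERM (var 41 * lit (3 * sch.k) + var 42))).eval m2 =
          ∑ b ∈ Finset.range b, ∑ e ∈ Finset.range (3 * sch.k), term b e +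
            ∑ e ∈ Finset.range (e + 1), term b e := by
        simp only [RExpr.eval_add, RExpr.eval_mul, RExpr.eval_get, RExpr.eval_lit, RExpr.eval_mod,
          hmask2, g33, g41, h42, g 4 (by simp) (by simp) (by simp) (by simp),
          g 10 (by simp) (by simp) (by simp) (by simp),
          g 23 (by simp) (by simp) (by simp) (by simp), hσ _ hpos, hr.weight]
        rw [show w / sch.N ^ b % sch.N = dig sch.N w b from rfl,
          hr.sub _ (dig_lt sch.N_pos _ _) e he, Finset.sum_range_succ, add_assoc]
      exact wp_store le_rfl (by rw [hval]; exact hlt b hb e he) ⟨ht2, by rw [hval]; simp⟩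
    · rintro m2 t2 hfr2 ⟨ht2, hmask2⟩
      have g33 : m2 33 0 = w / sch.N ^ b := by
        rw [hfr2 33 (by simp [forLoop, writes]), hcode]
      refine wp_store (by omega) ?_ ⟨ht2, ?_, ?_⟩
      · simp only [RExpr.eval_div, RExpr.eval_get, RExpr.eval_lit, g33]
        exact lt_of_le_of_lt (Nat.div_le_self _ _) (lt_of_le_of_lt (Nat.div_le_self _ _) hw)
      · simp [g33, Nat.div_div_eq_div_mul, pow_succ]
      · simp [hmask2, Finset.sum_range_succ]

theorem wp_fillVector {n M h : ℕ} {σ : Equiv.Perm ℕ} {mc thr : ℕ → ℕ} (hh : h < 3)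
    (hr : sch.Ready n M m) (hσ : ∀ x < M * (3 * sch.k), m aPERM x = σ x)
    (hmc : m aCOVER = mc) (hthr : m aTHR h = thr h) (hL : 1 ≤ L) (hN : sch.N ^ M < 2 ^ L)
    (hn : 2 ^ n < 2 ^ L) (hM : M < 2 ^ L) (hk : 3 * sch.k < 2 ^ L)
    (hX : (3 * sch.k + 1) * (M + 1) * (sch.N ^ M + 1) ≤ X) :
    WP ω L X (fillVector h sch.N sch.k) m t fun m' t' => t' = t + sch.N ^ M ∧
      ∀ w < sch.N ^ M, m' (20 + h) w = sch.enc (if mc (mask (sch.elems n M σ w)) < thr h then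
        coinVal K (ω (t + w)) else 0) := by
  have hX' : 1 ≤ (3 * sch.k + 1) * (M + 1) := Nat.mul_pos (by omega) (by omega)
  have n1 : ∀ a, a ≠ 20 → a ≠ 21 → a ≠ 22 → a ≠ 20 + h := by omega
  have hfrm : ∀ a, a ≠ 20 → a ≠ 21 → a ≠ 22 → a ≠ 19 → a ≠ 33 → a ≠ 25 → a ≠ 40 → a ≠ 41 → a ≠ 42 →
      a ∉ (fillVector h sch.N sch.k).writes := by
    intro a h1 h2 h3
    simp only [fillVector, codeMask, forLoop, writes, List.cons_append, List.nil_append,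
      List.mem_cons, List.not_mem_nil, or_false, not_or]
    have := n1 a h1 h2 h3
    tauto
  refine wp_forLoop (X := (3 * sch.k + 1) * (M + 1)) (sch.N ^ M) (fun w m' t' => t' = t + w ∧
    ∀ w' < w, m' (20 + h) w' = sch.enc (if mc (mask (sch.elems n M σ w')) < thr h then
        coinVal K (ω (t + w')) else 0))
    ?_ hX' ?_ hN ?_ ?_ ?_ hX (fun _ _ h _ => h)
  · simp only [codeMask, forLoop, writes, List.cons_append, List.nil_append,
      List.mem_cons, List.not_mem_nil, or_false, not_or]
    have := n1 40
    simp; omega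
  · intro m' hfr
    rw [RExpr.eval_get, RExpr.eval_lit, hfr 11 (hfrm 11 (by simp) (by simp) (by simp) (by simp)
      (by simp) (by simp) (by simp) (by simp) (by simp)), hr.codes]
  · rintro w m' t' v ⟨h1, h2⟩
    refine ⟨h1, fun w' hw' => ?_⟩
    rw [Memory.write_of_ne _ _ _ (by omega), h2 w' hw']
  · exact ⟨rfl, by simp⟩
  · rintro w m1 t1 hw h40 hfr1 ⟨ht1, hvec⟩
    have g1 : ∀ a, a ≠ 20 → a ≠ 21 → a ≠ 22 → a ≠ 19 → a ≠ 33 → a ≠ 25 → a ≠ 40 → a ≠ 41 → a ≠ 42 →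
        m1 a = m a := fun a h1 h2 h3 h4 h5 h6 h7 h8 h9 => hfr1 a (hfrm a h1 h2 h3 h4 h5 h6 h7 h8 h9)
    refine wp_seq_frame (wp_codeMask (n := n) (M := M) (w := w) (σ := σ)
      (hr.congr fun a h2 h11 => g1 a (by omega) (by omega) (by omega) (by omega) (by omega)
        (by omega) (by omega) (by omega) (by omega)) ?_ h40 (hw.trans hN) hn hM hk le_rfl) ?_
    · intro x hx
      rw [g1 23 (by simp) (by simp) (by simp) (by simp) (by simp) (by simp) (by simp) (by simp)
        (by simp), hσ x hx]
    rintro m2 t2 hfr2 ⟨ht2, hmask⟩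
    have g2 : ∀ a, a ≠ 19 → a ≠ 33 → a ≠ 41 → a ≠ 42 → m2 a = m1 a := fun a h1 h2 h3 h4 =>
      hfr2 a (by simp [codeMask, forLoop, writes, h1, h2, h3, h4])
    have g18 : m2 18 = mc := by
      rw [g2 18 (by simp) (by simp) (by simp) (by simp), g1 18 (by simp) (by simp) (by simp)
        (by simp) (by simp) (by simp) (by simp) (by simp) (by simp), hmc]
    have g34 : m2 34 h = thr h := by
      rw [g2 34 (by simp) (by simp) (by simp) (by simp), g1 34 (by simp) (by simp) (by simp)
        (by simp) (by simp) (by simp) (by simp) (by simp) (by simp), hthr]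
    have g40 : m2 40 0 = w := by
      rw [g2 40 (by simp) (by simp) (by simp) (by simp), h40]
    have g20 : m2 (20 + h) = m1 (20 + h) :=
      g2 _ (by omega) (by omega) (by omega) (by omega)
    have hval : ∀ m3 : Memory, m3 = m2.write 25 0 (ω t2).toNat →
        (var vCOIN * (1 - (get aCOVER (var vMASK) + 1 - get aTHR (lit h)))).eval m3 =
        sch.enc (if mc (mask (sch.elems n M σ w)) < thr h then coinVal K (ω (t + w)) else 0) := by
      rintro m3 rfl
      simp only [RExpr.eval_mul, RExpr.eval_get, RExpr.eval_lit, RExpr.eval_sub, RExpr.eval_add,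
        RExpr.eval_ofNat, Memory.write_same, Memory.write_of_ne, ne_eq, Nat.reduceEqDiff,
        not_false_eq_true, g18, g34, hmask, ht2, ht1]
      split_ifs with hlt
      · rw [show 1 - (mc (mask (sch.elems n M σ w)) + 1 - thr h) = 1 by omega, mul_one]
        unfold coinVal
        cases ω (t + w) <;> simp [sch.enc_zero, sch.enc_one]
      · rw [show 1 - (mc (mask (sch.elems n M σ w)) + 1 - thr h) = 0 by omega, mul_zero,
          sch.enc_zero]
    refine wp_seq (wp_toss hX' hL (wp_store hX' ?_ ⟨by rw [ht2, ht1, add_assoc], ?_⟩))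
    · refine lt_of_le_of_lt (?_ : _ ≤ 1) (lt_of_lt_of_le (by norm_num) (Nat.pow_le_pow_right
        (by norm_num) hL : 2 ^ 1 ≤ 2 ^ L))
      simp only [RExpr.eval_mul, RExpr.eval_get, RExpr.eval_lit, RExpr.eval_sub, RExpr.eval_add,
        RExpr.eval_ofNat, Memory.write_same]
      calc _ ≤ 1 * 1 := Nat.mul_le_mul (Bool.toNat_le _) (Nat.sub_le _ _)
        _ = 1 := rfl
    · intro w' hw'
      rw [hval (m2.write 25 ((0 : RExpr).eval m2) (ω t2).toNat) rfl]
      simp only [RExpr.eval_get, RExpr.eval_lit, Memory.write_index, Memory.write_of_ne, ne_eq,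
        Nat.reduceEqDiff, not_false_eq_true, g40]
      by_cases hww : w' = w
      · subst hww
        rw [if_pos rfl]
      · rw [if_neg hww, Memory.write_of_ne _ _ _ (by omega), g20, hvec w' (by omega)]

end Scheme

/-! ### Yates's algorithm -/

namespace RProg

/-- Compute one entry of the partially transformed vector, with index the value of variable `41`. -/
def yatesEntry (h N q : ℕ) : RProg :=
  set vACC 0 ;;
  forLoop 42 (lit N) (set vACC (get aADD (var vACC * lit q +
    get aMUL (get (5 + h) (var 41 / var vQUOT * lit N + var 42) * lit q +
      get (20 + h) (var 42 + lit N * (var 41 % var vQUOT))))))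

/-- Apply a matrix to the next coordinate of the `h`-th vector. -/
def yatesStep (h r N q : ℕ) : RProg :=
  set vQUOT (var vLEN / lit N) ;;
  -- The result goes to a second array and is copied back afterwards, since the old vector is still
  -- being read.
  forLoop 41 (lit r * var vQUOT) (yatesEntry h N q ;; .store aOUT (var 41) (var vACC)) ;;
  set vLEN (lit r * var vQUOT) ;;
  forLoop 41 (var vLEN) (.store (20 + h) (var 41) (get aOUT (var 41)))

/-- Apply a tensor power of a matrix to the `h`-th vector. -/
def yates (h r N q : ℕ) : RProg :=
  set vLEN (var vCODES) ;; forLoop 40 (var vBLOCKS) (yatesStep h r N q)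

end RProg

namespace Scheme

open RProg

variable {K : Type*} [Field K] {sch : Scheme K}
variable {ω : ℕ → Bool} {L X : ℕ} {m : Memory} {t : ℕ}

/-- The entries of the vector after `b` steps of Yates's algorithm. -/
def yatesValue (sch : Scheme K) (M : ℕ) (x : ℕ → K) (h b idx : ℕ) : K :=
  sch.partialTransform x h b (idx / sch.N ^ (M - b)) (idx % sch.N ^ (M - b))

/-- An index consists of the converted digits on top and the unconverted ones below. A step takes
the digit `l` from the bottom and puts the new digit `idx / Q` on top, so every step has the same
form. -/
theorem yatesValue_succ {M b : ℕ} (hb : b < M) (x : ℕ → K) (h : ℕ) {idx Q : ℕ}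
    (hQ : Q = sch.r ^ b * sch.N ^ (M - (b + 1))) (hidx : idx < sch.r * Q) :
    sch.yatesValue M x h (b + 1) idx = ∑ l ∈ Finset.range sch.N,
      sch.co h (idx / Q) l * sch.yatesValue M x h b (l + sch.N * (idx % Q)) := by
  have hN := sch.N_pos
  have hr := sch.r_pos
  set P := sch.N ^ (M - (b + 1)) with hP
  have hPpos : 0 < P := by positivity
  have hQpos : 0 < Q := by rw [hQ]; positivity
  have hPN : sch.N ^ (M - b) = sch.N * P := by
    rw [hP, ← pow_succ']; congr 1; omega
  have hi : idx / Q < sch.r := Nat.div_lt_of_lt_mul (by rwa [mul_comm])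
  have hw : idx % Q / P < sch.r ^ b :=
    Nat.div_lt_of_lt_mul (by rw [mul_comm, ← hQ]; exact Nat.mod_lt _ hQpos)
  have e1 : idx / P = idx % Q / P + sch.r ^ b * (idx / Q) := by
    have h1 : idx = idx % Q + P * (sch.r ^ b * (idx / Q)) := by
      conv_lhs => rw [← Nat.mod_add_div idx Q]
      conv_lhs => enter [2, 1]; rw [hQ]
      ring
    conv_lhs => rw [h1]
    rw [Nat.add_mul_div_left _ _ hPpos]
  have e2 : idx % P = idx % Q % P := by
    rw [hQ, Nat.mod_mul_left_mod]
  unfold yatesValue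
  rw [← hP, e1, sch.partialTransform_succ _ _ _ _ hw hi]
  refine Finset.sum_congr rfl fun l hl => ?_
  have hl := Finset.mem_range.1 hl
  have hdiv : (l + sch.N * (idx % Q)) / sch.N = idx % Q := by
    rw [Nat.add_mul_div_left _ _ hN, Nat.div_eq_of_lt hl, zero_add]
  rw [hPN, e2, ← Nat.div_div_eq_div_mul, Nat.mod_mul, hdiv, Nat.add_mul_mod_self_left,
    Nat.mod_eq_of_lt hl]

theorem wp_yatesEntry {n M h b idx Q : ℕ} {x : ℕ → K} (hh : h < 3) (hr : sch.Ready n M m)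
    (hb : b < M) (hQ : Q = sch.r ^ b * sch.N ^ (M - (b + 1))) (hidx : idx < sch.r * Q)
    (hV : ∀ i < sch.N * Q, m (20 + h) i = sch.enc (sch.yatesValue M x h b i))
    (h41 : m 41 0 = idx) (hquot : m vQUOT 0 = Q) (hN : sch.N < 2 ^ L) (hX : sch.N + 1 ≤ X) :
    WP ω L X (yatesEntry h sch.N sch.q) m t fun m' t' => t' = t ∧
      m' vACC 0 = sch.enc (sch.yatesValue M x h (b + 1) idx) := by
  have hQpos : 0 < Q := by
    have := sch.N_pos
    have := sch.r_pos
    rw [hQ]; positivity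
  have hi : idx / Q < sch.r := Nat.div_lt_of_lt_mul (by rwa [mul_comm])
  refine wp_seq (wp_store (by omega) (by simp) ?_)
  refine wp_forLoop (X := 1) sch.N (fun l m' t' => t' = t ∧ m' vACC 0 = sch.enc
    (∑ l ∈ Finset.range l, sch.co h (idx / Q) l * sch.yatesValue M x h b (l + sch.N * (idx % Q))))
    (by simp [writes]) le_rfl (by simp) hN ?_ ?_ ?_ (by omega) ?_
  · intro l m' t' v h
    simpa using h
  · simp [sch.enc_zero]
  · rintro l m1 t1 hl h42 hfr ⟨ht, hacc⟩
    have g : ∀ a, a ≠ 31 → a ≠ 42 → m1 a = m a := by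
      intro a h1 h2
      rw [hfr a (by simp [forLoop, writes, h1, h2]), Memory.write_of_ne _ _ _ h1]
    have hpos : l + sch.N * (idx % Q) < sch.N * Q := by
      calc l + sch.N * (idx % Q) < sch.N * (idx % Q + 1) := by rw [mul_add]; omega
        _ ≤ sch.N * Q := Nat.mul_le_mul_left _ (Nat.mod_lt _ hQpos)
    refine WP.of_small fun hsm => wp_store le_rfl (by simpa using hsm _ _) ⟨ht, ?_⟩
    simp only [RExpr.eval_get, RExpr.eval_lit, RExpr.eval_add, RExpr.eval_mul, RExpr.eval_div,
      RExpr.eval_mod, RExpr.eval_ofNat, Memory.write_same, hacc, h42,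
      g 41 (by simp) (by simp), g 29 (by simp) (by simp), g 2 (by simp) (by simp),
      g 3 (by simp) (by simp), g (5 + h) (by omega) (by omega), g (20 + h) (by omega) (by omega),
      h41, hquot, hr.co h hh _ hi l hl, hV _ hpos, hr.mul, hr.add, Finset.sum_range_succ]
  · rintro m' t' ⟨ht, hacc⟩ -
    exact ⟨ht, by rw [hacc, yatesValue_succ hb x h hQ hidx]⟩

/-- Here conciseness, `N ≤ r`, is used: no intermediate vector is longer than the final one. -/
theorem pow_mul_pow_le (sch : Scheme K) {b M : ℕ} (hb : b ≤ M) :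
    sch.r ^ b * sch.N ^ (M - b) ≤ sch.r ^ M := by
  calc sch.r ^ b * sch.N ^ (M - b) ≤ sch.r ^ b * sch.r ^ (M - b) := by gcongr; exact sch.N_le
    _ = sch.r ^ M := by rw [← pow_add]; congr 1; omega

theorem wp_yatesStep {n M h b : ℕ} {x : ℕ → K} (hh : h < 3) (hr : sch.Ready n M m)
    (hb : b < M) (hV : ∀ i < sch.r ^ b * sch.N ^ (M - b),
      m (20 + h) i = sch.enc (sch.yatesValue M x h b i))
    (hlen : m vLEN 0 = sch.r ^ b * sch.N ^ (M - b)) (hN : sch.N < 2 ^ L) (hL : sch.r ^ M < 2 ^ L)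
    (hX : (sch.N + 1) * (sch.r ^ M + 1) ≤ X) :
    WP ω L X (yatesStep h sch.r sch.N sch.q) m t fun m' t' => t' = t ∧
      m' vLEN 0 = sch.r ^ (b + 1) * sch.N ^ (M - (b + 1)) ∧
      ∀ i < sch.r ^ (b + 1) * sch.N ^ (M - (b + 1)),
        m' (20 + h) i = sch.enc (sch.yatesValue M x h (b + 1) i) := by
  obtain ⟨Q, hQ⟩ : ∃ Q, Q = sch.r ^ b * sch.N ^ (M - (b + 1)) := ⟨_, rfl⟩
  have hNQ : sch.r ^ b * sch.N ^ (M - b) = sch.N * Q := by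
    rw [hQ, show M - b = (M - (b + 1)) + 1 by omega, pow_succ]; ring
  have hrQ : sch.r ^ (b + 1) * sch.N ^ (M - (b + 1)) = sch.r * Q := by
    rw [hQ, pow_succ]; ring
  have hrQle : sch.r * Q ≤ sch.r ^ M := hrQ ▸ sch.pow_mul_pow_le hb
  have hQle : Q ≤ sch.r * Q := Nat.le_mul_of_pos_left _ sch.r_pos
  have hX1 : 1 ≤ X := le_trans (Nat.mul_pos (by omega) (by omega)) hX
  rw [hNQ] at hV hlen
  rw [hrQ]
  have hquot : (var vLEN / lit sch.N).eval m = Q := by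
    simp only [RExpr.eval_div, RExpr.eval_get, RExpr.eval_lit, hlen]
    exact Nat.mul_div_cancel_left _ sch.N_pos
  refine wp_seq (wp_store hX1 (by rw [hquot]; omega) ?_)
  rw [hquot]
  set m1 := m.write 29 ((0 : RExpr).eval m) Q with hm1
  have g1 : ∀ a, a ≠ 29 → m1 a = m a := fun a ha => Memory.write_of_ne _ _ _ ha
  have q1 : m1 29 0 = Q := by simp [hm1]
  have e42 : 42 ≠ 20 + h := by omega
  refine wp_seq_frame (wp_forLoop (X := sch.N + 1) (sch.r * Q) (fun i m' t' => t' = t ∧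
    ∀ j < i, m' aOUT j = sch.enc (sch.yatesValue M x h (b + 1) j))
    (by simp [writes, forLoop, yatesEntry]) (by omega) ?_ (by omega) ?_ ?_ ?_
    (le_trans (by gcongr) hX) (fun _ _ h _ => h)) ?_
  · intro m' hfr
    simp [hfr 29 (by simp [forLoop, writes, yatesEntry]), q1]
  · intro i m' t' v h
    simpa using h
  · exact ⟨rfl, by simp⟩
  · rintro i m2 t2 hi h41 hfr2 ⟨ht2, hout⟩
    have g2 : ∀ a, a ≠ 28 → a ≠ 31 → a ≠ 41 → a ≠ 42 → m2 a = m1 a := fun a h1 h2 h3 h4 =>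
      hfr2 a (by simp [forLoop, writes, yatesEntry, h1, h2, h3, h4])
    refine wp_seq_frame (wp_yatesEntry (x := x) (Q := Q) (b := b) (idx := i) (n := n) (M := M) hh
      (hr.congr fun a h1 h2 => ?_) hb hQ hi ?_ h41 ?_ hN le_rfl) ?_
    · rw [g2 a (by omega) (by omega) (by omega) (by omega), g1 a (by omega)]
    · rw [g2 _ (by omega) (by omega) (by omega) (by omega), g1 _ (by omega)]
      exact hV
    · rw [g2 29 (by simp) (by simp) (by simp) (by simp), q1]
    · rintro m3 t3 hfr3 ⟨ht3, hacc⟩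
      refine WP.of_small fun hsm => wp_store (by omega) (by simpa using hsm _ _)
        ⟨ht3.trans ht2, fun j hj => ?_⟩
      have g28 : m3 28 = m2 28 := hfr3 28 (by simp [forLoop, writes, yatesEntry])
      have g41 : m3 41 0 = i := by rw [hfr3 41 (by simp [forLoop, writes, yatesEntry]), h41]
      simp only [RExpr.eval_get, RExpr.eval_lit, Memory.write_index, g41, hacc, g28]
      split_ifs with hji
      · rw [hji]
      · exact hout j (by omega)
  rintro m2 t2 hfr2 ⟨ht2, hout⟩
  have q2 : m2 29 0 = Q := by rw [hfr2 29 (by simp [forLoop, writes, yatesEntry]), q1]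
  refine wp_seq (wp_store hX1 (by simp [q2]; omega) ?_)
  refine wp_forLoop (X := 1) (sch.r * Q) (fun i m' t' => t' = t ∧ m' vLEN 0 = sch.r * Q ∧
    ∀ j < i, m' (20 + h) j = sch.enc (sch.yatesValue M x h (b + 1) j))
    (by simp [writes]; omega) le_rfl ?_ (by omega) ?_ ?_ ?_ ?_
    (fun _ _ h _ => h)
  · intro m' hfr
    simp [hfr 30 (by simp [forLoop, writes]; omega), q2]
  · rintro i m' t' v ⟨h1, h2, h3⟩
    refine ⟨h1, by simpa using h2, fun j hj => ?_⟩
    rw [Memory.write_of_ne _ _ _ (by omega), h3 j hj]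
  · exact ⟨ht2, by simp [q2], by simp⟩
  · rintro i m3 t3 hi h41 hfr3 ⟨ht3, hl3, hv3⟩
    have g28 : m3 28 = m2 28 := by
      rw [hfr3 28 (by simp [forLoop, writes]; omega), Memory.write_of_ne _ _ _ (by decide)]
    refine WP.of_small fun hsm => wp_store le_rfl (by simpa using hsm _ _) ⟨ht3, ?_, fun j hj => ?_⟩
    · rw [Memory.write_of_ne _ _ _ (by omega), hl3]
    · simp only [RExpr.eval_get, RExpr.eval_lit, Memory.write_index, h41, g28]
      split_ifs with hji
      · rw [hout i hi, hji]
      · exact hv3 j (by omega)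
  · calc 1 * (sch.r * Q + 1) ≤ (sch.N + 1) * (sch.r ^ M + 1) := by gcongr; omega
      _ ≤ X := hX

theorem wp_yates {n M h : ℕ} {x : ℕ → K} (hh : h < 3) (hr : sch.Ready n M m)
    (hV : ∀ w < sch.N ^ M, m (20 + h) w = sch.enc (x w)) (hN : sch.N < 2 ^ L) (hM : M < 2 ^ L)
    (hL : sch.r ^ M < 2 ^ L) (hX : (sch.N + 1) * (sch.r ^ M + 1) * (M + 1) ≤ X) :
    WP ω L X (yates h sch.r sch.N sch.q) m t fun m' t' => t' = t ∧ m' vLEN 0 = sch.r ^ M ∧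
      ∀ w < sch.r ^ M, m' (20 + h) w = sch.enc (sch.partialTransform x h M w 0) := by
  have hX1 : 1 ≤ (sch.N + 1) * (sch.r ^ M + 1) := Nat.mul_pos (by omega) (by omega)
  have hle : sch.N ^ M ≤ sch.r ^ M := Nat.pow_le_pow_left sch.N_le _
  have hw : ∀ a, a ≠ 20 + h → a ≠ 28 → a ≠ 29 → a ≠ 30 → a ≠ 31 → a ≠ 40 → a ≠ 41 → a ≠ 42 →
      a ∉ (forLoop 40 (var vBLOCKS) (yatesStep h sch.r sch.N sch.q)).writes := by
    intro a h1 h2 h3 h4 h5 h6 h7 h8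
    simp [yatesStep, yatesEntry, forLoop, writes, h1, h2, h3, h4, h5, h6, h7, h8]
  refine wp_seq (wp_store (hX1.trans (le_trans (Nat.le_mul_of_pos_right _ (by omega)) hX))
    (by simp [hr.codes]; omega) ?_)
  refine wp_forLoop (X := (sch.N + 1) * (sch.r ^ M + 1)) M (fun b m' t' => t' = t ∧
      m' vLEN 0 = sch.r ^ b * sch.N ^ (M - b) ∧ ∀ i < sch.r ^ b * sch.N ^ (M - b),
        m' (20 + h) i = sch.enc (sch.yatesValue M x h b i))
    (by simp [yatesStep, yatesEntry, forLoop, writes]; omega) hX1 ?_ hM ?_ ?_ ?_ hX ?_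
  · intro m' hfr
    simp [hfr 8 (hw 8 (by omega) (by simp) (by simp) (by simp) (by simp) (by simp) (by simp)
      (by simp)), hr.blocks]
  · rintro b m' t' v ⟨h1, h2, h3⟩
    refine ⟨h1, by simpa using h2, fun j hj => ?_⟩
    rw [Memory.write_of_ne _ _ _ (by omega), h3 j hj]
  · refine ⟨rfl, by simp [hr.codes], fun i hi => ?_⟩
    rw [pow_zero, one_mul, Nat.sub_zero] at hi
    rw [Memory.write_of_ne _ _ _ (by omega), hV i hi, yatesValue, partialTransform_zero,
      Nat.sub_zero, Nat.mod_eq_of_lt hi]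
  · rintro b m1 t1 hb - hfr ⟨ht, hlen, hv⟩
    refine (wp_yatesStep (x := x) (n := n) hh (hr.congr fun a h1 h2 => ?_) hb hv hlen hN hL
      le_rfl).mono ?_
    · rw [hfr a (hw a (by omega) (by omega) (by omega) (by omega) (by omega) (by omega) (by omega)
        (by omega)), Memory.write_of_ne _ _ _ (by omega)]
    · rintro m2 t2 ⟨h1, h2⟩
      exact ⟨h1.trans ht, h2⟩
  · rintro m' t' ⟨ht, hlen, hv⟩ -
    simp only [Nat.sub_self, pow_zero, mul_one] at hlen hv
    refine ⟨ht, hlen, fun w hw => ?_⟩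
    rw [hv w hw, yatesValue, Nat.sub_self, pow_zero, Nat.div_one, Nat.mod_one]

end Scheme

/-! ### A trial -/

namespace RProg

/-- Sum the products of the entries of the three vectors. -/
def sumProducts (q : ℕ) : RProg :=
  set vACC 0 ;;
  forLoop 40 (var vLEN) (set vACC (get aADD (var vACC * lit q +
    get aMUL (get aMUL (get 20 (var 40) * lit q + get 21 (var 40)) * lit q + get 22 (var 40)))))

/-- Evaluate the tensor power at random vectors. -/
def trial (k r N q : ℕ) : RProg :=
  randomPerm ;; fillVector 0 N k ;; fillVector 1 N k ;; fillVector 2 N k ;;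
    yates 0 r N q ;; yates 1 r N q ;; yates 2 r N q ;; sumProducts q

end RProg

namespace Scheme

open RProg

variable {K : Type*} [Field K] {sch : Scheme K}
variable {ω : ℕ → Bool} {L X : ℕ} {m : Memory} {t : ℕ}

theorem wp_sumProducts {n M R : ℕ} {x y z : ℕ → K} (hr : sch.Ready n M m)
    (hx : ∀ w < R, m 20 w = sch.enc (x w)) (hy : ∀ w < R, m 21 w = sch.enc (y w))
    (hz : ∀ w < R, m 22 w = sch.enc (z w)) (hlen : m vLEN 0 = R) (hL : R < 2 ^ L)
    (hX : R + 1 ≤ X) :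
    WP ω L X (sumProducts sch.q) m t fun m' t' => t' = t ∧
      m' vACC 0 = sch.enc (∑ w ∈ Finset.range R, x w * y w * z w) := by
  refine wp_seq (wp_store (by omega) (by simp) ?_)
  refine wp_forLoop (X := 1) R (fun l m' t' => t' = t ∧ m' vACC 0 = sch.enc
    (∑ w ∈ Finset.range l, x w * y w * z w)) (by simp [writes]) le_rfl ?_ hL ?_ ?_ ?_ (by omega)
    (fun _ _ h _ => h)
  · intro m' hfr
    simp [hfr 30 (by simp [forLoop, writes]), hlen]
  · intro l m' t' v h
    simpa using h
  · simp [sch.enc_zero]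
  · rintro l m1 t1 hl h40 hfr ⟨ht, hacc⟩
    have g : ∀ a, a ≠ 31 → a ≠ 40 → m1 a = m a := by
      intro a h1 h2
      rw [hfr a (by simp [forLoop, writes, h1, h2]), Memory.write_of_ne _ _ _ h1]
    refine WP.of_small fun hsm => wp_store le_rfl (by simpa using hsm _ _) ⟨ht, ?_⟩
    simp only [RExpr.eval_get, RExpr.eval_lit, RExpr.eval_add, RExpr.eval_mul,
      RExpr.eval_ofNat, Memory.write_same, hacc, h40,
      g 20 (by simp) (by simp), g 21 (by simp) (by simp), g 2 (by simp) (by simp),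
      g 3 (by simp) (by simp), g 22 (by simp) (by simp), hx l hl, hy l hl, hz l hl, hr.mul, hr.add,
      Finset.sum_range_succ]

theorem wp_trial {n M : ℕ} {mc thr : ℕ → ℕ} (hr : sch.Ready n M m)
    (hmc : m aCOVER = mc) (hthr : ∀ h < 3, m aTHR h = thr h)
    (hbits : bitCount (M * (3 * sch.k)) ≤ L) (hrL : sch.r ^ M < 2 ^ L) (hn : 2 ^ n < 2 ^ L)
    (hM : M < 2 ^ L) (hk : 3 * sch.k < 2 ^ L) (hN : sch.N < 2 ^ L)
    (hX₁ : (bitCount (M * (3 * sch.k)) + 1) * (M * (3 * sch.k) + 1) ≤ X)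
    (hX₂ : (3 * sch.k + 1) * (M + 1) * (sch.N ^ M + 1) ≤ X)
    (hX₃ : (sch.N + 1) * (sch.r ^ M + 1) * (M + 1) ≤ X) :
    WP ω L X (trial sch.k sch.r sch.N sch.q) m t fun m' t' => t' = t + sch.trialTosses M ∧
      m' vACC 0 = sch.enc (sch.trialValue n M mc thr (later t ω)) := by
  have hL1 : 1 ≤ L := le_trans (by unfold bitCount; omega) hbits
  have hle : sch.N ^ M ≤ sch.r ^ M := Nat.pow_le_pow_left sch.N_le _
  have hNL : sch.N ^ M < 2 ^ L := by omega
  have hX₄ : sch.r ^ M + 1 ≤ X := by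
    refine le_trans ?_ hX₃
    calc sch.r ^ M + 1 = 1 * (sch.r ^ M + 1) * 1 := by ring
      _ ≤ _ := by gcongr <;> omega
  set σ := sch.trialPerm M (later t ω) with hσdef
  set v : ℕ → ℕ → K := sch.trialVec n M mc thr (later t ω) with hv
  have hval : ∀ h s, s = t + sch.permTosses M + h * sch.N ^ M → ∀ w,
      (if mc (mask (sch.elems n M σ w)) < thr h then coinVal K (ω (s + w)) else 0) = v h w := by
    rintro h s rfl w
    simp only [hv, trialVec, later_apply, add_assoc, hσdef]
  refine wp_seq_frame (wp_randomPerm hr.size hbits hX₁) ?_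
  rintro m₀ t₀ f₀ ⟨ht₀, hperm⟩
  have g₀ : ∀ a, a ≠ 23 → a ≠ 24 → a ≠ 25 → a ≠ 26 → a ≠ 27 → a ≠ 40 → a ≠ 41 → m₀ a = m a := by
    intro a h1 h2 h3 h4 h5 h6 h7
    exact f₀ a (by simp [randomPerm, randomNumber, swapEntries, forLoop, writes, *])
  have hr₀ : sch.Ready n M m₀ := hr.congr fun a h1 h2 => g₀ a (by omega) (by omega) (by omega)
    (by omega) (by omega) (by omega) (by omega)
  have hmc₀ : m₀ aCOVER = mc := by
    rw [g₀ 18 (by simp) (by simp) (by simp) (by simp) (by simp) (by simp) (by simp), hmc]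
  have hthr₀ : ∀ h < 3, m₀ aTHR h = thr h := by
    rw [g₀ 34 (by simp) (by simp) (by simp) (by simp) (by simp) (by simp) (by simp)]; exact hthr
  have hσ₀ : ∀ x < M * (3 * sch.k), m₀ aPERM x = σ x := hperm
  have ht₀' : t₀ = t + sch.permTosses M := ht₀
  have fw : ∀ h a, a ≠ 19 → a ≠ 20 + h → a ≠ 25 → a ≠ 33 → a ≠ 40 → a ≠ 41 → a ≠ 42 →
      a ∉ (fillVector h sch.N sch.k).writes := by
    intro h a h1 h2 h3 h4 h5 h6 h7
    simp [fillVector, codeMask, forLoop, writes, *]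
  have yw : ∀ h a, a ≠ 20 + h → a ≠ 28 → a ≠ 29 → a ≠ 30 → a ≠ 31 → a ≠ 40 → a ≠ 41 → a ≠ 42 →
      a ∉ (yates h sch.r sch.N sch.q).writes := by
    intro h a h1 h2 h3 h4 h5 h6 h7 h8
    simp [yates, yatesStep, yatesEntry, forLoop, writes, *]
  refine wp_seq_frame (wp_fillVector (h := 0) (by simp) hr₀ hσ₀ hmc₀ (hthr₀ 0 (by simp)) hL1 hNL hn
    hM hk hX₂) ?_
  rintro m₁ t₁ f₁ ⟨ht₁, hv₁⟩
  have hr₁ : sch.Ready n M m₁ := hr₀.congr fun a h1 h2 => f₁ a (fw _ _ (by omega) (by omega)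
    (by omega) (by omega) (by omega) (by omega) (by omega))
  have e₁ : ∀ a, a ≠ 19 → a ≠ 20 → a ≠ 25 → a ≠ 33 → a ≠ 40 → a ≠ 41 → a ≠ 42 → m₁ a = m₀ a :=
    fun a h1 h2 h3 h4 h5 h6 h7 => f₁ a (fw _ _ h1 h2 h3 h4 h5 h6 h7)
  refine wp_seq_frame (wp_fillVector (h := 1) (σ := σ) (mc := mc) (thr := thr) (by simp) hr₁ ?_ ?_
    ?_ hL1 hNL hn hM hk hX₂) ?_
  · rw [e₁ 23 (by simp) (by simp) (by simp) (by simp) (by simp) (by simp) (by simp)]; exact hσ₀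
  · rw [e₁ 18 (by simp) (by simp) (by simp) (by simp) (by simp) (by simp) (by simp)]; exact hmc₀
  · rw [e₁ 34 (by simp) (by simp) (by simp) (by simp) (by simp) (by simp) (by simp)]
    exact hthr₀ 1 (by simp)
  rintro m₂ t₂ f₂ ⟨ht₂, hv₂⟩
  have hr₂ : sch.Ready n M m₂ := hr₁.congr fun a h1 h2 => f₂ a (fw _ _ (by omega) (by omega)
    (by omega) (by omega) (by omega) (by omega) (by omega))
  have e₂ : ∀ a, a ≠ 19 → a ≠ 21 → a ≠ 25 → a ≠ 33 → a ≠ 40 → a ≠ 41 → a ≠ 42 → m₂ a = m₁ a :=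
    fun a h1 h2 h3 h4 h5 h6 h7 => f₂ a (fw _ _ h1 h2 h3 h4 h5 h6 h7)
  refine wp_seq_frame (wp_fillVector (h := 2) (σ := σ) (mc := mc) (thr := thr) (by simp) hr₂ ?_ ?_
    ?_ hL1 hNL hn hM hk hX₂) ?_
  · rw [e₂ 23 (by simp) (by simp) (by simp) (by simp) (by simp) (by simp) (by simp),
      e₁ 23 (by simp) (by simp) (by simp) (by simp) (by simp) (by simp) (by simp)]; exact hσ₀
  · rw [e₂ 18 (by simp) (by simp) (by simp) (by simp) (by simp) (by simp) (by simp),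
      e₁ 18 (by simp) (by simp) (by simp) (by simp) (by simp) (by simp) (by simp)]; exact hmc₀
  · rw [e₂ 34 (by simp) (by simp) (by simp) (by simp) (by simp) (by simp) (by simp),
      e₁ 34 (by simp) (by simp) (by simp) (by simp) (by simp) (by simp) (by simp)]
    exact hthr₀ 2 (by simp)
  rintro m₃ t₃ f₃ ⟨ht₃, hv₃⟩
  have hr₃ : sch.Ready n M m₃ := hr₂.congr fun a h1 h2 => f₃ a (fw _ _ (by omega) (by omega)
    (by omega) (by omega) (by omega) (by omega) (by omega))
  have e₃ : ∀ a, a ≠ 19 → a ≠ 22 → a ≠ 25 → a ≠ 33 → a ≠ 40 → a ≠ 41 → a ≠ 42 → m₃ a = m₂ a :=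
    fun a h1 h2 h3 h4 h5 h6 h7 => f₃ a (fw _ _ h1 h2 h3 h4 h5 h6 h7)
  have x₀ : ∀ w < sch.N ^ M, m₃ (20 + 0) w = sch.enc (v 0 w) := by
    intro w hw
    rw [e₃ (20 + 0) (by simp) (by simp) (by simp) (by simp) (by simp) (by simp) (by simp),
      e₂ (20 + 0) (by simp) (by simp) (by simp) (by simp) (by simp) (by simp) (by simp), hv₁ w hw,
      hval 0 t₀ (by omega)]
  have x₁ : ∀ w < sch.N ^ M, m₃ (20 + 1) w = sch.enc (v 1 w) := by
    intro w hw
    rw [e₃ (20 + 1) (by simp) (by simp) (by simp) (by simp) (by simp) (by simp) (by simp), hv₂ w hw,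
      hval 1 t₁ (by omega)]
  have x₂ : ∀ w < sch.N ^ M, m₃ (20 + 2) w = sch.enc (v 2 w) := by
    intro w hw
    rw [hv₃ w hw, hval 2 t₂ (by omega)]
  refine wp_seq_frame (wp_yates (h := 0) (by simp) hr₃ x₀ hN hM hrL hX₃) ?_
  rintro m₄ t₄ f₄ ⟨ht₄, -, hv₄⟩
  have hr₄ : sch.Ready n M m₄ := hr₃.congr fun a h1 h2 => f₄ a (yw _ _ (by omega) (by omega)
    (by omega) (by omega) (by omega) (by omega) (by omega) (by omega))
  have e₄ : ∀ a, 20 < a → a < 23 → m₄ a = m₃ a := fun a h1 h2 => f₄ a (yw _ _ (by omega) (by omega)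
    (by omega) (by omega) (by omega) (by omega) (by omega) (by omega))
  refine wp_seq_frame (wp_yates (h := 1) (x := v 1) (by simp) hr₄ ?_ hN hM hrL hX₃) ?_
  · rw [e₄ (20 + 1) (by simp) (by simp)]; exact x₁
  rintro m₅ t₅ f₅ ⟨ht₅, -, hv₅⟩
  have hr₅ : sch.Ready n M m₅ := hr₄.congr fun a h1 h2 => f₅ a (yw _ _ (by omega) (by omega)
    (by omega) (by omega) (by omega) (by omega) (by omega) (by omega))
  have e₅ : ∀ a, 19 < a → a < 23 → a ≠ 21 → m₅ a = m₄ a := fun a h1 h2 h3 => f₅ a (yw _ _ (by omega)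
    (by omega) (by omega) (by omega) (by omega) (by omega) (by omega) (by omega))
  refine wp_seq_frame (wp_yates (h := 2) (x := v 2) (by simp) hr₅ ?_ hN hM hrL hX₃) ?_
  · rw [e₅ (20 + 2) (by simp) (by simp) (by simp), e₄ (20 + 2) (by simp) (by simp)]; exact x₂
  rintro m₆ t₆ f₆ ⟨ht₆, hlen, hv₆⟩
  have hr₆ : sch.Ready n M m₆ := hr₅.congr fun a h1 h2 => f₆ a (yw _ _ (by omega) (by omega)
    (by omega) (by omega) (by omega) (by omega) (by omega) (by omega))
  have e₆ : ∀ a, 19 < a → a < 22 → m₆ a = m₅ a := fun a h1 h2 => f₆ a (yw _ _ (by omega)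
    (by omega) (by omega) (by omega) (by omega) (by omega) (by omega) (by omega))
  refine (wp_sumProducts hr₆ (x := fun w => sch.partialTransform (v 0) 0 M w 0)
    (y := fun w => sch.partialTransform (v 1) 1 M w 0)
    (z := fun w => sch.partialTransform (v 2) 2 M w 0) ?_ ?_ hv₆ hlen hrL hX₄).mono ?_
  · rw [e₆ 20 (by simp) (by simp), e₅ 20 (by simp) (by simp) (by simp)]; exact hv₄
  · rw [e₆ 21 (by simp) (by simp)]; exact hv₅
  · rintro m' t' ⟨ht', hacc⟩
    refine ⟨?_, ?_⟩
    · unfold trialTosses; omega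
    · rw [hacc, sum_partialTransform]; rfl

end Scheme

local notation "vPOWER" => (12 : ℕ)
local notation "vGOOD" => (13 : ℕ)
local notation "vTRIALS" => (14 : ℕ)
local notation "vFLAG" => (32 : ℕ)
local notation "vTOTAL" => (36 : ℕ)

/-! ### The algorithm -/

namespace Scheme

open RProg

variable {K : Type*} [Field K] (sch : Scheme K)
variable {ω : ℕ → Bool} {L X : ℕ} {m : Memory} {t : ℕ}

/-- Write down the tables for the field operations, the sets, and the coefficients. -/
def tables : RProg :=
  table aADD (fun i => sch.enc (sch.dec (i / sch.q) + sch.dec (i % sch.q))) (sch.q * sch.q) ;;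
  table aMUL (fun i => sch.enc (sch.dec (i / sch.q) * sch.dec (i % sch.q))) (sch.q * sch.q) ;;
  table aSUB (fun i => if i % (3 * sch.k) ∈ sch.sub (i / (3 * sch.k)) then 1 else 0)
    (sch.N * (3 * sch.k)) ;;
  table 5 (fun i => sch.enc (sch.co 0 (i / sch.N) (i % sch.N))) (sch.r * sch.N) ;;
  table 6 (fun i => sch.enc (sch.co 1 (i / sch.N) (i % sch.N))) (sch.r * sch.N) ;;
  table 7 (fun i => sch.enc (sch.co 2 (i / sch.N) (i % sch.N))) (sch.r * sch.N)

/-- The number of blocks that leaves room for `2 * s` additional elements. -/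
def blockCount (s n : ℕ) : ℕ := (n + (2 * s + 3 * sch.k)) / (3 * sch.k)

/-- The number of repetitions of a trial. -/
def trialCount (M : ℕ) : ℕ := 32 * ((27 ^ sch.k) ^ M / triCount sch.k ^ M + 1)

/-- The tables and parameters. -/
def parameters (s : ℕ) : RProg :=
  set vBLOCKS ((var 0 + lit (2 * s + 3 * sch.k)) / lit (3 * sch.k)) ;;
  set vSIZE (var vBLOCKS * lit (3 * sch.k)) ;;
  weights ;; power vCODES sch.N ;; power vPOWER (27 ^ sch.k) ;; power vGOOD (triCount sch.k) ;;
  set vTRIALS (32 * (var vPOWER / var vGOOD + 1)) ;;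
  set vTOTAL ((get 0 2 + 1) * (get 0 2 + 1) * var vTRIALS)

/-- The deterministic part of the algorithm. -/
def setup (s : ℕ) : RProg :=
  sch.tables ;; sch.parameters s ;; listSets sch.k ;; coverTable

/-- Perform the trial whose number is the value of variable `39`. -/
def numberedTrial : RProg :=
  -- The trial number is read in mixed radix as `(j₁, j₂, i)`: both covering numbers run up to the
  -- size of the family, and `i` counts repetitions.
  .store aTHR 0 (var 39 / var vTRIALS / (get 0 2 + 1) + 1) ;;
  .store aTHR 1 (var 39 / var vTRIALS % (get 0 2 + 1) + 1) ;;
  .store aTHR 2 (get 0 1 + 1 - (var 39 / var vTRIALS / (get 0 2 + 1) +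
    var 39 / var vTRIALS % (get 0 2 + 1))) ;;
  -- `1 - (1 - x)` is `1` for `x > 0` and `0` for `x = 0`, so the flag is the disjunction of all
  -- outcomes so far.
  trial sch.k sch.r sch.N sch.q ;; set vFLAG (1 - (1 - (var vFLAG + var vACC)))

/-- The random part of the algorithm. -/
def search : RProg :=
  set vFLAG 0 ;; forLoop 39 (var vTOTAL) sch.numberedTrial ;; .store 0 0 (var vFLAG)

variable {sch}

theorem mem_writes_tables {a : ℕ} (h : a ∈ sch.tables.writes) : 2 ≤ a ∧ a ≤ 7 := by
  simp only [tables, writes, List.mem_append] at h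
  rcases h with h | h | h | h | h | h <;> have := mem_writes_table h <;> omega

theorem div_mul_add {q a b : ℕ} (hb : b < q) : (a * q + b) / q = a := by
  rw [mul_comm, Nat.mul_add_div (by omega), Nat.div_eq_of_lt hb, add_zero]

theorem mod_mul_add {q a b : ℕ} (hb : b < q) : (a * q + b) % q = b := by
  rw [mul_comm, Nat.mul_add_mod, Nat.mod_eq_of_lt hb]

theorem mul_add_lt {q n a b : ℕ} (ha : a < n) (hb : b < q) : a * q + b < n * q := by
  calc a * q + b < (a + 1) * q := by rw [add_mul]; omega
    _ ≤ n * q := Nat.mul_le_mul_right _ ha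

theorem wp_tables (hq : sch.q < 2 ^ L) (hX : 1 ≤ X) :
    WP ω L X sch.tables m t fun m' t' => t' = t ∧
      (∀ x y, m' aADD (sch.enc x * sch.q + sch.enc y) = sch.enc (x + y)) ∧
      (∀ x y, m' aMUL (sch.enc x * sch.q + sch.enc y) = sch.enc (x * y)) ∧
      (∀ l < sch.N, ∀ e < 3 * sch.k,
        m' aSUB (l * (3 * sch.k) + e) = if e ∈ sch.sub l then 1 else 0) ∧
      ∀ h < 3, ∀ i < sch.r, ∀ l < sch.N, m' (5 + h) (i * sch.N + l) = sch.enc (sch.co h i l) := by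
  have henc : ∀ x, sch.enc x < 2 ^ L := fun x => (sch.enc_lt x).trans hq
  have h1 : 1 < 2 ^ L := by rw [← sch.enc_one]; exact henc 1
  have ne : ∀ {a b : ℕ} {f : ℕ → ℕ} {len : ℕ}, b ≠ a → b ∉ (table a f len).writes :=
    fun h hb => h (mem_writes_table hb)
  refine wp_seq_frame (wp_table (fun _ _ => henc _) hX) ?_
  rintro m₂ t₂ f₂ ⟨h₂, ht₂⟩
  refine wp_seq_frame (wp_table (fun _ _ => henc _) hX) ?_
  rintro m₃ t₃ f₃ ⟨h₃, ht₃⟩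
  refine wp_seq_frame (wp_table (fun _ _ => by split_ifs <;> omega) hX) ?_
  rintro m₄ t₄ f₄ ⟨h₄, ht₄⟩
  refine wp_seq_frame (wp_table (fun _ _ => henc _) hX) ?_
  rintro m₅ t₅ f₅ ⟨h₅, ht₅⟩
  refine wp_seq_frame (wp_table (fun _ _ => henc _) hX) ?_
  rintro m₆ t₆ f₆ ⟨h₆, ht₆⟩
  refine ((wp_table (fun _ _ => henc _) hX).frame).mono ?_
  rintro m₇ t₇ ⟨⟨h₇, ht₇⟩, f₇⟩
  refine ⟨by omega, fun x y => ?_, fun x y => ?_, fun l hl e he => ?_, fun h hh i hi l hl => ?_⟩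
  · rw [f₇ 2 (ne (by simp)), f₆ 2 (ne (by simp)), f₅ 2 (ne (by simp)), f₄ 2 (ne (by simp)),
      f₃ 2 (ne (by simp)), h₂ _ (mul_add_lt (sch.enc_lt x) (sch.enc_lt y)),
      div_mul_add (sch.enc_lt y), mod_mul_add (sch.enc_lt y), sch.dec_enc, sch.dec_enc]
  · rw [f₇ 3 (ne (by simp)), f₆ 3 (ne (by simp)), f₅ 3 (ne (by simp)), f₄ 3 (ne (by simp)),
      h₃ _ (mul_add_lt (sch.enc_lt x) (sch.enc_lt y)),
      div_mul_add (sch.enc_lt y), mod_mul_add (sch.enc_lt y), sch.dec_enc, sch.dec_enc]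
  · rw [f₇ 4 (ne (by simp)), f₆ 4 (ne (by simp)), f₅ 4 (ne (by simp)), h₄ _ (mul_add_lt hl he),
      div_mul_add he, mod_mul_add he]
  · interval_cases h
    · rw [f₇ (5 + 0) (ne (by simp)), f₆ (5 + 0) (ne (by simp)), h₅ _ (mul_add_lt hi hl),
        div_mul_add hl, mod_mul_add hl]
    · rw [f₇ (5 + 1) (ne (by simp)), h₆ _ (mul_add_lt hi hl), div_mul_add hl, mod_mul_add hl]
    · rw [h₇ _ (mul_add_lt hi hl), div_mul_add hl, mod_mul_add hl]

/-- Registers of `L` bits suffice for the instance `I` and `M` blocks. -/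
structure Fits (sch : Scheme K) (I : SetCoverInstance) (M L : ℕ) : Prop where
  field : sch.q < 2 ^ L
  bits : bitCount (M * (3 * sch.k)) ≤ L
  sets : 2 ^ (I.n + 1) < 2 ^ L
  rank : sch.r ^ M < 2 ^ L
  power : (27 ^ sch.k) ^ M < 2 ^ L
  trials : (I.fam.length + 1) * (I.fam.length + 1) * sch.trialCount M < 2 ^ L
  cover : I.fam.length + I.t + 2 < 2 ^ L

theorem triCount_pos (k : ℕ) : 0 < triCount k :=
  Nat.mul_pos (Nat.choose_pos (by omega)) (Nat.choose_pos (by omega))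

theorem trialCount_pos (sch : Scheme K) (M : ℕ) : 0 < sch.trialCount M := by
  exact Nat.mul_pos (by norm_num) (Nat.succ_pos _)

theorem one_le_blockCount (sch : Scheme K) (s n : ℕ) : 1 ≤ sch.blockCount s n := by
  have := sch.k_pos
  unfold blockCount
  rw [Nat.one_le_div_iff (by omega)]
  omega

theorem Fits.blocks_lt {I : SetCoverInstance} {M : ℕ} (h : sch.Fits I M L) :
    M * (3 * sch.k) < 2 ^ L := by
  have := h.bits
  unfold bitCount at this
  exact lt_of_le_of_lt (by omega) (Nat.lt_two_pow_self (n := L))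

theorem Fits.M_lt {I : SetCoverInstance} {M : ℕ} (h : sch.Fits I M L) : M < 2 ^ L :=
  lt_of_le_of_lt (Nat.le_mul_of_pos_right _ (by have := sch.k_pos; omega)) h.blocks_lt

theorem wp_parameters {s M : ℕ} {I : SetCoverInstance} (hM : M = sch.blockCount s I.n)
    (hfit : sch.Fits I M L) (hin : m 0 = I.input 0) (hw : m aWEIGHT = 0) (hX₁ : I.n + 1 ≤ X)
    (hX₂ : M + 1 ≤ X) (hT : triCount sch.k ≤ 27 ^ sch.k) :
    WP ω L X (sch.parameters s) m t fun m' t' => t' = t ∧ m' vBLOCKS 0 = M ∧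
      m' vSIZE 0 = M * (3 * sch.k) ∧ m' aWEIGHT = bitWeight I.n ∧ m' vCODES 0 = sch.N ^ M ∧
      m' vTRIALS 0 = sch.trialCount M ∧
      m' vTOTAL 0 = (I.fam.length + 1) * (I.fam.length + 1) * sch.trialCount M := by
  have hML := hfit.M_lt
  have hNL : sch.N ^ M < 2 ^ L := (Nat.pow_le_pow_left sch.N_le _).trans_lt hfit.rank
  have hTL : triCount sch.k ^ M < 2 ^ L := (Nat.pow_le_pow_left hT _).trans_lt hfit.power
  have hnL : 2 ^ I.n < 2 ^ L := (Nat.pow_le_pow_right (by norm_num) (by omega)).trans_lt hfit.sets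
  have hBL : sch.trialCount M < 2 ^ L :=
    (Nat.le_mul_of_pos_left _ (Nat.mul_pos (by omega) (by omega))).trans_lt hfit.trials
  have hm0 : m 0 0 = I.n := by rw [hin]; rfl
  have hm2 : m 0 2 = I.fam.length := by rw [hin]; rfl
  have hval : ((var 0 + lit (2 * s + 3 * sch.k)) / lit (3 * sch.k)).eval m = M := by
    simp only [RExpr.eval_div, RExpr.eval_add, RExpr.eval_get, RExpr.eval_lit, hm0, hM, blockCount]
  refine wp_seq (wp_store (by omega) (by rw [hval]; exact hML) ?_)
  rw [hval]
  refine wp_seq (wp_store (by omega) (by simpa using hfit.blocks_lt) ?_)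
  set m₁ := (m.write 8 ((0 : RExpr).eval m) M).write 9
    ((0 : RExpr).eval (m.write 8 ((0 : RExpr).eval m) M))
    ((var vBLOCKS * lit (3 * sch.k)).eval (m.write 8 ((0 : RExpr).eval m) M)) with hm₁
  have g₁ : ∀ a, a ≠ 8 → a ≠ 9 → m₁ a = m a := by
    intro a h1 h2
    rw [hm₁, Memory.write_of_ne _ _ _ h2, Memory.write_of_ne _ _ _ h1]
  have b₁ : m₁ 8 0 = M := by simp [hm₁]
  have s₁ : m₁ 9 0 = M * (3 * sch.k) := by simp [hm₁]
  refine wp_seq_frame (wp_weights (n := I.n) (by rw [g₁ 0 (by simp) (by simp), hm0])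
    (by rw [g₁ 10 (by simp) (by simp), hw]) hnL hX₁) ?_
  rintro m₂ t₂ f₂ ⟨hw₂, ht₂⟩
  have g₂ : ∀ a, a ≠ 10 → a ≠ 26 → a ≠ 40 → m₂ a = m₁ a := fun a h1 h2 h3 =>
    f₂ a (by simp [weights, forLoop, writes, *])
  have pw : ∀ d b a, a ≠ d → a ≠ 40 → a ∉ (power d b).writes := by
    intro d b a h1 h2
    simp [RProg.power, forLoop, writes, *]
  have b₂ : m₂ 8 0 = M := by rw [g₂ 8 (by simp) (by simp) (by simp), b₁]
  refine wp_seq_frame (wp_power (by simp) (by simp) sch.N_pos b₂ hML hNL hX₂) ?_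
  rintro m₃ t₃ f₃ ⟨hp₃, ht₃⟩
  have b₃ : m₃ 8 0 = M := by rw [f₃ 8 (pw _ _ _ (by simp) (by simp)), b₂]
  refine wp_seq_frame (wp_power (by simp) (by simp) (by positivity) b₃ hML hfit.power hX₂) ?_
  rintro m₄ t₄ f₄ ⟨hp₄, ht₄⟩
  have b₄ : m₄ 8 0 = M := by rw [f₄ 8 (pw _ _ _ (by simp) (by simp)), b₃]
  refine wp_seq_frame (wp_power (by simp) (by simp) (triCount_pos _) b₄ hML hTL hX₂) ?_
  rintro m₅ t₅ f₅ ⟨hp₅, ht₅⟩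
  have g₅ : ∀ a, a < 11 → m₅ a = m₂ a := by
    intro a h
    rw [f₅ a (pw _ _ _ (by omega) (by omega)), f₄ a (pw _ _ _ (by omega) (by omega)),
      f₃ a (pw _ _ _ (by omega) (by omega))]
  have c₅ : m₅ 11 0 = sch.N ^ M := by
    rw [f₅ 11 (pw _ _ _ (by simp) (by simp)), f₄ 11 (pw _ _ _ (by simp) (by simp)), hp₃]
  have d₅ : m₅ 12 0 = (27 ^ sch.k) ^ M := by
    rw [f₅ 12 (pw _ _ _ (by simp) (by simp)), hp₄]
  have l₅ : m₅ 0 2 = I.fam.length := by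
    rw [g₅ 0 (by simp), g₂ 0 (by simp) (by simp) (by simp), g₁ 0 (by simp) (by simp), hm2]
  have hv₅ : (32 * (var vPOWER / var vGOOD + 1)).eval m₅ = sch.trialCount M := by
    simp only [RExpr.eval_mul, RExpr.eval_add, RExpr.eval_div, RExpr.eval_get, RExpr.eval_lit,
      RExpr.eval_ofNat, d₅, hp₅, trialCount]
  refine wp_seq (wp_store (by omega) (by rw [hv₅]; exact hBL) ?_)
  rw [hv₅]
  refine wp_store (by omega) ?_ ?_
  · simpa [l₅] using hfit.trials
  · simp only [Memory.write_of_ne, ne_eq, Nat.reduceEqDiff, not_false_eq_true, Memory.write_same,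
      RExpr.eval_mul, RExpr.eval_add, RExpr.eval_get, RExpr.eval_lit, RExpr.eval_ofNat, l₅, c₅,
      and_true, true_and, g₅ 8 (by simp), g₅ 9 (by simp), g₅ 10 (by simp), hw₂, b₂]
    exact ⟨by omega, by rw [g₂ 9 (by simp) (by simp) (by simp), s₁]⟩

/-- The state of the memory after the deterministic part of the algorithm. -/
structure Prepared (sch : Scheme K) (I : SetCoverInstance) (M : ℕ) (m : Memory) : Prop where
  ready : sch.Ready I.n M m
  input : m 0 = I.input 0
  trials : m vTRIALS 0 = sch.trialCount M
  total : m vTOTAL 0 = (I.fam.length + 1) * (I.fam.length + 1) * sch.trialCount M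
  cover : I.IsCoverTable (M * sch.k) (m aCOVER)

theorem wp_setup {s M : ℕ} {I : SetCoverInstance} (hM : M = sch.blockCount s I.n)
    (hfit : sch.Fits I M L) (hT : triCount sch.k ≤ 27 ^ sch.k) (hX₁ : M + 1 ≤ X)
    (hX₂ : (I.n + 1) * (I.fam.length + 1) * (smallSubsetCount I.n (M * sch.k) + 1) *
      (I.fam.length + 1) ≤ X) :
    WP ω L X (sch.setup s) I.input 0 fun m' t' => t' = 0 ∧ sch.Prepared I M m' := by
  have hX₃ : (smallSubsetCount I.n (M * sch.k) + 1) * (I.n + 1) ≤ X := by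
    refine le_trans ?_ hX₂
    calc _ = (I.n + 1) * 1 * (smallSubsetCount I.n (M * sch.k) + 1) * 1 := by ring
      _ ≤ _ := by gcongr <;> omega
  have hX₄ : I.n + 1 ≤ X := le_trans (Nat.le_mul_of_pos_left _ (by omega)) hX₃
  have hnL : 2 ^ I.n < 2 ^ L := (Nat.pow_le_pow_right (by norm_num) (by omega)).trans_lt hfit.sets
  refine wp_seq_frame (wp_tables hfit.field (by omega)) ?_
  rintro m₁ t₁ f₁ ⟨ht₁, hadd, hmul, hsub, hco⟩
  have g₁ : ∀ a, a < 2 ∨ 7 < a → m₁ a = I.input a := fun a h => f₁ a fun hmem => by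
    have := mem_writes_tables hmem
    omega
  refine wp_seq_frame (wp_parameters hM hfit (g₁ 0 (by simp)) ?_ hX₄ hX₁ hT) ?_
  · rw [g₁ 10 (by simp)]; rfl
  rintro m₂ t₂ f₂ ⟨ht₂, hb, hs, hw, hc, htr, hto⟩
  have g₂ : ∀ a, a < 8 → m₂ a = m₁ a := by
    intro a h
    refine f₂ a ?_
    simp only [parameters, weights, RProg.power, forLoop, writes, List.cons_append, List.nil_append,
      List.mem_cons, List.not_mem_nil, or_false, not_or]
    omega
  have i₂ : m₂ 0 0 = I.n := by rw [g₂ 0 (by simp), g₁ 0 (by simp)]; rfl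
  have hK : M * sch.k + 1 < 2 ^ L := by
    have h1 := hfit.bits
    have h2 : M * (3 * sch.k) = 3 * (M * sch.k) := by ring
    have h3 : M * sch.k + 1 ≤ L := by unfold bitCount at h1; omega
    exact h3.trans_lt Nat.lt_two_pow_self
  refine wp_seq_frame (wp_listSets i₂ hb hw hfit.sets hK hX₃) ?_
  rintro m₃ t₃ f₃ ⟨ht₃, cnt, F, hF⟩
  have g₃ : ∀ a, a < 15 ∨ a = 36 → m₃ a = m₂ a := by
    intro a h
    refine f₃ a ?_
    simp only [listSets, listStep, forLoop, writes, List.cons_append, List.nil_append,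
      List.mem_cons, List.not_mem_nil, or_false, not_or]
    omega
  refine ((wp_coverTable (I := I) (by rw [g₃ 0 (by simp), g₂ 0 (by simp), g₁ 0 (by simp)])
    (by rw [g₃ 1 (by simp), g₂ 1 (by simp), g₁ 1 (by simp)]) (by rw [g₃ 10 (by simp), hw]) hF hnL
    (by have := hfit.cover; omega) hX₂).frame).mono ?_
  rintro m₄ t₄ ⟨⟨ht₄, hcov⟩, f₄⟩
  have g₄ : ∀ a, a < 15 ∨ a = 36 → m₄ a = m₂ a := by
    intro a h
    rw [f₄ a, g₃ a h]
    simp only [coverTable, relaxProg, forLoop, writes, List.cons_append, List.nil_append,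
      List.mem_cons, List.not_mem_nil, or_false, not_or]
    omega
  refine ⟨by omega, ⟨?_, ?_, ?_, ?_, ?_, ?_, ?_, ?_⟩, ?_, ?_, ?_, hcov⟩
  · rw [g₄ 2 (by simp), g₂ 2 (by simp)]; exact hadd
  · rw [g₄ 3 (by simp), g₂ 3 (by simp)]; exact hmul
  · rw [g₄ 4 (by simp), g₂ 4 (by simp)]; exact hsub
  · intro h hh
    rw [g₄ (5 + h) (by omega), g₂ (5 + h) (by omega)]; exact hco h hh
  · rw [g₄ 8 (by simp), hb]
  · rw [g₄ 9 (by simp), hs]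
  · rw [g₄ 10 (by simp), hw]
  · rw [g₄ 11 (by simp), hc]
  · rw [g₄ 0 (by simp), g₂ 0 (by simp), g₁ 0 (by simp)]
  · rw [g₄ 14 (by simp), htr]
  · rw [g₄ 36 (by simp), hto]

/-- The thresholds used in the trial with number `g`. -/
def trialThreshold (sch : Scheme K) (I : SetCoverInstance) (M g : ℕ) : ℕ → ℕ :=
  threshold I.t (g / sch.trialCount M / (I.fam.length + 1))
    (g / sch.trialCount M % (I.fam.length + 1))

/-- The trial with number `g` is successful. -/
def Success (sch : Scheme K) (I : SetCoverInstance) (M : ℕ) (mc : ℕ → ℕ) (ω : ℕ → Bool) (g : ℕ) :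
    Prop :=
  sch.trialValue I.n M mc (sch.trialThreshold I M g) (later (g * sch.trialTosses M) ω) ≠ 0

theorem enc_eq_zero (x : K) : sch.enc x = 0 ↔ x = 0 := by
  constructor
  · intro h
    rw [← sch.dec_enc x, h, ← sch.enc_zero, sch.dec_enc]
  · rintro rfl
    exact sch.enc_zero

/-- A bound for the cost of a trial with `M` blocks. -/
def trialCost (sch : Scheme K) (M : ℕ) : ℕ :=
  (bitCount (M * (3 * sch.k)) + 1) * (M * (3 * sch.k) + 1) +
    (3 * sch.k + 1) * (M + 1) * (sch.N ^ M + 1) + (sch.N + 1) * (sch.r ^ M + 1) * (M + 1)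

theorem one_le_trialCost (sch : Scheme K) (M : ℕ) : 1 ≤ sch.trialCost M :=
  le_trans (Nat.mul_pos (Nat.mul_pos (by omega) (by omega)) (by omega)) (Nat.le_add_left _ _)

theorem Prepared.congr {I : SetCoverInstance} {M : ℕ} {m' : Memory} (h : sch.Prepared I M m)
    (hm : ∀ a, a ≠ 1 → a ≤ 18 ∨ a = 36 → m' a = m a) : sch.Prepared I M m' where
  ready := h.ready.congr fun a h1 h2 => hm a (by omega) (by omega)
  input := by rw [hm 0 (by simp) (by simp), h.input]
  trials := by rw [hm 14 (by simp) (by simp), h.trials]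
  total := by rw [hm 36 (by simp) (by simp), h.total]
  cover := by rw [hm 18 (by simp) (by simp)]; exact h.cover

theorem mem_writes_trial {k r N q a : ℕ} (h : a ∈ (trial k r N q).writes) :
    19 ≤ a ∧ a ≠ 32 ∧ a ≠ 34 ∧ a ≠ 36 ∧ a ≠ 39 := by
  simp only [trial, randomPerm, randomNumber, swapEntries, fillVector, codeMask, yates, yatesStep,
    yatesEntry, sumProducts, forLoop, writes, List.cons_append, List.nil_append,
    List.mem_cons, List.not_mem_nil, or_false] at h
  omega

open Classical in
theorem wp_numberedTrial {M g : ℕ} {I : SetCoverInstance} (hM1 : 1 ≤ M) (hfit : sch.Fits I M L)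
    (hp : sch.Prepared I M m) (hg : g < (I.fam.length + 1) * (I.fam.length + 1) * sch.trialCount M)
    (h39 : m 39 0 = g) {P : Prop} (hflag : m vFLAG 0 = if P then 1 else 0)
    (ht : t = g * sch.trialTosses M) (hX : sch.trialCost M ≤ X) :
    WP ω L X sch.numberedTrial m t fun m' t' => t' = (g + 1) * sch.trialTosses M ∧
      m' vFLAG 0 = if P ∨ sch.Success I M (m aCOVER) ω g then 1 else 0 := by
  have hX1 : 1 ≤ X := (sch.one_le_trialCost M).trans hX
  have hm2 : m 0 2 = I.fam.length := by rw [hp.input]; rfl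
  have hm1 : m 0 1 = I.t := by rw [hp.input]; rfl
  have hj₁ : g / sch.trialCount M / (I.fam.length + 1) ≤ I.fam.length := by
    rw [← Nat.lt_succ_iff, Nat.div_lt_iff_lt_mul (by omega), Nat.div_lt_iff_lt_mul
      (sch.trialCount_pos M)]
    exact hg
  have hj₂ : g / sch.trialCount M % (I.fam.length + 1) ≤ I.fam.length :=
    Nat.lt_succ_iff.1 (Nat.mod_lt _ (by omega))
  have hcov := hfit.cover
  have htr := hp.trials
  refine wp_seq (wp_store hX1 ?_ (wp_seq (wp_store hX1 ?_ (wp_seq (wp_store hX1 ?_ ?_)))))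
  · simp [h39, htr, hm2]; omega
  · simp [h39, htr, hm2]; omega
  · simp only [RExpr.eval_sub, RExpr.eval_get, RExpr.eval_add, RExpr.eval_ofNat,
      Memory.write_of_ne, ne_eq, Nat.reduceEqDiff, not_false_eq_true, hm1]
    exact (Nat.sub_le _ _).trans_lt (by omega)
  generalize hm' : Memory.write _ 34 _ _ = m₁
  have g₁ : ∀ a, a ≠ 34 → m₁ a = m a := by
    rintro a ha
    simp [← hm', ha]
  have hthr : ∀ h < 3, m₁ 34 h = sch.trialThreshold I M g h := by
    intro h hh
    interval_cases h <;>
    simp [← hm', Memory.write_index, h39, htr, hm2, hm1, trialThreshold, threshold]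
  have hp₁ : sch.Prepared I M m₁ := hp.congr fun a h1 h2 => g₁ a (by omega)
  have hk : 3 * sch.k < 2 ^ L := lt_of_le_of_lt (Nat.le_mul_of_pos_left _ hM1) hfit.blocks_lt
  have hN : sch.N < 2 ^ L := by
    refine lt_of_le_of_lt ?_ hfit.rank
    calc sch.N ≤ sch.r := sch.N_le
      _ = sch.r ^ 1 := (pow_one _).symm
      _ ≤ sch.r ^ M := Nat.pow_le_pow_right sch.r_pos hM1
  have hnL : 2 ^ I.n < 2 ^ L := (Nat.pow_le_pow_right (by norm_num) (by omega)).trans_lt hfit.sets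
  refine wp_seq_frame (wp_trial hp₁.ready rfl hthr hfit.bits hfit.rank hnL hfit.M_lt hk hN
    (le_trans (by unfold trialCost; omega) hX) (le_trans (by unfold trialCost; omega) hX)
    (le_trans (by unfold trialCost; omega) hX)) ?_
  rintro m₂ t₂ f₂ ⟨ht₂, hacc⟩
  have h32 : m₂ 32 0 = if P then 1 else 0 := by
    rw [f₂ 32 fun h => (mem_writes_trial h).2.1 rfl, g₁ 32 (by simp), hflag]
  have hL1 : 1 < 2 ^ L := by omega
  refine wp_store hX1 (by simp; omega) ⟨by rw [ht₂, ht, add_mul, one_mul], ?_⟩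
  have hs : sch.enc (sch.trialValue I.n M (m₁ 18) (sch.trialThreshold I M g) (later t ω)) = 0 ↔
      ¬ sch.Success I M (m 18) ω g := by
    rw [enc_eq_zero, Success, not_not, g₁ 18 (by simp), ht]
  simp only [RExpr.eval_sub, RExpr.eval_add, RExpr.eval_get, RExpr.eval_lit, RExpr.eval_ofNat,
    Memory.write_same, h32, hacc]
  by_cases h1 : P
  · simp [h1]
  · by_cases h2 : sch.Success I M (m 18) ω g
    · have := mt hs.1 (not_not.2 h2)
      simp [h1, h2]; omega
    · have := hs.2 h2
      simp [h1, h2, this]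

open Classical in
theorem wp_search {M : ℕ} {I : SetCoverInstance} (hM1 : 1 ≤ M) (hfit : sch.Fits I M L)
    (hp : sch.Prepared I M m) (hX : sch.trialCost M *
      ((I.fam.length + 1) * (I.fam.length + 1) * sch.trialCount M + 1) ≤ X) :
    WP ω L X sch.search m 0 fun m' _ => m' 0 0 =
      if ∃ g < (I.fam.length + 1) * (I.fam.length + 1) * sch.trialCount M,
        sch.Success I M (m aCOVER) ω g then 1 else 0 := by
  have hc1 := sch.one_le_trialCost M
  have hX1 : 1 ≤ X := le_trans (Nat.mul_pos hc1 (by omega)) hX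
  have hw : ∀ a, a < 19 ∨ a = 36 → a ∉ (forLoop 39 (var vTOTAL) sch.numberedTrial).writes := by
    intro a ha h
    simp only [numberedTrial, forLoop, writes, List.cons_append, List.nil_append,
      List.mem_append, List.mem_cons, List.not_mem_nil, or_false] at h
    by_cases ht : a ∈ (trial sch.k sch.r sch.N sch.q).writes
    · have := mem_writes_trial ht
      omega
    · simp only [ht, false_or] at h
      omega
  refine wp_seq (wp_store hX1 (by simp) ?_)
  refine wp_seq (wp_forLoop (X := sch.trialCost M)
    ((I.fam.length + 1) * (I.fam.length + 1) * sch.trialCount M)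
    (fun g m' t' => t' = g * sch.trialTosses M ∧ m' vFLAG 0 =
      if ∃ g' < g, sch.Success I M (m aCOVER) ω g' then 1 else 0) ?_ hc1 ?_ hfit.trials ?_ ?_ ?_ hX
    ?_)
  · simp only [numberedTrial, writes, List.cons_append, List.nil_append,
      List.mem_append, List.mem_cons, List.not_mem_nil, or_false]
    have ht : 39 ∉ (trial sch.k sch.r sch.N sch.q).writes := fun h => (mem_writes_trial h).2.2.2.2 rfl
    simp [ht]
  · intro m' hfr
    simp [hfr 36 (hw 36 (by simp)), hp.total]
  · intro g m' t' v h
    simpa using h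
  · simp
  · rintro g m₁ t₁ hg h39 hfr ⟨ht, hflag⟩
    have g₁ : ∀ a, a < 19 ∨ a = 36 → m₁ a = m a := fun a ha => by
      rw [hfr a (hw a ha), Memory.write_of_ne _ _ _ (by omega)]
    refine (wp_numberedTrial hM1 hfit (hp.congr fun a h1 h2 => g₁ a (by omega)) hg h39
      (P := ∃ g' < g, sch.Success I M (m aCOVER) ω g') (hflag.trans (by congr)) ht le_rfl).mono ?_
    rintro m' t' ⟨ht', hflag'⟩
    refine ⟨ht', ?_⟩
    rw [hflag', g₁ 18 (by simp)]
    have : ((∃ g' < g, sch.Success I M (m 18) ω g') ∨ sch.Success I M (m 18) ω g) ↔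
        ∃ g' < g + 1, sch.Success I M (m 18) ω g' := by
      constructor
      · rintro (⟨g', h1, h2⟩ | h)
        · exact ⟨g', by omega, h2⟩
        · exact ⟨g, by omega, h⟩
      · rintro ⟨g', h1, h2⟩
        rcases Nat.lt_succ_iff_lt_or_eq.1 h1 with h1 | rfl
        · exact Or.inl ⟨g', h1, h2⟩
        · exact Or.inr h2
    by_cases h : ∃ g' < g + 1, sch.Success I M (m 18) ω g'
    · rw [if_pos (this.2 h), if_pos h]
    · rw [if_neg (mt this.1 h), if_neg h]
  · rintro m' t' ⟨-, hflag⟩ -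
    refine WP.of_small fun hsm => wp_store hX1 (by simpa using hsm _ _) ?_
    simp [hflag]

end Scheme

/-! ### Correctness of the algorithm -/

namespace RProg

/-- The program does not toss coins. -/
def TossFree : RProg → Prop
  | .skip => True
  | .store _ _ _ => True
  | .toss _ _ => False
  | .seq p q => p.TossFree ∧ q.TossFree
  | .cond _ p q => p.TossFree ∧ q.TossFree
  | .loop _ p => p.TossFree

theorem tossFree_table (a : ℕ) (f : ℕ → ℕ) (len : ℕ) : (table a f len).TossFree := by
  induction len with
  | zero => trivial
  | succ len ih => exact ⟨ih, trivial⟩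

/-- The preparatory part thus yields the same table of covering numbers for all outcomes, as the
probability estimates require: they treat the table as fixed. -/
theorem _root_.Exec.of_tossFree {ω ω' : ℕ → Bool} {p : RProg} {σ σ' : RState} {c : ℕ}
    (h : Exec ω p σ σ' c) (hp : p.TossFree) : Exec ω' p σ σ' c := by
  induction h with
  | skip σ => exact .skip σ
  | store a i e σ => exact .store a i e σ
  | toss => exact hp.elim
  | seq _ _ ih₁ ih₂ => exact .seq (ih₁ hp.1) (ih₂ hp.2)
  | cond_true h _ ih => exact .cond_true h (ih hp.1)
  | cond_false h _ ih => exact .cond_false h (ih hp.2)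
  | loop_true h _ _ ih₁ ih₂ => exact .loop_true h (ih₁ hp) (ih₂ hp)
  | loop_false h => exact .loop_false h

/-- `RProg.Accepts` only asks for some accepting run; by uniqueness it is the run that the program
logic constructs. -/
theorem _root_.Exec.deterministic {ω : ℕ → Bool} {p : RProg} {σ σ₁ σ₂ : RState} {c₁ c₂ : ℕ}
    (h₁ : Exec ω p σ σ₁ c₁) (h₂ : Exec ω p σ σ₂ c₂) : σ₁ = σ₂ := by
  induction h₁ generalizing σ₂ c₂ with
  | skip σ => cases h₂; rfl
  | store a i e σ => cases h₂; rfl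
  | toss a i σ => cases h₂; rfl
  | seq _ _ ih₁ ih₂ =>
    cases h₂ with
    | seq h h' => obtain rfl := ih₁ h; exact ih₂ h'
  | cond_true h _ ih =>
    cases h₂ with
    | cond_true _ h' => exact ih h'
    | cond_false h'' _ => exact absurd h'' h
  | cond_false h _ ih =>
    cases h₂ with
    | cond_true h'' _ => exact absurd h h''
    | cond_false _ h' => exact ih h'
  | loop_true h _ _ ih₁ ih₂ =>
    cases h₂ with
    | loop_true _ h' h'' => obtain rfl := ih₁ h'; exact ih₂ h''
    | loop_false h'' => exact absurd h'' h
  | loop_false h =>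
    cases h₂ with
    | loop_true h'' _ _ => exact absurd h h''
    | loop_false _ => rfl

end RProg

namespace Scheme

open RProg

variable {K : Type*} [Field K] (sch : Scheme K)
variable {ω : ℕ → Bool} {L X : ℕ} {m : Memory} {t : ℕ}

/-- The algorithm for `s`-set cover. -/
def algorithm (s : ℕ) : RProg := sch.setup s ;; sch.search

theorem tossFree_setup (s : ℕ) : (sch.setup s).TossFree := by
  simp [setup, tables, parameters, weights, RProg.power, listSets, listStep, coverTable, relaxProg,
    forLoop, TossFree, tossFree_table]

variable {sch}

theorem Fits.input_lt {I : SetCoverInstance} {M : ℕ} (h : sch.Fits I M L) (a i : ℕ) :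
    I.input a i < 2 ^ L := by
  have h1 := h.cover
  have h2 := h.sets
  have h3 : I.n < 2 ^ I.n := Nat.lt_two_pow_self
  have h4 : 2 ^ I.n ≤ 2 ^ (I.n + 1) := Nat.pow_le_pow_right (by norm_num) (by omega)
  unfold SetCoverInstance.input
  split
  · omega
  · omega
  · omega
  · split_ifs <;> omega
  · omega

theorem exists_wp_algorithm {s M : ℕ} {I : SetCoverInstance} (hM : M = sch.blockCount s I.n)
    (hfit : sch.Fits I M L) (hT : triCount sch.k ≤ 27 ^ sch.k) (hX₁ : M + 1 ≤ X)
    (hX₂ : (I.n + 1) * (I.fam.length + 1) * (smallSubsetCount I.n (M * sch.k) + 1) *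
      (I.fam.length + 1) ≤ X)
    (hX₃ : sch.trialCost M *
      ((I.fam.length + 1) * (I.fam.length + 1) * sch.trialCount M + 1) ≤ X) :
    ∃ mc, I.IsCoverTable (M * sch.k) mc ∧ ∀ ω, WP ω L X (sch.algorithm s) I.input 0 fun m' _ =>
      m' 0 0 = 1 ↔ ∃ g < (I.fam.length + 1) * (I.fam.length + 1) * sch.trialCount M,
        sch.Success I M mc ω g := by
  -- The preparation is executed once, with arbitrary tosses, to fix the table before `ω` is
  -- introduced.
  obtain ⟨m₁, t₁, c, hexec, hc, hm₁, rfl, hp⟩ :=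
    wp_setup (ω := fun _ => false) hM hfit hT hX₁ hX₂ hfit.input_lt
  refine ⟨_, hp.cover, fun ω => ?_⟩
  refine wp_seq fun _ => ⟨m₁, 0, c, hexec.of_tossFree (sch.tossFree_setup s), hc, hm₁, ?_⟩
  refine (wp_search (hM ▸ sch.one_le_blockCount s I.n) hfit hp hX₃).mono fun m' _ h => ?_
  rw [h]
  split_ifs with hs <;> simp [hs]

/-- The factor `32 = 2 * 16` and rounding up make the expected number of successes at least `2`. -/
theorem two_le_trialCount_mul {M : ℕ} {p : ℝ}
    (hp : (triCount sch.k : ℝ) ^ M / (16 * 27 ^ (M * sch.k)) ≤ p) : 2 ≤ sch.trialCount M * p := by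
  have hT : 0 < triCount sch.k ^ M := pow_pos (triCount_pos _) _
  have h : (27 ^ sch.k) ^ M < triCount sch.k ^ M * ((27 ^ sch.k) ^ M / triCount sch.k ^ M + 1) :=
    Nat.lt_mul_div_succ _ hT
  have h' : (27 : ℝ) ^ (M * sch.k) ≤ (triCount sch.k : ℝ) ^ M *
      (((27 ^ sch.k) ^ M / triCount sch.k ^ M + 1 : ℕ) : ℝ) := by
    rw [mul_comm M, pow_mul]
    exact_mod_cast h.le
  refine le_trans ?_ (mul_le_mul_of_nonneg_left hp (Nat.cast_nonneg _))
  have h27 : (0 : ℝ) < 27 ^ (M * sch.k) := by positivity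
  rw [trialCount, Nat.cast_mul, mul_div_assoc', le_div_iff₀ (by positivity)]
  push_cast at h' ⊢
  nlinarith

theorem le_blockCount_mul (sch : Scheme K) (s n : ℕ) :
    n + 2 * s ≤ sch.blockCount s n * (3 * sch.k) := by
  have hk : 0 < 3 * sch.k := by have := sch.k_pos; omega
  have := Nat.lt_mul_div_succ (n + 2 * s) hk
  rw [blockCount, ← add_assoc, Nat.add_div_right _ hk, mul_comm _ (3 * sch.k)]
  exact this.le

theorem two_thirds_le_prob_success {s M : ℕ} {I : SetCoverInstance} {mc : ℕ → ℕ}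
    (hM : M = sch.blockCount s I.n) (hmc : I.IsCoverTable (M * sch.k) mc)
    (hs : ∀ X ∈ I.fam, X.card ≤ s) (hI : I.IsYes) :
    2 / 3 ≤ prob fun ω => ∃ g < (I.fam.length + 1) * (I.fam.length + 1) * sch.trialCount M,
      sch.Success I M mc ω g := by
  have hn : I.n + 2 * s ≤ M * (3 * sch.k) := hM ▸ sch.le_blockCount_mul s I.n
  obtain ⟨j₁, hj₁, j₂, hj₂, h⟩ := exists_le_prob_trialValue (sch := sch) hmc hs hn hI
  -- The trials with the right thresholds have consecutive numbers, starting at this offset.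
  refine (two_thirds_le_prob_exists (sch.firstCoins_trialValue I.n M mc (threshold I.t j₁ j₂))
    (two_le_trialCount_mul h) ((j₁ * (I.fam.length + 1) + j₂) * sch.trialCount M)).trans
    (prob_mono ?_)
  rintro ω ⟨i, hi, hA⟩
  refine ⟨_, mul_add_lt (mul_add_lt (Nat.lt_succ_iff.2 hj₁) (Nat.lt_succ_iff.2 hj₂)) hi, ?_⟩
  rw [Success, trialThreshold, div_mul_add hi, div_mul_add (Nat.lt_succ_iff.2 hj₂),
    mod_mul_add (Nat.lt_succ_iff.2 hj₂)]
  exact hA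

theorem isYes_of_success {s M g : ℕ} {I : SetCoverInstance} {mc : ℕ → ℕ}
    (hM : M = sch.blockCount s I.n) (hmc : I.IsCoverTable (M * sch.k) mc)
    (hg : g < (I.fam.length + 1) * (I.fam.length + 1) * sch.trialCount M)
    (h : sch.Success I M mc ω g) : I.IsYes := by
  refine isYes_of_trialValue_ne_zero hmc ?_ ?_ ?_ h
  · have := sch.le_blockCount_mul s I.n
    rw [hM]
    omega
  · rw [← Nat.lt_succ_iff, Nat.div_lt_iff_lt_mul (by omega), Nat.div_lt_iff_lt_mul
      (sch.trialCount_pos M)]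
    exact hg
  · exact Nat.lt_succ_iff.1 (Nat.mod_lt _ (by omega))

theorem accepts_iff {p : RProg} {I : SetCoverInstance} (hin : ∀ a i, I.input a i < 2 ^ L)
    {P : (ℕ → Bool) → Prop} (h : ∀ ω, WP ω L X p I.input 0 fun m' _ => m' 0 0 = 1 ↔ P ω)
    (ω : ℕ → Bool) : p.Accepts I ω ↔ P ω := by
  obtain ⟨m', t', c, hexec, -, -, hm'⟩ := h ω hin
  rw [← hm']
  constructor
  · rintro ⟨σ, c', hexec', hσ⟩
    rwa [← hexec.deterministic hexec'] at hσ
  · intro h1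
    exact ⟨_, _, hexec, h1⟩

theorem accepts_correct {s M : ℕ} {I : SetCoverInstance} (hM : M = sch.blockCount s I.n)
    (hfit : sch.Fits I M L) (hT : triCount sch.k ≤ 27 ^ sch.k) (hX₁ : M + 1 ≤ X)
    (hX₂ : (I.n + 1) * (I.fam.length + 1) * (smallSubsetCount I.n (M * sch.k) + 1) *
      (I.fam.length + 1) ≤ X)
    (hX₃ : sch.trialCost M *
      ((I.fam.length + 1) * (I.fam.length + 1) * sch.trialCount M + 1) ≤ X)
    (hs : ∀ X ∈ I.fam, X.card ≤ s) :
    (I.IsYes → 2 / 3 ≤ coinMeasure {ω | (sch.algorithm s).Accepts I ω}) ∧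
    (¬ I.IsYes → coinMeasure {ω | (sch.algorithm s).Accepts I ω} ≤ 1 / 3) ∧
    ∀ ω, ∃ (σ : RState) (c : ℕ), Exec ω (sch.algorithm s) ⟨I.input, 0⟩ σ c ∧
      c ≤ (sch.algorithm s).weight * X * (L + 1) := by
  obtain ⟨mc, hmc, hwp⟩ := exists_wp_algorithm hM hfit hT hX₁ hX₂ hX₃
  have hset := Set.ext (accepts_iff hfit.input_lt hwp)
  refine ⟨fun hI => ?_, fun hI => ?_, fun ω => ?_⟩
  · have h := two_thirds_le_prob_success hM hmc hs hI
    rw [show {ω | (sch.algorithm s).Accepts I ω} = _ from hset]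
    refine (ENNReal.toReal_le_toReal (by finiteness) (measure_ne_top _ _)).1 ?_
    refine le_trans (le_of_eq ?_) h
    simp
  · rw [show {ω | (sch.algorithm s).Accepts I ω} = _ from hset]
    have : {ω | ∃ g < (I.fam.length + 1) * (I.fam.length + 1) * sch.trialCount M,
        sch.Success I M mc ω g} = ∅ := by
      refine Set.eq_empty_of_forall_notMem fun ω => ?_
      rintro ⟨g, hg, h⟩
      exact hI (isYes_of_success hM hmc hg h)
    refine le_trans (le_of_eq ?_) zero_le
    exact (congrArg coinMeasure this).trans measure_empty
  · obtain ⟨m', t', c, hexec, hc, -⟩ := hwp ω hfit.input_lt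
    exact ⟨_, c, hexec, hc⟩

end Scheme

/-! ### The running time of the algorithm -/

theorem triCount_le_pow (k : ℕ) : triCount k ≤ 27 ^ k := by
  refine (triCount_le_card k).trans ((Fintype.card_subtype_le _).trans ?_)
  simp [pow_mul]

/-- Give each set `S` the weight `2 ^ (K - |S|)`, which is at least `1` for small sets; over all
subsets the weights sum to `2 ^ K * (3 / 2) ^ (3 * K)`. This suffices because `27 / 4 < 8`. -/
theorem smallSubsetCount_le_pow {n K : ℕ} (hn : n ≤ 3 * K) :
    (smallSubsetCount n K : ℝ) ≤ (27 / 4) ^ K := by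
  calc (smallSubsetCount n K : ℝ) ≤ (smallSubsetCount (3 * K) K : ℝ) := by
        exact_mod_cast smallSubsetCount_mono hn K
    _ = ∑ S ∈ (Finset.range (3 * K)).powerset.filter fun S => S.card ≤ K, (1 : ℝ) := by
        simp [smallSubsetCount]
    _ ≤ ∑ S ∈ (Finset.range (3 * K)).powerset.filter fun S => S.card ≤ K,
        2 ^ K * (1 / 2 : ℝ) ^ S.card := by
        refine Finset.sum_le_sum fun S hS => ?_
        rw [one_div, inv_pow, ← div_eq_mul_inv, one_le_div (by positivity)]
        exact pow_le_pow_right₀ (by norm_num) (Finset.mem_filter.1 hS).2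
    _ ≤ ∑ S ∈ (Finset.range (3 * K)).powerset, 2 ^ K * (1 / 2 : ℝ) ^ S.card :=
        Finset.sum_le_sum_of_subset_of_nonneg (Finset.filter_subset _ _) fun _ _ _ => by positivity
    _ = 2 ^ K * (3 / 2) ^ (3 * K) := by
        have := Finset.sum_pow_mul_eq_add_pow (1 / 2 : ℝ) 1 (Finset.range (3 * K))
        simp only [one_pow, mul_one, Finset.card_range] at this
        rw [← Finset.mul_sum, this]
        norm_num
    _ = (27 / 4) ^ K := by rw [pow_mul, ← mul_pow]; norm_num

namespace SetCoverInstance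

variable (I : SetCoverInstance)

theorem n_lt_length : I.n + 1 ≤ I.length := by
  unfold length
  nlinarith [Nat.zero_le (I.n * I.fam.length), Nat.zero_le I.fam.length, Nat.zero_le I.t.size]

theorem card_fam_lt_length : I.fam.length + 1 ≤ I.length := by
  unfold length
  nlinarith [Nat.zero_le (I.n * I.fam.length), Nat.zero_le I.n, Nat.zero_le I.t.size]

theorem size_le_length : I.t.size ≤ I.length := Nat.le_add_left _ _

end SetCoverInstance

namespace Scheme

open RProg

variable {K : Type*} [Field K] (sch : Scheme K)

theorem blockCount_mul_le (s n : ℕ) :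
    sch.blockCount s n * (3 * sch.k) ≤ n + (2 * s + 3 * sch.k) := Nat.div_mul_le_self _ _

/-- Follows from the assumption on `r` and `triCount k ≤ 27 ^ k`; it keeps `r ^ M` within a number
of bits linear in `n`. -/
theorem r_lt : sch.r < 8 ^ sch.k := by
  have h := sch.r_mul_lt
  have h2 := triCount_le_pow sch.k
  unfold triCount at h2
  refine Nat.lt_of_mul_lt_mul_right (a := 27 ^ sch.k) (h.trans_le ?_)
  gcongr

/-- The number of bits per register. -/
def registerSize (s : ℕ) (I : SetCoverInstance) : ℕ :=
  sch.q + 6 * (sch.blockCount s I.n * (3 * sch.k)) + 2 * I.fam.length + I.t.size + 10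

theorem fits_registerSize (s : ℕ) (I : SetCoverInstance) :
    sch.Fits I (sch.blockCount s I.n) (sch.registerSize s I) := by
  have hk := sch.k_pos
  have hM1 := sch.one_le_blockCount s I.n
  have hle := sch.le_blockCount_mul s I.n
  unfold registerSize
  set M := sch.blockCount s I.n
  set P := M * (3 * sch.k) with hP
  have hP1 : 1 ≤ P := Nat.mul_pos hM1 (by omega)
  set L := sch.q + 6 * P + 2 * I.fam.length + I.t.size + 10 with hL
  have hlt : ∀ {a b : ℕ}, a ≤ 2 ^ b → b < L → a < 2 ^ L := fun h1 h2 =>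
    h1.trans_lt (Nat.pow_lt_pow_right (by norm_num) h2)
  have h27 : (27 ^ sch.k) ^ M ≤ 2 ^ (2 * P) := by
    calc (27 ^ sch.k) ^ M ≤ (64 ^ sch.k) ^ M := by gcongr; norm_num
      _ = 2 ^ (2 * P) := by
        rw [show (64 : ℕ) = 2 ^ 6 by norm_num, ← pow_mul, ← pow_mul, hP]
        congr 1; ring
  have hl : I.fam.length + 1 ≤ 2 ^ I.fam.length := Nat.lt_two_pow_self
  refine ⟨hlt (b := sch.q) Nat.lt_two_pow_self.le (by omega), by unfold bitCount; omega,
    hlt (b := I.n + 1) le_rfl (by omega), ?_, hlt h27 (by omega), ?_, ?_⟩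
  · refine hlt (b := P) ?_ (by omega)
    calc sch.r ^ M ≤ (8 ^ sch.k) ^ M := Nat.pow_le_pow_left sch.r_lt.le _
      _ = 2 ^ P := by
        rw [show (8 : ℕ) = 2 ^ 3 by norm_num, ← pow_mul, ← pow_mul, hP]
        congr 1; ring
  · refine hlt (b := I.fam.length + I.fam.length + (6 + 2 * P)) ?_ (by omega)
    rw [pow_add, pow_add]
    gcongr
    calc sch.trialCount M ≤ 32 * (2 ^ (2 * P) + 2 ^ (2 * P)) := by
          unfold trialCount
          gcongr
          · exact (Nat.div_le_self _ _).trans h27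
          · exact Nat.one_le_two_pow
      _ = 2 ^ (6 + 2 * P) := by rw [pow_add]; ring
  · refine hlt (b := I.fam.length + I.t.size + 1) ?_ (by omega)
    have ht : I.t + 1 ≤ 2 ^ I.t.size := Nat.lt_size_self _
    have h1 : 2 ^ I.fam.length ≤ 2 ^ (I.fam.length + I.t.size) :=
      Nat.pow_le_pow_right (by norm_num) (by omega)
    have h2 : 2 ^ I.t.size ≤ 2 ^ (I.fam.length + I.t.size) :=
      Nat.pow_le_pow_right (by norm_num) (by omega)
    rw [pow_succ]
    omega

theorem registerSize_lt (s : ℕ) (I : SetCoverInstance) :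
    sch.registerSize s I + 1 ≤ (sch.q + 12 * s + 18 * sch.k + 20) * I.length := by
  have h1 := sch.blockCount_mul_le s I.n
  have h2 := I.n_lt_length
  have h3 := I.card_fam_lt_length
  have h4 := I.size_le_length
  have h5 : (sch.q + 12 * s + 18 * sch.k + 11) * 1 ≤
      (sch.q + 12 * s + 18 * sch.k + 11) * I.length := Nat.mul_le_mul_left _ (by omega)
  have h6 : (sch.q + 12 * s + 18 * sch.k + 20) * I.length =
      (sch.q + 12 * s + 18 * sch.k + 11) * I.length + 9 * I.length := by ring
  unfold registerSize
  omega

theorem trialCost_le (M : ℕ) : sch.trialCost M ≤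
    ((6 * sch.k + 2) * (3 * sch.k + 1) + 2 * (3 * sch.k + 1) + 2 * (sch.N + 1)) *
      ((M + 1) ^ 2 * sch.r ^ M) := by
  have hr : 1 ≤ sch.r ^ M := Nat.pow_pos sch.r_pos
  have hN : sch.N ^ M ≤ sch.r ^ M := Nat.pow_le_pow_left sch.N_le _
  have hM : M + 1 ≤ (M + 1) ^ 2 := by nlinarith
  have h1 : bitCount (M * (3 * sch.k)) + 1 ≤ (6 * sch.k + 2) * (M + 1) := by
    unfold bitCount; nlinarith
  have h2 : M * (3 * sch.k) + 1 ≤ (3 * sch.k + 1) * (M + 1) := by nlinarith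
  unfold trialCost
  calc _ ≤ ((6 * sch.k + 2) * (M + 1)) * ((3 * sch.k + 1) * (M + 1)) * sch.r ^ M +
        (3 * sch.k + 1) * (M + 1) ^ 2 * (2 * sch.r ^ M) +
        (sch.N + 1) * (2 * sch.r ^ M) * (M + 1) ^ 2 := by
        refine Nat.add_le_add (Nat.add_le_add ?_ ?_) ?_
        · exact (Nat.mul_le_mul h1 h2).trans (Nat.le_mul_of_pos_right _ hr)
        · exact Nat.mul_le_mul (Nat.mul_le_mul_left _ hM) (by omega)
        · exact Nat.mul_le_mul (Nat.mul_le_mul_left _ (by omega)) hM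
    _ = _ := by ring

/-- The base of the exponential running time, per block. -/
noncomputable def growth : ℝ := max (27 ^ sch.k * sch.r / triCount sch.k) ((27 / 4) ^ sch.k)

/-- The first term is below `8 ^ k` precisely by the assumption on the rank: repetitions times cost
of a trial. The second term belongs to the table of covering numbers. -/
theorem growth_lt : sch.growth < 8 ^ sch.k := by
  have hT : (0 : ℝ) < triCount sch.k := by exact_mod_cast triCount_pos _
  refine max_lt ?_ ?_
  · rw [div_lt_iff₀ hT, mul_comm]
    exact_mod_cast sch.r_mul_lt
  · exact pow_lt_pow_left₀ (by norm_num) (by norm_num) sch.k_pos.ne'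

theorem one_le_growth : 1 ≤ sch.growth :=
  (one_le_pow₀ (by norm_num)).trans (le_max_right _ _)

theorem pow_mul_trialCount_le (M : ℕ) :
    (sch.r : ℝ) ^ M * sch.trialCount M ≤ 64 * sch.growth ^ M := by
  have hT : (0 : ℝ) < triCount sch.k := by exact_mod_cast triCount_pos _
  have hT' : (triCount sch.k : ℝ) ≤ 27 ^ sch.k := by exact_mod_cast triCount_le_pow _
  have h1 : (sch.trialCount M : ℝ) ≤ 64 * ((27 ^ sch.k) ^ M / (triCount sch.k : ℝ) ^ M) := by
    have h2 : (((27 ^ sch.k) ^ M / triCount sch.k ^ M : ℕ) : ℝ) ≤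
        (27 ^ sch.k) ^ M / (triCount sch.k : ℝ) ^ M := by
      refine Nat.cast_div_le.trans (le_of_eq ?_)
      push_cast
      rfl
    have h3 : 1 ≤ ((27 : ℝ) ^ sch.k) ^ M / (triCount sch.k : ℝ) ^ M := by
      rw [one_le_div (by positivity)]
      gcongr
    unfold trialCount
    rw [Nat.cast_mul, Nat.cast_add, Nat.cast_one]
    push_cast at h2 ⊢
    linarith
  calc (sch.r : ℝ) ^ M * sch.trialCount M
      ≤ (sch.r : ℝ) ^ M * (64 * ((27 ^ sch.k) ^ M / (triCount sch.k : ℝ) ^ M)) := by gcongr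
    _ = 64 * (27 ^ sch.k * sch.r / triCount sch.k) ^ M := by
        rw [div_pow, mul_pow]; ring
    _ ≤ _ := by
        gcongr
        exact le_max_left _ _

/-- A bound for the number of times that a part of the algorithm is executed. -/
def stepBound (s : ℕ) (I : SetCoverInstance) : ℕ :=
  (sch.blockCount s I.n + 1) +
  (I.n + 1) * (I.fam.length + 1) * (smallSubsetCount I.n (sch.blockCount s I.n * sch.k) + 1) *
    (I.fam.length + 1) +
  sch.trialCost (sch.blockCount s I.n) *
    ((I.fam.length + 1) * (I.fam.length + 1) * sch.trialCount (sch.blockCount s I.n) + 1)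

/-- In the dominant term two powers of the length come from the pairs `(j₁, j₂)` and two from the
polynomial factor `(M + 1) ^ 2` in the cost of a trial. -/
theorem exists_stepBound_le (s : ℕ) : ∃ c : ℝ, 0 ≤ c ∧ ∀ I : SetCoverInstance,
    (sch.stepBound s I : ℝ) ≤ c * (I.length : ℝ) ^ 4 * sch.growth ^ sch.blockCount s I.n := by
  set c₁ : ℕ := (6 * sch.k + 2) * (3 * sch.k + 1) + 2 * (3 * sch.k + 1) + 2 * (sch.N + 1)
  set c₂ : ℕ := 2 * s + 3 * sch.k + 1 with hc₂
  refine ⟨c₂ + 2 + 128 * c₁ * c₂ ^ 2, by positivity, fun I => ?_⟩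
  set M := sch.blockCount s I.n with hM
  have hk := sch.k_pos
  have hn : (I.n : ℝ) + 1 ≤ I.length := by exact_mod_cast I.n_lt_length
  have hl : (I.fam.length : ℝ) + 1 ≤ I.length := by exact_mod_cast I.card_fam_lt_length
  have h1 : (1 : ℝ) ≤ I.length := le_trans (by linarith [Nat.cast_nonneg (α := ℝ) I.n]) hn
  have hMle : (M : ℝ) + 1 ≤ c₂ * I.length := by
    have h2 : M + 1 ≤ c₂ * (I.n + 1) := by
      have h3 : M * (3 * sch.k) ≤ I.n + (2 * s + 3 * sch.k) := sch.blockCount_mul_le s I.n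
      have h4 : M ≤ M * (3 * sch.k) := Nat.le_mul_of_pos_right _ (by omega)
      have h5 : c₂ * (I.n + 1) = (2 * s + 3 * sch.k) * I.n + I.n + c₂ := by rw [hc₂]; ring
      omega
    calc (M : ℝ) + 1 ≤ c₂ * (I.n + 1) := by exact_mod_cast h2
      _ ≤ c₂ * I.length := by gcongr
  have hg1 : 1 ≤ sch.growth ^ M := one_le_pow₀ sch.one_le_growth
  have hpow : ∀ i : ℕ, i ≤ 4 → (I.length : ℝ) ^ i ≤ (I.length : ℝ) ^ 4 := fun _ hi =>
    pow_le_pow_right₀ h1 hi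
  have hssc : (smallSubsetCount I.n (M * sch.k) : ℝ) + 1 ≤ 2 * sch.growth ^ M := by
    have h2 : (smallSubsetCount I.n (M * sch.k) : ℝ) ≤ sch.growth ^ M := by
      refine (smallSubsetCount_le_pow ?_).trans ?_
      · have : I.n + 2 * s ≤ M * (3 * sch.k) := sch.le_blockCount_mul s I.n
        have h3 : M * (3 * sch.k) = 3 * (M * sch.k) := by ring
        omega
      · rw [mul_comm M, pow_mul]
        exact pow_le_pow_left₀ (by positivity) (le_max_right _ _) M
    linarith
  have htot : ((I.fam.length : ℝ) + 1) * (I.fam.length + 1) * sch.trialCount M + 1 ≤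
      2 * ((I.length : ℝ) ^ 2 * sch.trialCount M) := by
    have hB : (1 : ℝ) ≤ sch.trialCount M := by exact_mod_cast sch.trialCount_pos M
    have h2 : ((I.fam.length : ℝ) + 1) * (I.fam.length + 1) * sch.trialCount M ≤
        (I.length : ℝ) ^ 2 * sch.trialCount M := by
      rw [sq]; gcongr
    have h3 : (1 : ℝ) ≤ (I.length : ℝ) ^ 2 * sch.trialCount M :=
      one_le_mul_of_one_le_of_one_le (one_le_pow₀ h1) hB
    linarith
  have hcost : (sch.trialCost M : ℝ) ≤ c₁ * ((M + 1) ^ 2 * sch.r ^ M) := by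
    exact_mod_cast sch.trialCost_le M
  have e1 : (M : ℝ) + 1 ≤ c₂ * (I.length : ℝ) ^ 4 * sch.growth ^ M := by
    calc (M : ℝ) + 1 ≤ c₂ * I.length := hMle
      _ = c₂ * (I.length : ℝ) ^ 1 * 1 := by ring
      _ ≤ _ := mul_le_mul (mul_le_mul_of_nonneg_left (hpow 1 (by norm_num)) (by positivity)) hg1
          zero_le_one (by positivity)
  have e2 : ((I.n : ℝ) + 1) * (I.fam.length + 1) * (smallSubsetCount I.n (M * sch.k) + 1) *
      (I.fam.length + 1) ≤ 2 * (I.length : ℝ) ^ 4 * sch.growth ^ M := by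
    calc _ ≤ (I.length : ℝ) * I.length * (2 * sch.growth ^ M) * I.length := by gcongr
      _ = 2 * (I.length : ℝ) ^ 3 * sch.growth ^ M := by ring
      _ ≤ _ := mul_le_mul_of_nonneg_right
          (mul_le_mul_of_nonneg_left (hpow 3 (by norm_num)) (by norm_num)) (by positivity)
  have e3 : (sch.trialCost M : ℝ) * ((I.fam.length + 1) * (I.fam.length + 1) * sch.trialCount M + 1)
      ≤ 128 * c₁ * c₂ ^ 2 * (I.length : ℝ) ^ 4 * sch.growth ^ M := by
    calc _ ≤ c₁ * ((c₂ * I.length) ^ 2 * sch.r ^ M) *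
          (2 * ((I.length : ℝ) ^ 2 * sch.trialCount M)) := by
          refine mul_le_mul (hcost.trans ?_) htot (by positivity) (by positivity)
          gcongr
      _ = 2 * c₁ * c₂ ^ 2 * (I.length : ℝ) ^ 4 * (sch.r ^ M * sch.trialCount M) := by ring
      _ ≤ 2 * c₁ * c₂ ^ 2 * (I.length : ℝ) ^ 4 * (64 * sch.growth ^ M) :=
          mul_le_mul_of_nonneg_left (sch.pow_mul_trialCount_le M) (by positivity)
      _ = _ := by ring
  unfold stepBound
  push_cast
  linarith

/-- The exponent of the running time. -/
noncomputable def exponent : ℝ := Real.logb 2 sch.growth / (3 * sch.k)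

theorem exponent_nonneg : 0 ≤ sch.exponent :=
  div_nonneg (Real.logb_nonneg (by norm_num) sch.one_le_growth) (by positivity)

theorem exponent_lt : sch.exponent < 1 := by
  have hk : (0 : ℝ) < 3 * sch.k := by have := sch.k_pos; positivity
  rw [exponent, div_lt_one hk, Real.logb_lt_iff_lt_rpow (by norm_num)
    (zero_lt_one.trans_le sch.one_le_growth), show (3 * sch.k : ℝ) = ((3 * sch.k : ℕ) : ℝ) by simp,
    Real.rpow_natCast, pow_mul]
  norm_num
  exact sch.growth_lt

/-- The blocks contain at most `2s + 3k` elements more than the universe. As the exponent per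
element is below `1`, they cost only a factor depending on `s` and `k`. -/
theorem growth_pow_le (s n : ℕ) : sch.growth ^ sch.blockCount s n ≤
    2 ^ (2 * s + 3 * sch.k) * (2 : ℝ) ^ (sch.exponent * n) := by
  have hk : (0 : ℝ) < 3 * sch.k := by have := sch.k_pos; positivity
  have hg : 0 < sch.growth := zero_lt_one.trans_le sch.one_le_growth
  have h1 : sch.growth = (2 : ℝ) ^ (sch.exponent * (3 * sch.k)) := by
    rw [exponent, div_mul_cancel₀ _ hk.ne', Real.rpow_logb (by norm_num) (by norm_num) hg]
  have h2 : (sch.blockCount s n : ℝ) * (3 * sch.k) ≤ n + (2 * s + 3 * sch.k) := by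
    exact_mod_cast sch.blockCount_mul_le s n
  have h3 := sch.exponent_nonneg
  have h4 := sch.exponent_lt
  calc sch.growth ^ sch.blockCount s n
      = (2 : ℝ) ^ (sch.exponent * (sch.blockCount s n * (3 * sch.k))) := by
        conv_lhs => rw [h1]
        rw [← Real.rpow_natCast, ← Real.rpow_mul (by norm_num)]
        congr 1; ring
    _ ≤ (2 : ℝ) ^ (((2 * s + 3 * sch.k : ℕ) : ℝ) + sch.exponent * n) := by
        refine Real.rpow_le_rpow_of_exponent_le (by norm_num) ?_
        have h5 : (0 : ℝ) ≤ 2 * s + 3 * sch.k := by positivity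
        push_cast
        calc sch.exponent * (sch.blockCount s n * (3 * sch.k))
            ≤ sch.exponent * (n + (2 * s + 3 * sch.k)) := by gcongr
          _ ≤ _ := by nlinarith
    _ = _ := by rw [Real.rpow_add (by norm_num), Real.rpow_natCast]

theorem _root_.cost_le_of_le {cost w S R c G E P c' l : ℝ} (hcost : cost ≤ w * S * R)
    (hS : S ≤ c * l ^ 4 * G) (hG : G ≤ E * P) (hR : R ≤ c' * l) (hw : 0 ≤ w) (hR0 : 0 ≤ R)
    (hc : 0 ≤ c) (hl : 0 ≤ l) (hE : 0 ≤ E) (hP : 0 ≤ P) :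
    cost ≤ ⌈w * (c * E) * c'⌉₊ * l ^ 5 * P := by
  calc cost ≤ w * S * R := hcost
    _ ≤ w * (c * l ^ 4 * (E * P)) * (c' * l) := by
        gcongr
        exact hS.trans (by gcongr)
    _ = w * (c * E) * c' * l ^ 5 * P := by ring
    _ ≤ _ := by
        gcongr
        exact Nat.le_ceil _

theorem solvesSetCover (s : ℕ) : (sch.algorithm s).SolvesSetCover s (1 - sch.exponent) := by
  have hcorrect := fun (I : SetCoverInstance) => accepts_correct (sch := sch) (s := s) (I := I)
    (X := sch.stepBound s I) rfl (sch.fits_registerSize s I) (triCount_le_pow _)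
    (by unfold stepBound; omega) (by unfold stepBound; omega) (by unfold stepBound; omega)
  refine ⟨fun I hI => ⟨(hcorrect I hI).1, (hcorrect I hI).2.1⟩, ?_⟩
  obtain ⟨c, hc, hstep⟩ := sch.exists_stepBound_le s
  refine ⟨⌈((sch.algorithm s).weight : ℝ) * (c * 2 ^ (2 * s + 3 * sch.k)) *
    (sch.q + 12 * s + 18 * sch.k + 20 : ℕ)⌉₊, 5, fun I hI ω => ?_⟩
  obtain ⟨σ, cost, hexec, hcost⟩ := (hcorrect I hI).2.2 ω
  refine ⟨σ, cost, hexec, ?_⟩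
  rw [sub_sub_cancel]
  exact cost_le_of_le (R := ((sch.registerSize s I + 1 : ℕ) : ℝ)) (by exact_mod_cast hcost)
    (hstep I) (sch.growth_pow_le s I.n) (by exact_mod_cast sch.registerSize_lt s I)
    (Nat.cast_nonneg _) (Nat.cast_nonneg _) hc (Nat.cast_nonneg _) (by positivity) (by positivity)

/-- The exponent depends on the decomposition but not on `s`. Hence one `ε` is refuted by algorithms
for all `s`. -/
theorem not_setCoverConjecture (sch : Scheme K) : ¬ SetCoverConjecture := by
  intro h
  obtain ⟨s, hs⟩ := h (1 - sch.exponent) (sub_pos.2 sch.exponent_lt)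
  exact hs ⟨_, sch.solvesSetCover s⟩

end Scheme

/-! ### The theorem -/

theorem not_setCoverConjecture_of_rank_lt {F : Type*} [Field F] {k : ℕ} (hk : 1 ≤ k)
    (hr : (tripartitionTensor F k).rank * 27 ^ k < 8 ^ k * triCount k) : ¬ SetCoverConjecture := by
  obtain ⟨K, iK, ⟨sch⟩⟩ := exists_scheme hk hr
  exact sch.not_setCoverConjecture

/-! ### Numerical estimates for the number of balanced tripartitions -/

theorem triCount_succ (k : ℕ) :
    -- A factor `k + 1` is already cancelled: `triCount k` is `(3k)! / k! ^ 3`, and `3k + 3 = 3 (k +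
    -- 1)`.
    (k + 1) ^ 2 * triCount (k + 1) = 3 * (3 * k + 2) * (3 * k + 1) * triCount k := by
  have key : ∀ j, triCount j * j.factorial ^ 3 = (3 * j).factorial := by
    intro j
    have h1 := Nat.choose_mul_factorial_mul_factorial (show j ≤ 3 * j by omega)
    have h2 := Nat.choose_mul_factorial_mul_factorial (show j ≤ 2 * j by omega)
    rw [show 3 * j - j = 2 * j by omega] at h1
    rw [show 2 * j - j = j by omega] at h2
    rw [← h1, ← h2, triCount]
    ring
  have h1 := key (k + 1)
  rw [show 3 * (k + 1) = 3 * k + 1 + 1 + 1 by ring, Nat.factorial_succ, Nat.factorial_succ,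
    Nat.factorial_succ, Nat.factorial_succ, ← key k] at h1
  have hpos : 0 < (k + 1) * k.factorial ^ 3 := by positivity
  refine Nat.eq_of_mul_eq_mul_right hpos ?_
  linear_combination h1

/-- The quantity `k * triCount k / 27 ^ k` does not decrease, because `3 (3k + 2) (3k + 1) = 27 k (k
+ 1) + 6`. The constant `2 / 9` is its value at `k = 1`, where equality holds. -/
theorem two_mul_pow_le (k : ℕ) (hk : 1 ≤ k) : 2 * 27 ^ k ≤ 9 * k * triCount k := by
  induction k, hk using Nat.le_induction with
  | base => simp [triCount]
  | succ k hk ih =>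
    have h := triCount_succ k
    refine Nat.le_of_mul_le_mul_left ?_ (show 0 < k * (k + 1) by positivity)
    have e1 : k * (k + 1) * (9 * (k + 1) * triCount (k + 1)) =
        (9 * k * triCount k) * (3 * (3 * k + 2) * (3 * k + 1)) := by
      linear_combination 9 * k * h
    have e2 : 27 * (k * (k + 1)) ≤ 3 * (3 * k + 2) * (3 * k + 1) := by nlinarith
    calc k * (k + 1) * (2 * 27 ^ (k + 1)) = (2 * 27 ^ k) * (27 * (k * (k + 1))) := by ring
      _ ≤ (9 * k * triCount k) * (3 * (3 * k + 2) * (3 * k + 1)) := Nat.mul_le_mul ih e2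
      _ = _ := e1.symm

/-- The right-hand side is not divisible by `3`. Thus `rank ≤ 2 / (9k) * 8 ^ k` can never be an
equality, and the strict inequality needed for the algorithm holds even for `k = 1`, where
`two_mul_pow_le` has no slack. -/
theorem nine_mul_ne (a k : ℕ) : 9 * a ≠ 2 * 8 ^ k := by
  intro h
  have h3 : 3 ∣ 2 * 8 ^ k := ⟨3 * a, by omega⟩
  rcases (Nat.Prime.dvd_mul Nat.prime_three).1 h3 with h3 | h3
  · omega
  · have := Nat.Prime.dvd_of_dvd_pow Nat.prime_three h3
    omega

theorem corollary4 {F : Type*} [Field F] :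
    (SetCoverConjecture → ∀ k : ℕ, 1 ≤ k →
      (8 : ℝ) ^ k * (Nat.choose (3 * k) k : ℝ) * (Nat.choose (2 * k) k : ℝ) / (27 : ℝ) ^ k
          ≤ ((tripartitionTensor F k).rank : ℝ) ∧
      2 / 9 * (8 : ℝ) ^ k * (k : ℝ)⁻¹
          ≤ (8 : ℝ) ^ k * (Nat.choose (3 * k) k : ℝ) * (Nat.choose (2 * k) k : ℝ) / (27 : ℝ) ^ k) ∧
    (∀ k : ℕ, 1 ≤ k →
      ((tripartitionTensor F k).rank : ℝ) ≤ 2 / (9 * (k : ℝ)) * (8 : ℝ) ^ k →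
        ¬ SetCoverConjecture) := by
  refine ⟨fun h k hk => ⟨?_, ?_⟩, fun k hk hr => not_setCoverConjecture_of_rank_lt (F := F) hk ?_⟩
  · by_contra! hlt
    refine not_setCoverConjecture_of_rank_lt (F := F) hk ?_ h
    rw [lt_div_iff₀ (by positivity), mul_assoc] at hlt
    unfold triCount
    exact_mod_cast hlt
  · have hk' : (0 : ℝ) < k := by exact_mod_cast hk
    have h2 : (2 : ℝ) * 27 ^ k ≤ 9 * k * (Nat.choose (3 * k) k * Nat.choose (2 * k) k) := by
      exact_mod_cast two_mul_pow_le k hk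
    rw [le_div_iff₀ (by positivity), ← div_eq_mul_inv, div_mul_eq_mul_div, div_le_iff₀ hk']
    have h8 : (0 : ℝ) < 8 ^ k := by positivity
    nlinarith
  · have hk' : (0 : ℝ) < k := by exact_mod_cast hk
    have h1 : 9 * (k * (tripartitionTensor F k).rank) ≤ 2 * 8 ^ k := by
      rw [div_mul_eq_mul_div, le_div_iff₀ (by positivity)] at hr
      have : ((tripartitionTensor F k).rank : ℝ) * (9 * k) ≤ 2 * 8 ^ k := hr
      have h2 : (tripartitionTensor F k).rank * (9 * k) ≤ 2 * 8 ^ k := by exact_mod_cast this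
      linarith
    have h2 := lt_of_le_of_ne h1 (nine_mul_ne _ _)
    have h3 := two_mul_pow_le k hk
    refine Nat.lt_of_mul_lt_mul_left (a := 9 * k) ?_
    calc 9 * k * ((tripartitionTensor F k).rank * 27 ^ k)
        = 9 * (k * (tripartitionTensor F k).rank) * 27 ^ k := by ring
      _ < 2 * 8 ^ k * 27 ^ k := by gcongr
      _ = 8 ^ k * (2 * 27 ^ k) := by ring
      _ ≤ 8 ^ k * (9 * k * triCount k) := by gcongr
      _ = _ := by ring
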